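/- Let $(U_i)_{i\ge1}$ be independent random variables, uniformly distributed on $[0,1]$; put $F_n(x)=n^{-1}\#\{1\le i\le n: U_i\le x\}$, $\alpha_n(x)=\sqrt n\,(F_n(x)-x)$ and $\log_2 u=\log\log(u\vee 3)$. Fix $t\in[0,1)$ and, for $h>0$, let $\mathcal D_{n,h,t}(s)=\alpha_n(t+hs)-\alpha_n(t)$, $s\in[0,1]$. Let $B[0,1]$ be the space of bounded càdlàg functions on $[0,1]$ with the sup norm $\|\cdot\|$, let $k\ge2$ be an integer, and endow $B[0,1]^k$ with the norm $\max_{l\le k}\|g_l\|$. Let $$\mathcal S_k=\Big\{(g_1,\dots,g_k): \text{each } g_j \text{ is absolutely continuous on } [0,1],\ g_j(0)=0,\ \sum_{j=1}^k\int_0^1\dot g_j(x)^2\,dx\le1\Big\}.$$ Let $0<h_{n,1}<\dots<h_{n,k}<1$ be sequences such that, ultimately as $n\to\infty$, $h_{n,l}/h_{n,l+1}\downarrow0$ for $l=1,\dots,k-1$, $h_{n,k}\downarrow0$ and $nh_{n,1}\uparrow\infty$ (the arrows mean ultimately monotone, and convergent to the stated limit), and such that $nh_{n,1}/\log_2 n\to\infty$.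 Then, almost surely, the sequence $$\Big(\frac{\mathcal D_{n,h_{n,1},t}}{(2h_{n,1}\log_2 n)^{1/2}},\dots,\frac{\mathcal D_{n,h_{n,k},t}}{(2h_{n,k}\log_2 n)^{1/2}}\Big)_{n\ge1}$$ is relatively compact in $B[0,1]^k$, and the set of its cluster points is exactly the (non-empty) set $\mathcal S_k$. -/

import Mathlib

open MeasureTheory ProbabilityTheory Filter Topology
open scoped ENNReal

namespace LocalEmpirical

noncomputable section

/-! ### The space `B[0,1]` of bounded càdlàg functions with the sup norm -/

/-- Càdlàg on `[0,1]`: right-continuous at every point, with a finite left limit at every point.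
(At `s = 1` the first, and at `s = 0` the second requirement is vacuous.) -/
def IsCadlag (f : unitInterval → ℝ) : Prop :=
  ∀ s, ContinuousWithinAt f (Set.Ici s) s ∧ ∃ l : ℝ, Tendsto f (𝓝[<] s) (𝓝 l)

/-- `B[0,1]`: the bounded càdlàg functions on `[0,1]`, with the sup norm, as a subspace of the
Banach space of all bounded functions on `[0,1]`. -/
abbrev CadlagSpace : Submodule ℝ (lp (fun _ : unitInterval => ℝ) ∞) where
  carrier := {f | IsCadlag fun s => f s}
  zero_mem' := fun s => ⟨continuousWithinAt_const, 0, tendsto_const_nhds⟩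
  add_mem' := by
    intro f g hf hg s
    obtain ⟨hf1, a, ha⟩ := hf s
    obtain ⟨hg1, b, hb⟩ := hg s
    exact ⟨hf1.add hg1, a + b, ha.add hb⟩
  smul_mem' := by
    intro c f hf s
    obtain ⟨hf1, a, ha⟩ := hf s
    exact ⟨hf1.const_smul c, c • a, ha.const_smul c⟩

/-! ### Strassen balls -/

/-- A function on `[0,1]`, seen as a function on `ℝ` (constant outside `[0,1]`). -/
def extendToReal (g : CadlagSpace) : ℝ → ℝ :=
  Set.IccExtend (zero_le_one (α := ℝ)) fun s => g.1 s

/-- `‖g‖_H² = ∫₀¹ ġ(x)² dx ∈ [0,∞]`, meant for absolutely continuous `g` (for which the derivative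
exists almost everywhere). -/
def hilbertNormSq (g : CadlagSpace) : ℝ≥0∞ :=
  ∫⁻ x in Set.Icc (0 : ℝ) 1, ENNReal.ofReal (deriv (extendToReal g) x ^ 2)

/-- The Strassen-type set `𝒮_k`: `k`-tuples of absolutely continuous functions on `[0,1]` which
vanish at `0` and satisfy `∑ ‖g_j‖_H² ≤ 1`. -/
def strassenBall (k : ℕ) : Set (Fin k → CadlagSpace) :=
  {g | (∀ j, AbsolutelyContinuousOnInterval (extendToReal (g j)) 0 1) ∧ (∀ j, (g j).1 0 = 0) ∧
    ∑ j, hilbertNormSq (g j) ≤ 1}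

/-! ### The local empirical process -/

/-- `log₂ u = log (log (u ∨ 3))`. -/
def log₂ (u : ℝ) : ℝ := Real.log (Real.log (max u 3))

/-- The empirical distribution function `F_n` of the points `u 0, …, u (n - 1)`. -/
def empiricalCDF (u : ℕ → ℝ) (n : ℕ) (x : ℝ) : ℝ :=
  (((Finset.range n).filter fun i => u i ≤ x).card : ℝ) / n

/-- The uniform empirical process `α_n(x) = √n (F_n(x) - x)`. -/
def empiricalProcess (u : ℕ → ℝ) (n : ℕ) (x : ℝ) : ℝ :=
  √(n : ℝ) * (empiricalCDF u n x - x)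

/-- The increment `s ↦ α_n(t + h s) - α_n(t)`, as a plain function on `[0,1]`. -/
def localIncrement (u : ℕ → ℝ) (n : ℕ) (h t : ℝ) (s : unitInterval) : ℝ :=
  empiricalProcess u n (t + h * s) - empiricalProcess u n t

theorem empiricalCDF_mono (u : ℕ → ℝ) (n : ℕ) : Monotone (empiricalCDF u n) := by
  intro x y hxy
  unfold empiricalCDF
  gcongr

theorem empiricalCDF_nonneg (u : ℕ → ℝ) (n : ℕ) (x : ℝ) : 0 ≤ empiricalCDF u n x := by
  unfold empiricalCDF
  positivity

theorem empiricalCDF_le_one (u : ℕ → ℝ) (n : ℕ) (x : ℝ) : empiricalCDF u n x ≤ 1 := by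
  unfold empiricalCDF
  apply div_le_one_of_le₀ _ (Nat.cast_nonneg n)
  exact_mod_cast (Finset.card_filter_le _ _).trans (by simp)

theorem empiricalCDF_rightCont (u : ℕ → ℝ) (n : ℕ) (x : ℝ) :
    ContinuousWithinAt (empiricalCDF u n) (Set.Ici x) x := by
  have key : ∀ᶠ y in 𝓝[≥] x, empiricalCDF u n y = empiricalCDF u n x := by
    have h1 : ∀ i ∈ Finset.range n, ∀ᶠ y in 𝓝[≥] x, (u i ≤ y ↔ u i ≤ x) := by
      intro i _
      by_cases hi : u i ≤ x
      · filter_upwards [self_mem_nhdsWithin] with y hy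
        exact ⟨fun _ => hi, fun h => h.trans hy⟩
      · filter_upwards [mem_nhdsWithin_of_mem_nhds (Iio_mem_nhds (not_le.1 hi))] with y hy
        exact ⟨fun h => absurd hy (not_lt.2 h), fun h => absurd h hi⟩
    have h2 := (Filter.eventually_all_finset (Finset.range n)).2 h1
    filter_upwards [h2] with y hy
    unfold empiricalCDF
    rw [Finset.filter_congr hy]
  exact tendsto_const_nhds.congr' (key.mono fun y hy => hy.symm)

theorem localIncrement_isCadlag (u : ℕ → ℝ) (n : ℕ) {h : ℝ} (hh : 0 ≤ h) (t : ℝ) :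
    IsCadlag (localIncrement u n h t) := by
  have hmono : Monotone fun s : unitInterval => t + h * (s : ℝ) := by
    intro a b hab
    have : (a : ℝ) ≤ b := hab
    dsimp only
    gcongr
  have hcont : Continuous fun s : unitInterval => t + h * (s : ℝ) := by fun_prop
  intro s
  constructor
  · have h1 : ContinuousWithinAt (fun s : unitInterval => empiricalCDF u n (t + h * (s : ℝ)))
        (Set.Ici s) s :=
      (empiricalCDF_rightCont u n _).comp hcont.continuousWithinAt fun y hy => hmono hy
    exact ((h1.sub hcont.continuousWithinAt).const_smul (√(n : ℝ))).sub continuousWithinAt_const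
  · have h2 : Monotone fun s : unitInterval => empiricalCDF u n (t + h * (s : ℝ)) :=
      (empiricalCDF_mono u n).comp hmono
    obtain ⟨l, hl⟩ : ∃ l : ℝ, Tendsto (fun s : unitInterval => empiricalCDF u n (t + h * (s : ℝ)))
        (𝓝[<] s) (𝓝 l) := ⟨_, h2.tendsto_nhdsLT s⟩
    have h3 : Tendsto (fun s : unitInterval => t + h * (s : ℝ)) (𝓝[<] s) (𝓝 (t + h * (s : ℝ))) :=
      hcont.continuousWithinAt
    exact ⟨_, ((hl.sub h3).const_mul (√(n : ℝ))).sub_const _⟩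

theorem localIncrement_memℓp (u : ℕ → ℝ) (n : ℕ) (h t : ℝ) :
    Memℓp (localIncrement u n h t) ∞ := by
  apply memℓp_infty
  refine ⟨√(n : ℝ) * (1 + |h|), ?_⟩
  rintro _ ⟨s, rfl⟩
  have e : localIncrement u n h t s =
      √(n : ℝ) * (empiricalCDF u n (t + h * s) - empiricalCDF u n t - h * s) := by
    unfold localIncrement empiricalProcess
    ring
  dsimp only
  rw [e, norm_mul, Real.norm_of_nonneg (Real.sqrt_nonneg _), Real.norm_eq_abs]
  gcongr
  have h1 := empiricalCDF_nonneg u n (t + h * s)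
  have h2 := empiricalCDF_le_one u n (t + h * s)
  have h3 := empiricalCDF_nonneg u n t
  have h4 := empiricalCDF_le_one u n t
  have h5 : |h * (s : ℝ)| ≤ |h| := by
    rw [abs_mul, abs_of_nonneg s.2.1]
    exact mul_le_of_le_one_right (abs_nonneg h) s.2.2
  refine (abs_sub _ _).trans (add_le_add ?_ h5)
  rw [abs_le]
  constructor <;> linarith

/-- The local empirical process `𝒟_{n,h,t}`, `𝒟_{n,h,t}(s) = α_n(t + h s) - α_n(t)`, as an element
of `B[0,1]`. -/
def localProcess (u : ℕ → ℝ) (n : ℕ) (h : ℝ) (hh : 0 ≤ h) (t : ℝ) : CadlagSpace :=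
  ⟨⟨localIncrement u n h t, localIncrement_memℓp u n h t⟩, localIncrement_isCadlag u n hh t⟩

/-- The normalised process `𝒟_{n,h,t} / (2 h log₂ n)^{1/2}`. -/
def normalizedProcess (u : ℕ → ℝ) (n : ℕ) (h : ℝ) (hh : 0 ≤ h) (t : ℝ) : CadlagSpace :=
  (√(2 * h * log₂ n))⁻¹ • localProcess u n h hh t

/-! ### Modes of convergence -/

/-- `x_n ⇝ K`: the set `K` is non-empty and is the set of all cluster points of `(x_n)`. -/
def ClustersTo {E : Type*} [MetricSpace E] (x : ℕ → E) (K : Set E) : Prop :=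
  K.Nonempty ∧ {y | MapClusterPt y atTop x} = K

/-- `u_n ↓ 0` ultimately: `u` is non-increasing from some index on and converges to `0`. -/
def UltimatelyDecreasesToZero (u : ℕ → ℝ) : Prop :=
  (∃ N, AntitoneOn u (Set.Ici N)) ∧ Tendsto u atTop (𝓝 0)

/-- `u_n ↑ ∞` ultimately: `u` is non-decreasing from some index on and tends to `∞`. -/
def UltimatelyIncreasesToInfinity (u : ℕ → ℝ) : Prop :=
  (∃ N, MonotoneOn u (Set.Ici N)) ∧ Tendsto u atTop atTop

end

end LocalEmpirical

open LocalEmpirical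

/-!
The law of the iterated logarithm for local empirical processes at several scales has the proof
scheme of Strassen's theorem: large deviation probabilities of size `exp (-(1 + δ) log₂ n)` and
`exp (-(1 - δ) log₂ n)`, evaluated along geometric sequences of sample sizes, on the two sides of
the Borel–Cantelli dichotomy. After normalisation, `𝒟_{n,h,t}(s)` is
`(2 n h log₂ n)^{-1/2}` times the centred number of sample points in `(t, t + h s]`
(`normalizedProcess_apply`), a sum of independent bounded variables.

*Discretisation.* The energy of a `k`-tuple of functions is described by its finite increments
(`EnergyLE`), which turns membership in the Strassen ball into a closed condition
(`mem_strassenBall_iff`) and gives compactness by the Arzelà–Ascoli theorem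
(`isCompact_strassenBall`). A tuple whose increments on a grid have discrete energy at most one
agrees on the grid with the piecewise linear element of the ball
(`exists_mem_strassenBall_of_grid`). The oscillation of the process between grid points is
controlled by dyadic chaining with a Bernstein-type bound (`exists_measure_oscillation_le`).

*Large deviations.* Only a fixed finite vector of grid increments is left (`gridVector`). Its
logarithmic moment generating function, divided by `log₂ n`, converges to the quadratic function
`θ ↦ |θ|² / 4` (`IsBandwidthArray.tendsto_log_mgf`): increments over disjoint cells are nearly
uncorrelated, and, since `h_l / h_{l'} → 0`, so are increments at different scales. This is where
the `k` components become independent in the limit and their energies add up. Exponential tilting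
gives the lower bound (`eventually_exp_neg_le_measure`), a covering of the complement of a ball by
finitely many half-spaces the upper bound (`exists_finite_halfspaces`). Doob's inequality for the
exponential submartingale makes the upper bound uniform in all sample sizes up to a given one.

*Almost sure statements.* Along `a ^ j` with `a` close to `1` the exceptional probabilities are
summable, and the monotonicity of `h n l` and `n * h n l` interpolates between consecutive terms
(`ae_eventually_near_strassenBall`). Along `A ^ j` with `A` large, the blocks of observations with
indices in `[A ^ j, A ^ (j + 1))` are independent, the probabilities of being close to a tuple of
energy less than one are not summable, and the earlier observations are negligible
(`ae_frequently_dist_le`). A countable dense subset of the Strassen ball and a topological lemma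
(`isCompact_closure_range_and_mapClusterPt_eq`) conclude.
-/

namespace LocalEmpirical

/-! ### Energy of functions with square-integrable derivative -/

/-- The discrete energy of the tuple `g` along any finite family of disjoint subintervals of
`[0,1]` is at most `c`. Empty intervals are allowed; they contribute `0 / 0 = 0`. -/
def EnergyLE {ι : Type*} [Fintype ι] (c : ℝ) (g : ι → ℝ → ℝ) : Prop :=
  ∀ (n : ℕ) (a b : ℕ → ℝ), (∀ i < n, 0 ≤ a i ∧ a i ≤ b i ∧ b i ≤ 1) →
    (Finset.range n : Set ℕ).PairwiseDisjoint (fun i => Set.Ioc (a i) (b i)) →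
    ∑ l, ∑ i ∈ Finset.range n, (g l (b i) - g l (a i)) ^ 2 / (b i - a i) ≤ c

section

variable {ι : Type*} [Fintype ι]

/-- Cauchy–Schwarz for one increment of an absolutely continuous function. -/
theorem ofReal_increment_sq_div_le {f : ℝ → ℝ} (hf : AbsolutelyContinuousOnInterval f 0 1)
    {a b : ℝ} (ha : 0 ≤ a) (hab : a ≤ b) (hb : b ≤ 1) :
    ENNReal.ofReal ((f b - f a) ^ 2 / (b - a)) ≤
      ∫⁻ x in Set.Ioc a b, ENNReal.ofReal (deriv f x ^ 2) := by
  rcases hab.eq_or_lt with rfl | hlt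
  · simp
  have hac : AbsolutelyContinuousOnInterval f a b := hf.mono (by
    rw [Set.uIcc_of_le hab, Set.uIcc_of_le zero_le_one]; exact Set.Icc_subset_Icc ha hb)
  by_cases htop : ∫⁻ x in Set.Ioc a b, ENNReal.ofReal (deriv f x ^ 2) = ∞
  · rw [htop]; exact le_top
  have h1 : Integrable (deriv f) (volume.restrict (Set.Ioc a b)) :=
    (intervalIntegrable_iff_integrableOn_Ioc_of_le hab).1 hac.intervalIntegrable_deriv
  have h2 : Integrable (fun x => deriv f x ^ 2) (volume.restrict (Set.Ioc a b)) := by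
    refine ⟨((measurable_deriv f).pow_const 2).aestronglyMeasurable, ?_⟩
    rw [hasFiniteIntegral_iff_ofReal (Eventually.of_forall fun x => sq_nonneg _)]
    exact lt_top_iff_ne_top.2 htop
  rw [← ofReal_integral_eq_lintegral_ofReal h2 (Eventually.of_forall fun x => sq_nonneg _)]
  apply ENNReal.ofReal_le_ofReal
  have hint : ∫ x in Set.Ioc a b, deriv f x = f b - f a := by
    rw [← intervalIntegral.integral_of_le hab, hac.integral_deriv_eq_sub]
  have hba : 0 < b - a := sub_pos.2 hlt
  -- the variance of the derivative is nonnegative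
  have key : 0 ≤ ∫ x in Set.Ioc a b, (deriv f x - (f b - f a) / (b - a)) ^ 2 :=
    integral_nonneg fun x => sq_nonneg _
  have e : ∀ x, (deriv f x - (f b - f a) / (b - a)) ^ 2 =
      deriv f x ^ 2 - (2 * ((f b - f a) / (b - a)) * deriv f x - ((f b - f a) / (b - a)) ^ 2) := by
    intro x; ring
  simp_rw [e] at key
  have h3 := h1.const_mul (2 * ((f b - f a) / (b - a)))
  have h4 : Integrable (fun _ : ℝ => ((f b - f a) / (b - a)) ^ 2)
    (volume.restrict (Set.Ioc a b)) := integrable_const _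
  have h5 : Integrable (fun x => 2 * ((f b - f a) / (b - a)) * deriv f x -
    ((f b - f a) / (b - a)) ^ 2) (volume.restrict (Set.Ioc a b)) := h3.sub h4
  rw [integral_sub h2 h5, integral_sub h3 h4, integral_const_mul, hint] at key
  simp only [integral_const, MeasurableSet.univ, measureReal_restrict_apply, Set.univ_inter,
    Real.volume_real_Ioc_of_le hab, smul_eq_mul] at key
  have e2 : (f b - f a) ^ 2 / (b - a) = 2 * ((f b - f a) / (b - a)) * (f b - f a) -
      (b - a) * ((f b - f a) / (b - a)) ^ 2 := by
    field_simp; ring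
  linarith

theorem EnergyLE.of_lintegral {g : ι → ℝ → ℝ} {c : ℝ} (hc : 0 ≤ c)
    (hac : ∀ l, AbsolutelyContinuousOnInterval (g l) 0 1)
    (hg : ∑ l, ∫⁻ x in Set.Icc (0 : ℝ) 1, ENNReal.ofReal (deriv (g l) x ^ 2) ≤ ENNReal.ofReal c) :
    EnergyLE c g := by
  intro n a b hab hdisj
  rw [← ENNReal.ofReal_le_ofReal_iff hc]
  refine le_trans ?_ hg
  have hnn : ∀ l, ∀ i ∈ Finset.range n, 0 ≤ (g l (b i) - g l (a i)) ^ 2 / (b i - a i) :=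
    fun l i hi => div_nonneg (sq_nonneg _) (sub_nonneg.2 (hab i (Finset.mem_range.1 hi)).2.1)
  rw [ENNReal.ofReal_sum_of_nonneg fun l _ => Finset.sum_nonneg (hnn l)]
  refine Finset.sum_le_sum fun l _ => ?_
  rw [ENNReal.ofReal_sum_of_nonneg (hnn l)]
  calc _ ≤ ∑ i ∈ Finset.range n, ∫⁻ x in Set.Ioc (a i) (b i), ENNReal.ofReal (deriv (g l) x ^ 2) :=
        Finset.sum_le_sum fun i hi => by
          obtain ⟨h1, h2, h3⟩ := hab i (Finset.mem_range.1 hi)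
          exact ofReal_increment_sq_div_le (hac l) h1 h2 h3
    _ = ∫⁻ x in ⋃ i ∈ Finset.range n, Set.Ioc (a i) (b i), ENNReal.ofReal (deriv (g l) x ^ 2) :=
        (lintegral_biUnion_finset hdisj (fun i _ => measurableSet_Ioc) _).symm
    _ ≤ _ := by
        apply lintegral_mono_set
        refine Set.iUnion₂_subset fun i hi => ?_
        obtain ⟨h1, h2, h3⟩ := hab i (Finset.mem_range.1 hi)
        exact fun x hx => ⟨h1.trans hx.1.le, hx.2.trans h3⟩

theorem EnergyLE.abs_sub_le {g : ι → ℝ → ℝ} (hg : EnergyLE 1 g) (l : ι) {a b : ℝ}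
    (ha : 0 ≤ a) (hab : a ≤ b) (hb : b ≤ 1) : |g l b - g l a| ≤ √(b - a) := by
  rcases hab.eq_or_lt with rfl | hlt
  · simp
  have h := hg 1 (fun _ => a) (fun _ => b) (fun _ _ => ⟨ha, hab, hb⟩) (by
    intro i hi j hj hij; simp at hi hj; omega)
  simp only [Finset.range_one, Finset.sum_singleton] at h
  have h1 := (Finset.single_le_sum (fun l _ => div_nonneg (sq_nonneg (g l b - g l a))
    (sub_nonneg.2 hab)) (Finset.mem_univ l)).trans h
  rw [div_le_one (sub_pos.2 hlt)] at h1
  exact Real.abs_le_sqrt h1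

/-- By Cauchy–Schwarz, intervals of total length `δ` carry total variation at most `√δ`. -/
theorem EnergyLE.absolutelyContinuous {g : ι → ℝ → ℝ} (hg : EnergyLE 1 g) (l : ι) :
    AbsolutelyContinuousOnInterval (g l) 0 1 := by
  rw [absolutelyContinuousOnInterval_iff]
  intro ε hε
  refine ⟨ε ^ 2, by positivity, ?_⟩
  rintro ⟨n, E⟩ hE hlen
  simp only [AbsolutelyContinuousOnInterval.disjWithin, Set.mem_ofPred_eq] at hE
  obtain ⟨hE1, hE2⟩ := hE
  rw [Set.uIcc_of_le zero_le_one] at hE1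
  have h := hg n (fun i => min (E i).1 (E i).2) (fun i => max (E i).1 (E i).2)
    (fun i hi => by
      obtain ⟨⟨h1, h2⟩, h3, h4⟩ := hE1 i (Finset.mem_range.2 hi)
      exact ⟨le_min h1 h3, min_le_max, max_le h2 h4⟩)
    (by simpa only [Set.uIoc] using hE2)
  have hsq : ∀ l i, (g l (max (E i).1 (E i).2) - g l (min (E i).1 (E i).2)) ^ 2 =
      (dist (g l (E i).1) (g l (E i).2)) ^ 2 := by
    intro l i
    rw [Real.dist_eq, sq_abs]
    rcases le_total (E i).1 (E i).2 with h | h <;> simp [h]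
    ring
  have hlen' : ∀ i, max (E i).1 (E i).2 - min (E i).1 (E i).2 = dist (E i).1 (E i).2 := by
    intro i
    rw [Real.dist_eq, max_sub_min_eq_abs]
    exact abs_sub_comm _ _
  simp only [hsq, hlen'] at h
  have h1 := (Finset.single_le_sum (fun l _ => Finset.sum_nonneg fun i _ =>
    div_nonneg (sq_nonneg (dist (g l (E i).1) (g l (E i).2))) (dist_nonneg (x := (E i).1)))
    (Finset.mem_univ l)).trans h
  have h2 := Finset.sum_sq_le_sum_mul_sum_of_sq_le_mul (Finset.range n)
    (r := fun i => dist (g l (E i).1) (g l (E i).2))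
    (f := fun i => dist (g l (E i).1) (g l (E i).2) ^ 2 / dist (E i).1 (E i).2)
    (g := fun i => dist (E i).1 (E i).2)
    (fun i _ => by positivity) (fun i _ => by positivity) (fun i _ => by
      by_cases h0 : dist (E i).1 (E i).2 = 0
      · rw [dist_eq_zero] at h0
        simp [h0]
      · exact (div_mul_cancel₀ _ h0).ge)
  have h3 : (∑ i ∈ Finset.range n, dist (g l (E i).1) (g l (E i).2)) ^ 2 < ε ^ 2 := by
    refine (h2.trans (mul_le_of_le_one_left (Finset.sum_nonneg fun i _ => dist_nonneg) h1)).trans_lt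
      hlen
  exact lt_of_pow_lt_pow_left₀ 2 hε.le h3

/-- The integral of a step function over the uniform grid of mesh `1 / m`. -/
theorem lintegral_floor_step (m : ℕ) (hm : 0 < m) (v : ℕ → ℝ≥0∞) :
    ∫⁻ x in Set.Ico (0 : ℝ) 1, v ⌊m * x⌋₊ = ∑ i ∈ Finset.range m, v i * ENNReal.ofReal (1 / m) := by
  have hm' : (0 : ℝ) < m := by exact_mod_cast hm
  have hU : Set.Ico (0 : ℝ) 1 = ⋃ i ∈ Finset.range m, Set.Ico ((i : ℝ) / m) ((i + 1 : ℝ) / m) := by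
    ext x
    simp only [Set.mem_Ico, Finset.mem_range, Set.mem_iUnion, exists_prop]
    constructor
    · rintro ⟨h0, h1⟩
      refine ⟨⌊m * x⌋₊, ?_, ?_, ?_⟩
      · rw [Nat.floor_lt (by positivity)]; nlinarith
      · rw [div_le_iff₀ hm', mul_comm]; exact Nat.floor_le (by positivity)
      · rw [lt_div_iff₀ hm', mul_comm]; exact Nat.lt_floor_add_one _
    · rintro ⟨i, hi, h1, h2⟩
      refine ⟨le_trans (by positivity) h1, h2.trans_le ?_⟩
      rw [div_le_one hm']; exact_mod_cast hi
  have hfl : ∀ (i : ℕ) (x : ℝ), x ∈ Set.Ico ((i : ℝ) / m) ((i + 1 : ℝ) / m) → ⌊m * x⌋₊ = i := by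
    rintro i x ⟨h1, h2⟩
    rw [div_le_iff₀ hm'] at h1
    rw [lt_div_iff₀ hm'] at h2
    rw [Nat.floor_eq_iff (by nlinarith [Nat.cast_nonneg (α := ℝ) i])]
    constructor <;> linarith
  rw [hU, lintegral_biUnion_finset]
  · refine Finset.sum_congr rfl fun i _ => ?_
    rw [setLIntegral_congr_fun (g := fun _ => v i) measurableSet_Ico
      (fun x hx => by simp only [hfl i x hx])]
    rw [setLIntegral_const, Real.volume_Ico]
    congr 2
    ring
  · intro i _ j _ hij
    refine Set.disjoint_left.2 fun x hx hx' => hij ?_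
    rw [← hfl i x hx, hfl j x hx']
  · exact fun _ _ => measurableSet_Ico

/-- Difference quotients over the grid cell containing `x` converge to the derivative. -/
theorem tendsto_grid_quotient {f : ℝ → ℝ} {x f' : ℝ} (hx : 0 ≤ x) (hf : HasDerivAt f f' x) :
    Tendsto (fun m : ℕ => (m : ℝ) * (f ((⌊m * x⌋₊ + 1 : ℝ) / m) - f ((⌊m * x⌋₊ : ℝ) / m)))
      atTop (𝓝 f') := by
  rw [Metric.tendsto_atTop]
  intro ε hε
  have h := (hasDerivAt_iff_isLittleO.1 hf).bound (show (0 : ℝ) < ε / 4 by positivity)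
  obtain ⟨δ, hδ, hball⟩ := Metric.eventually_nhds_iff.1 h
  obtain ⟨M, hM⟩ := exists_nat_gt (1 / δ)
  refine ⟨M + 1, fun m hm => ?_⟩
  have hm0 : (0 : ℝ) < m := by exact_mod_cast (by omega : 0 < m)
  have hmδ : 1 / (m : ℝ) < δ := by
    rw [div_lt_iff₀ hm0]
    rw [div_lt_iff₀ hδ] at hM
    have : (M : ℝ) ≤ m := by exact_mod_cast (by omega : M ≤ m)
    nlinarith
  have h1 : (⌊m * x⌋₊ : ℝ) ≤ m * x := Nat.floor_le (by positivity)
  have h2 : (m * x : ℝ) < ⌊m * x⌋₊ + 1 := Nat.lt_floor_add_one _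
  set q : ℝ := (⌊m * x⌋₊ : ℝ) with hq
  have ha : |q / m - x| ≤ 1 / m := by
    rw [abs_le]
    constructor
    · rw [le_sub_iff_add_le, ← sub_nonneg]
      have : q / m - (-(1 / m) + x) = (q + 1 - m * x) / m := by field_simp; ring
      rw [this]; exact div_nonneg (by linarith) hm0.le
    · rw [sub_le_iff_le_add, ← sub_nonneg]
      have : 1 / m + x - q / m = (1 + (m * x - q)) / m := by field_simp; ring
      rw [this]; exact div_nonneg (by linarith) hm0.le
  have hb : |(q + 1) / m - x| ≤ 1 / m := by
    rw [abs_le]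
    constructor
    · rw [le_sub_iff_add_le, ← sub_nonneg]
      have : (q + 1) / m - (-(1 / m) + x) = (q + 1 - m * x + 1) / m := by field_simp; ring
      rw [this]; exact div_nonneg (by linarith) hm0.le
    · rw [sub_le_iff_le_add, ← sub_nonneg]
      have : 1 / m + x - (q + 1) / m = (m * x - q) / m := by field_simp; ring
      rw [this]; exact div_nonneg (by linarith) hm0.le
  have hA := hball (y := q / m) (by rw [Real.dist_eq]; linarith)
  have hB := hball (y := (q + 1) / m) (by rw [Real.dist_eq]; linarith)
  simp only [Real.norm_eq_abs, smul_eq_mul] at hA hB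
  have hA' := hA.trans (mul_le_mul_of_nonneg_left ha (by positivity))
  have hB' := hB.trans (mul_le_mul_of_nonneg_left hb (by positivity))
  rw [Real.dist_eq]
  have e : (m : ℝ) * (f ((q + 1) / m) - f (q / m)) - f' =
      m * ((f ((q + 1) / m) - f x - ((q + 1) / m - x) * f') -
        (f (q / m) - f x - (q / m - x) * f')) := by field_simp; ring
  rw [e, abs_mul, abs_of_pos hm0]
  calc _ ≤ (m : ℝ) * (ε / 4 * (1 / m) + ε / 4 * (1 / m)) := by
        gcongr
        exact (abs_sub _ _).trans (add_le_add hB' hA')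
    _ = ε / 2 := by field_simp; ring
    _ < ε := by linarith

theorem EnergyLE.grid_sum_le {g : ι → ℝ → ℝ} {c : ℝ} (hg : EnergyLE c g) {m : ℕ} (hm : 0 < m) :
    ∑ l, ∑ i ∈ Finset.range m, (g l ((i + 1 : ℝ) / m) - g l ((i : ℝ) / m)) ^ 2 /
      ((i + 1 : ℝ) / m - (i : ℝ) / m) ≤ c := by
  have hm' : (0 : ℝ) < m := by exact_mod_cast hm
  refine hg m (fun i => (i : ℝ) / m) (fun i => (i + 1 : ℝ) / m) (fun i hi => ?_) ?_
  · refine ⟨by positivity, by gcongr; linarith, ?_⟩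
    rw [div_le_one hm']; exact_mod_cast hi
  · intro i _ j _ hij
    refine Set.disjoint_left.2 fun x hx hx' => hij ?_
    simp only [Set.mem_Ioc, div_lt_iff₀ hm', le_div_iff₀ hm'] at hx hx'
    have h1 : (i : ℝ) < j + 1 := by linarith
    have h2 : (j : ℝ) < i + 1 := by linarith
    norm_cast at h1 h2
    omega

theorem EnergyLE.const_mul {g : ι → ℝ → ℝ} {c : ℝ} (hg : EnergyLE c g) (a : ℝ) :
    EnergyLE (a ^ 2 * c) fun l x => a * g l x := by
  intro n b b' hb hdisj
  refine le_trans (le_of_eq ?_) (mul_le_mul_of_nonneg_left (hg n b b' hb hdisj) (sq_nonneg a))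
  rw [Finset.mul_sum]
  refine Finset.sum_congr rfl fun l _ => ?_
  rw [Finset.mul_sum]
  refine Finset.sum_congr rfl fun i _ => ?_
  rw [← mul_sub, mul_pow, mul_div_assoc]

theorem EnergyLE.mono {g : ι → ℝ → ℝ} {c c' : ℝ} (hg : EnergyLE c g) (hc : c ≤ c') :
    EnergyLE c' g :=
  fun n a b hab hdisj => (hg n a b hab hdisj).trans hc

/-- Fatou's lemma for the difference quotients over finer and finer grids. -/
theorem EnergyLE.lintegral_deriv_sq_le {g : ι → ℝ → ℝ} (hg : EnergyLE 1 g) :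
    ∑ l, ∫⁻ x in Set.Icc (0 : ℝ) 1, ENNReal.ofReal (deriv (g l) x ^ 2) ≤ 1 := by
  rw [← lintegral_finsetSum _ fun l _ => ((measurable_deriv (g l)).pow_const 2).ennreal_ofReal]
  rw [← setLIntegral_congr (Ico_ae_eq_Icc (μ := volume) (a := (0 : ℝ)) (b := 1))]
  set D : ℕ → ℝ → ℝ≥0∞ := fun m x => ∑ l, ENNReal.ofReal
    (((m : ℝ) * (g l ((⌊m * x⌋₊ + 1 : ℝ) / m) - g l ((⌊m * x⌋₊ : ℝ) / m))) ^ 2) with hD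
  have hdiff : ∀ᵐ x ∂(volume.restrict (Set.Ico (0 : ℝ) 1)), ∀ l, DifferentiableAt ℝ (g l) x := by
    rw [ae_all_iff]
    intro l
    have := (hg.absolutelyContinuous l).boundedVariationOn.ae_differentiableAt_of_mem_uIcc
    rw [ae_restrict_iff' measurableSet_Ico]
    filter_upwards [this] with x hx hx'
    exact hx (by rw [Set.uIcc_of_le zero_le_one]; exact Set.Ico_subset_Icc_self hx')
  have hlim : ∀ᵐ x ∂(volume.restrict (Set.Ico (0 : ℝ) 1)),
      ∑ l, ENNReal.ofReal (deriv (g l) x ^ 2) = liminf (fun m => D m x) atTop := by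
    filter_upwards [hdiff, ae_restrict_mem measurableSet_Ico] with x hx hx'
    refine (Tendsto.liminf_eq ?_).symm
    refine tendsto_finsetSum _ fun l _ => ENNReal.tendsto_ofReal ?_
    exact (tendsto_grid_quotient hx'.1 (hx l).hasDerivAt).pow 2
  rw [lintegral_congr_ae hlim]
  refine (lintegral_liminf_le fun m => ?_).trans ?_
  · refine Finset.measurable_fun_sum _ fun l _ => ?_
    have : Measurable fun j : ℕ => ENNReal.ofReal
      (((m : ℝ) * (g l ((j + 1 : ℝ) / m) - g l ((j : ℝ) / m))) ^ 2) := measurable_of_countable _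
    exact this.comp (Nat.measurable_floor.comp (measurable_const_mul _))
  refine liminf_le_of_le (by isBoundedDefault) fun b hb => ?_
  obtain ⟨m, hbm, hm⟩ := (hb.and (eventually_gt_atTop 0)).exists
  refine hbm.trans ?_
  have hm' : (0 : ℝ) < m := by exact_mod_cast hm
  rw [hD]
  rw [lintegral_floor_step m hm (fun j => ∑ l, ENNReal.ofReal
    (((m : ℝ) * (g l ((j + 1 : ℝ) / m) - g l ((j : ℝ) / m))) ^ 2))]
  have h := hg.grid_sum_le hm
  rw [← ENNReal.ofReal_le_ofReal_iff zero_le_one, ENNReal.ofReal_one] at h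
  refine le_trans (le_of_eq ?_) h
  rw [Finset.sum_comm, ENNReal.ofReal_sum_of_nonneg fun i _ => Finset.sum_nonneg fun l _ =>
    div_nonneg (sq_nonneg _) (sub_nonneg.2 (by gcongr; linarith))]
  refine Finset.sum_congr rfl fun i _ => ?_
  rw [ENNReal.ofReal_sum_of_nonneg fun l _ =>
    div_nonneg (sq_nonneg _) (sub_nonneg.2 (by gcongr; linarith)), Finset.sum_mul]
  refine Finset.sum_congr rfl fun l _ => ?_
  rw [← ENNReal.ofReal_mul (sq_nonneg _)]
  congr 1
  field_simp
  ring

end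

/-! ### Piecewise linear functions, and compactness of the Strassen ball -/

theorem CadlagSpace.norm_le {f : CadlagSpace} {C : ℝ} (hC : 0 ≤ C) (h : ∀ s, |f.1 s| ≤ C) :
    ‖f‖ ≤ C :=
  lp.norm_le_of_forall_le hC h

theorem CadlagSpace.dist_pi_le {ι : Type*} [Fintype ι] {f g : ι → CadlagSpace} {C : ℝ} (hC : 0 ≤ C)
    (h : ∀ l s, |(f l).1 s - (g l).1 s| ≤ C) : dist f g ≤ C := by
  rw [dist_pi_le_iff hC]
  intro l
  rw [dist_eq_norm]
  exact CadlagSpace.norm_le hC (h l)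

theorem extendToReal_coe (g : CadlagSpace) (s : unitInterval) : extendToReal g s = g.1 s :=
  Set.IccExtend_val _ _ s

/-- A continuous function on `[0,1]`, as an element of `B[0,1]`. -/
noncomputable def cadlagOfContinuous (f : C(unitInterval, ℝ)) : CadlagSpace :=
  ⟨⟨fun s => f s, memℓp_infty ⟨‖f‖, by rintro _ ⟨s, rfl⟩; exact f.norm_coe_le_norm s⟩⟩,
    fun s => ⟨f.continuous.continuousWithinAt, f s, f.continuous.continuousWithinAt⟩⟩

theorem continuous_cadlagOfContinuous : Continuous cadlagOfContinuous := by
  refine (LipschitzWith.of_dist_le_mul (K := 1) fun f g => ?_).continuous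
  rw [NNReal.coe_one, one_mul, dist_eq_norm (cadlagOfContinuous f)]
  refine CadlagSpace.norm_le dist_nonneg fun s => ?_
  exact f.dist_apply_le_dist (g := g) s

theorem mem_strassenBall_iff {k : ℕ} {g : Fin k → CadlagSpace} :
    g ∈ strassenBall k ↔ (∀ l, (g l).1 0 = 0) ∧ EnergyLE 1 fun l => extendToReal (g l) := by
  constructor
  · rintro ⟨h1, h2, h3⟩
    exact ⟨h2, EnergyLE.of_lintegral zero_le_one h1 (by rw [ENNReal.ofReal_one]; exact h3)⟩
  · rintro ⟨h1, h2⟩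
    exact ⟨h2.absolutelyContinuous, h1, h2.lintegral_deriv_sq_le⟩

theorem abs_sub_le_of_mem_strassenBall {k : ℕ} {g : Fin k → CadlagSpace} (hg : g ∈ strassenBall k)
    (l : Fin k) (s s' : unitInterval) : |(g l).1 s - (g l).1 s'| ≤ √|(s : ℝ) - s'| := by
  have h := (mem_strassenBall_iff.1 hg).2
  wlog hs : s' ≤ s generalizing s s'
  · rw [abs_sub_comm, abs_sub_comm (s : ℝ)]
    exact this s' s (le_of_not_ge hs)
  have hs' : (s' : ℝ) ≤ s := hs
  have := h.abs_sub_le l s'.2.1 hs' s.2.2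
  rw [extendToReal_coe, extendToReal_coe] at this
  rwa [abs_of_nonneg (sub_nonneg.2 hs')]

theorem abs_apply_le_one_of_mem_strassenBall {k : ℕ} {g : Fin k → CadlagSpace}
    (hg : g ∈ strassenBall k) (l : Fin k) (s : unitInterval) : |(g l).1 s| ≤ 1 := by
  have h := abs_sub_le_of_mem_strassenBall hg l s 0
  rw [(mem_strassenBall_iff.1 hg).1 l, sub_zero] at h
  refine h.trans (Real.sqrt_le_one.2 ?_)
  rw [Set.Icc.coe_zero, sub_zero, abs_of_nonneg s.2.1]
  exact s.2.2

theorem strassenBall_nonempty (k : ℕ) : (strassenBall k).Nonempty := by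
  refine ⟨0, mem_strassenBall_iff.2 ⟨fun _ => rfl, ?_⟩⟩
  intro n a b _ _
  have h : extendToReal 0 = fun _ => 0 := rfl
  simp [h]

/-- By Arzelà–Ascoli: the modulus of continuity `√|s - s'|` is common to all elements, and the
discrete energy bounds are closed conditions. -/
theorem isCompact_strassenBall (k : ℕ) : IsCompact (strassenBall k) := by
  set A : Set C(unitInterval, ℝ) :=
    {f | f 0 = 0 ∧ ∀ s s' : unitInterval, |f s - f s'| ≤ √|(s : ℝ) - s'|} with hA
  have hAcomp : IsCompact A := by
    apply ArzelaAscoli.isCompact_of_equicontinuous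
    · have himg : ContinuousMap.toFun '' A =
          {f : unitInterval → ℝ | f 0 = 0 ∧ ∀ s s' : unitInterval, |f s - f s'| ≤ √|(s : ℝ) - s'|} := by
        ext f
        constructor
        · rintro ⟨F, hF, rfl⟩
          exact hF
        · intro hf
          have hc : Continuous f := by
            rw [continuous_iff_continuousAt]
            intro s
            rw [ContinuousAt, tendsto_iff_dist_tendsto_zero]
            have hlim : Tendsto (fun s' : unitInterval => √|(s' : ℝ) - s|) (𝓝 s) (𝓝 0) := by
              have : Continuous fun s' : unitInterval => √|(s' : ℝ) - s| := by fun_prop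
              simpa using this.tendsto s
            exact squeeze_zero (fun _ => dist_nonneg) (fun s' => hf.2 s' s) hlim
          exact ⟨⟨f, hc⟩, hf, rfl⟩
      rw [himg]
      refine IsCompact.of_isClosed_subset
        (isCompact_univ_pi fun _ : unitInterval => isCompact_Icc (a := (-1 : ℝ)) (b := 1)) ?_ ?_
      · simp only [Set.ofPred_and, Set.ofPred_forall]
        refine IsClosed.inter (isClosed_eq (continuous_apply 0) continuous_const) ?_
        refine isClosed_iInter fun s => isClosed_iInter fun s' => ?_
        exact isClosed_le (by fun_prop) continuous_const
      · rintro f ⟨h0, hf⟩ s -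
        have h := hf s 0
        rw [h0, sub_zero] at h
        refine abs_le.1 (h.trans (Real.sqrt_le_one.2 ?_))
        rw [Set.Icc.coe_zero, sub_zero, abs_of_nonneg s.2.1]
        exact s.2.2
    · intro s
      refine Metric.equicontinuousAt_of_continuity_modulus (fun s' : unitInterval => √|(s : ℝ) - s'|)
        ?_ _ ?_
      · have : Continuous fun s' : unitInterval => √|(s : ℝ) - s'| := by fun_prop
        simpa using this.tendsto s
      · exact Eventually.of_forall fun s' f => f.2.2 s s'
  set B : Set (Fin k → C(unitInterval, ℝ)) := {g | (∀ l, g l ∈ A) ∧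
    EnergyLE 1 fun l => Set.IccExtend (zero_le_one (α := ℝ)) (g l)} with hB
  have hBcomp : IsCompact B := by
    refine (isCompact_univ_pi fun _ : Fin k => hAcomp).of_isClosed_subset ?_
      fun g hg l _ => hg.1 l
    have hAclosed : IsClosed A := hAcomp.isClosed
    simp only [hB, EnergyLE, Set.ofPred_and, Set.ofPred_forall]
    refine IsClosed.inter (isClosed_iInter fun l => hAclosed.preimage (continuous_apply l)) ?_
    refine isClosed_iInter fun n => isClosed_iInter fun a => isClosed_iInter fun b =>
      isClosed_iInter fun _ => isClosed_iInter fun _ => ?_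
    refine isClosed_le (continuous_finsetSum _ fun l _ => continuous_finsetSum _ fun i _ => ?_)
      continuous_const
    simp only [Set.IccExtend, Function.comp_apply]
    have hev : ∀ s : unitInterval, Continuous fun g : Fin k → C(unitInterval, ℝ) => g l s :=
      fun s => (continuous_eval_const (F := C(unitInterval, ℝ)) s).comp (continuous_apply l)
    exact (((hev _).sub (hev _)).pow 2).div_const _
  have himage : strassenBall k = (fun g l => cadlagOfContinuous (g l)) '' B := by
    ext g
    constructor
    · intro hg
      have hcont : ∀ l, Continuous fun s => (g l).1 s := by
        intro l
        have := (hg.1 l).continuousOn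
        rw [Set.uIcc_of_le zero_le_one] at this
        have h2 := continuousOn_iff_continuous_domRestrict.1 this
        refine h2.congr fun s => extendToReal_coe _ _
      refine ⟨fun l => ⟨fun s => (g l).1 s, hcont l⟩, ⟨fun l => ⟨hg.2.1 l, ?_⟩, ?_⟩, rfl⟩
      · exact abs_sub_le_of_mem_strassenBall hg l
      · exact (mem_strassenBall_iff.1 hg).2
    · rintro ⟨f, hf, rfl⟩
      exact mem_strassenBall_iff.2 ⟨fun l => (hf.1 l).1, hf.2⟩
  rw [himage]
  exact hBcomp.image (continuous_pi fun l => continuous_cadlagOfContinuous.comp (continuous_apply l))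

/-- The function vanishing at `0` which is linear on the cells of the grid of mesh `1 / m`, with
increments `d i`. -/
noncomputable def gridInterpolation (m : ℕ) (d : ℕ → ℝ) (x : ℝ) : ℝ :=
  ∑ i ∈ Finset.range m, d i * max 0 (min (m * x - i) 1)

theorem continuous_gridInterpolation (m : ℕ) (d : ℕ → ℝ) : Continuous (gridInterpolation m d) := by
  unfold gridInterpolation
  fun_prop

theorem gridInterpolation_grid {m : ℕ} (hm : 0 < m) (d : ℕ → ℝ) {j : ℕ} (hj : j ≤ m) :
    gridInterpolation m d ((j : ℝ) / m) = ∑ i ∈ Finset.range j, d i := by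
  have hm' : (m : ℝ) ≠ 0 := by positivity
  unfold gridInterpolation
  rw [← Finset.sum_subset (Finset.range_subset_range.2 hj)]
  · refine Finset.sum_congr rfl fun i hi => ?_
    have : (i : ℝ) + 1 ≤ j := by exact_mod_cast Finset.mem_range.1 hi
    rw [mul_div_cancel₀ _ hm', min_eq_right (by linarith), max_eq_right zero_le_one, mul_one]
  · intro i _ hi
    have : (j : ℝ) ≤ i := by exact_mod_cast not_lt.1 fun h => hi (Finset.mem_range.2 h)
    rw [mul_div_cancel₀ _ hm', min_eq_left (by linarith), max_eq_left (by linarith), mul_zero]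

theorem lipschitzWith_gridInterpolation (m : ℕ) (d : ℕ → ℝ) :
    ∃ K, LipschitzWith K (gridInterpolation m d) := by
  refine ⟨∑ i ∈ Finset.range m, ‖d i‖₊ * m, LipschitzWith.of_dist_le_mul fun x y => ?_⟩
  unfold gridInterpolation
  rw [NNReal.coe_sum, Finset.sum_mul]
  refine (dist_sum_sum_le _ _ _).trans (Finset.sum_le_sum fun i _ => ?_)
  rw [Real.dist_eq, ← mul_sub, abs_mul]
  push_cast
  rw [mul_assoc]
  refine mul_le_mul_of_nonneg_left ?_ (abs_nonneg _)
  have h1 : ∀ u v : ℝ, |max 0 (min u 1) - max 0 (min v 1)| ≤ |u - v| := fun u v => by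
    refine (abs_max_sub_max_le_max 0 _ 0 _).trans ?_
    rw [sub_self, abs_zero, max_eq_right (abs_nonneg _)]
    refine (abs_min_sub_min_le_max _ _ _ _).trans ?_
    rw [sub_self, abs_zero, max_eq_left (abs_nonneg _)]
  refine (h1 _ _).trans_eq ?_
  rw [sub_sub_sub_cancel_right, ← mul_sub, abs_mul, Nat.abs_cast, Real.dist_eq]

theorem deriv_gridInterpolation {m : ℕ} (hm : 0 < m) (d : ℕ → ℝ) {x : ℝ} (hx : x ∈ Set.Ico (0 : ℝ) 1)
    (hx' : m * x ≠ ⌊m * x⌋₊) : deriv (gridInterpolation m d) x = m * d ⌊m * x⌋₊ := by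
  have hm' : (0 : ℝ) < m := by exact_mod_cast hm
  have hfl : (⌊m * x⌋₊ : ℝ) ≤ m * x := Nat.floor_le (mul_nonneg hm'.le hx.1)
  have hlt : (⌊m * x⌋₊ : ℝ) < m * x := lt_of_le_of_ne hfl hx'.symm
  have hlt' : m * x < ⌊m * x⌋₊ + 1 := Nat.lt_floor_add_one _
  have hfm : ⌊m * x⌋₊ < m := by
    rw [Nat.floor_lt (mul_nonneg hm'.le hx.1)]
    nlinarith [hx.2]
  have hcont : ContinuousAt (fun y : ℝ => (m : ℝ) * y) x := by fun_prop
  have h : ∀ i ∈ Finset.range m, HasDerivAt (fun y : ℝ => d i * max 0 (min (m * y - i) 1))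
      (if i = ⌊m * x⌋₊ then m * d i else 0) x := by
    intro i _
    rcases lt_trichotomy i ⌊m * x⌋₊ with hi | hi | hi
    · rw [if_neg hi.ne]
      have hi' : (i : ℝ) + 1 ≤ ⌊m * x⌋₊ := by exact_mod_cast hi
      refine (hasDerivAt_const x (d i)).congr_of_eventuallyEq ?_
      filter_upwards [hcont.eventually (lt_mem_nhds hlt)] with y hy
      rw [min_eq_right (by linarith), max_eq_right zero_le_one, mul_one]
    · rw [if_pos hi]
      subst hi
      have : HasDerivAt (fun y : ℝ => d ⌊m * x⌋₊ * (m * y - ⌊m * x⌋₊)) (d ⌊m * x⌋₊ * (m * 1)) x :=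
        (((hasDerivAt_id x).const_mul (m : ℝ)).sub_const _).const_mul _
      rw [mul_one, mul_comm (d _)] at this
      refine this.congr_of_eventuallyEq ?_
      filter_upwards [hcont.eventually (lt_mem_nhds hlt), hcont.eventually (gt_mem_nhds hlt')]
        with y hy hy'
      rw [min_eq_left (by linarith), max_eq_right (by linarith)]
    · rw [if_neg hi.ne']
      have hi' : (⌊m * x⌋₊ : ℝ) + 1 ≤ i := by exact_mod_cast hi
      refine (hasDerivAt_const x (0 : ℝ)).congr_of_eventuallyEq ?_
      filter_upwards [hcont.eventually (gt_mem_nhds hlt')] with y hy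
      rw [min_eq_left (by linarith), max_eq_left (by linarith), mul_zero]
  have h2 := HasDerivAt.fun_sum h
  rw [Finset.sum_ite_eq' (Finset.range m) ⌊m * x⌋₊, if_pos (Finset.mem_range.2 hfm)] at h2
  exact h2.deriv

theorem lintegral_deriv_gridInterpolation_sq {m : ℕ} (hm : 0 < m) (d : ℕ → ℝ) :
    ∫⁻ x in Set.Icc (0 : ℝ) 1, ENNReal.ofReal (deriv (gridInterpolation m d) x ^ 2) =
      ENNReal.ofReal (m * ∑ i ∈ Finset.range m, d i ^ 2) := by
  have hm' : (0 : ℝ) < m := by exact_mod_cast hm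
  rw [← setLIntegral_congr (Ico_ae_eq_Icc (μ := volume) (a := (0 : ℝ)) (b := 1))]
  have hae : ∀ᵐ x ∂(volume.restrict (Set.Ico (0 : ℝ) 1)),
      ENNReal.ofReal (deriv (gridInterpolation m d) x ^ 2) =
        ENNReal.ofReal ((m * d ⌊m * x⌋₊) ^ 2) := by
    have hcount : (Set.range fun j : ℕ => (j : ℝ) / m).Countable := Set.countable_range _
    filter_upwards [ae_restrict_mem measurableSet_Ico,
      ae_restrict_of_ae (hcount.ae_notMem volume)] with x hx hx'
    rw [deriv_gridInterpolation hm d hx fun h => hx' ⟨⌊m * x⌋₊, ?_⟩]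
    dsimp only
    rw [← h, mul_div_cancel_left₀ _ hm'.ne']
  rw [lintegral_congr_ae hae, lintegral_floor_step m hm fun j => ENNReal.ofReal ((m * d j) ^ 2),
    Finset.mul_sum, ENNReal.ofReal_sum_of_nonneg fun i _ => by positivity]
  refine Finset.sum_congr rfl fun i _ => ?_
  rw [← ENNReal.ofReal_mul (sq_nonneg _)]
  congr 1
  field_simp

/-- A grid vector of discrete energy at most one is the vector of grid increments of an element of
the Strassen ball. -/
theorem exists_mem_strassenBall_of_grid {k m : ℕ} (hm : 0 < m) (d : Fin k → ℕ → ℝ)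
    (hd : ∑ l, m * ∑ i ∈ Finset.range m, d l i ^ 2 ≤ (1 : ℝ)) :
    ∃ g ∈ strassenBall k, ∀ l, ∀ j ≤ m, extendToReal (g l) ((j : ℝ) / m) =
      ∑ i ∈ Finset.range j, d l i := by
  have hm' : (0 : ℝ) < m := by exact_mod_cast hm
  set g : Fin k → CadlagSpace := fun l => cadlagOfContinuous
    ⟨fun s => gridInterpolation m (d l) s, (continuous_gridInterpolation m (d l)).comp
      continuous_subtype_val⟩ with hg
  have hval : ∀ l (s : unitInterval), (g l).1 s = gridInterpolation m (d l) s := fun l s => rfl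
  have hext : ∀ l, ∀ x ∈ Set.Icc (0 : ℝ) 1, extendToReal (g l) x = gridInterpolation m (d l) x :=
    fun l x hx => (extendToReal_coe (g l) ⟨x, hx⟩).trans (hval l _)
  refine ⟨g, ⟨fun l => ?_, fun l => ?_, ?_⟩, fun l j hj => ?_⟩
  · obtain ⟨K, hK⟩ := lipschitzWith_gridInterpolation m (d l)
    refine LipschitzOnWith.absolutelyContinuousOnInterval (K := K) ?_
    rw [Set.uIcc_of_le zero_le_one]
    intro x hx y hy
    rw [hext l x hx, hext l y hy]
    exact hK x y
  · rw [hval]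
    have := gridInterpolation_grid hm (d l) (Nat.zero_le m)
    simpa using this
  · calc ∑ l, hilbertNormSq (g l) = ∑ l, ENNReal.ofReal (m * ∑ i ∈ Finset.range m, d l i ^ 2) := by
          refine Finset.sum_congr rfl fun l _ => ?_
          rw [← lintegral_deriv_gridInterpolation_sq hm, hilbertNormSq,
            ← setLIntegral_congr (Ioo_ae_eq_Icc (μ := volume) (a := (0 : ℝ)) (b := 1)),
            ← setLIntegral_congr (Ioo_ae_eq_Icc (μ := volume) (a := (0 : ℝ)) (b := 1))]
          refine setLIntegral_congr_fun measurableSet_Ioo fun x hx => ?_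
          have : extendToReal (g l) =ᶠ[𝓝 x] gridInterpolation m (d l) := by
            filter_upwards [Ioo_mem_nhds hx.1 hx.2] with y hy
            exact hext l y (Set.Ioo_subset_Icc_self hy)
          simp only [this.deriv_eq]
      _ = ENNReal.ofReal (∑ l, m * ∑ i ∈ Finset.range m, d l i ^ 2) :=
          (ENNReal.ofReal_sum_of_nonneg fun l _ => by positivity).symm
      _ ≤ 1 := by rw [← ENNReal.ofReal_one]; exact ENNReal.ofReal_le_ofReal hd
  · rw [hext l _ ⟨by positivity, by rw [div_le_one hm']; exact_mod_cast hj⟩,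
      gridInterpolation_grid hm _ hj]

/-! ### Sums of bounded functions of independent uniform variables -/

/-- A sequence of independent random variables, uniform on `[0,1]`. -/
structure IsIIDUniform {Ω : Type*} [MeasurableSpace Ω] (V : ℕ → Ω → ℝ) (P : Measure Ω) : Prop where
  measurable : ∀ i, Measurable (V i)
  indep : iIndepFun V P
  map_eq : ∀ i, P.map (V i) = volume.restrict (Set.Icc 0 1)

section

variable {Ω : Type*} [MeasurableSpace Ω] {P : Measure Ω}

theorem IsIIDUniform.shift {V : ℕ → Ω → ℝ} (hV : IsIIDUniform V P) (c : ℕ) :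
    IsIIDUniform (fun i => V (i + c)) P :=
  ⟨fun _ => hV.measurable _, hV.indep.precomp (add_left_injective c), fun _ => hV.map_eq _⟩

theorem IsIIDUniform.integral_comp {V : ℕ → Ω → ℝ} (hV : IsIIDUniform V P) {φ : ℝ → ℝ}
    (hφ : Measurable φ) (i : ℕ) : ∫ ω, φ (V i ω) ∂P = ∫ x in Set.Icc (0 : ℝ) 1, φ x := by
  rw [← hV.map_eq i, integral_map (hV.measurable i).aemeasurable hφ.aestronglyMeasurable]

theorem integrable_of_abs_le [IsFiniteMeasure P] {f : Ω → ℝ} (hf : Measurable f) {C : ℝ}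
    (h : ∀ ω, |f ω| ≤ C) : Integrable f P :=
  Integrable.of_bound hf.aestronglyMeasurable C (Eventually.of_forall h)

theorem abs_sum_comp_le {φ : ℝ → ℝ} {M : ℝ} (hM : ∀ x, |φ x| ≤ M) (u : ℕ → ℝ) (n : ℕ) :
    |∑ i ∈ Finset.range n, φ (u i)| ≤ n * M := by
  refine (Finset.abs_sum_le_sum_abs _ _).trans ((Finset.sum_le_sum fun i _ => hM (u i)).trans_eq ?_)
  simp

theorem IsIIDUniform.measurable_sum {V : ℕ → Ω → ℝ} (hV : IsIIDUniform V P) {φ : ℝ → ℝ}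
    (hφ : Measurable φ) (n : ℕ) : Measurable fun ω => ∑ i ∈ Finset.range n, φ (V i ω) :=
  Finset.measurable_fun_sum _ fun i _ => hφ.comp (hV.measurable i)

theorem IsIIDUniform.integrable_exp_sum [IsFiniteMeasure P] {V : ℕ → Ω → ℝ}
    (hV : IsIIDUniform V P) {φ : ℝ → ℝ} (hφ : Measurable φ) {M : ℝ} (hM : ∀ x, |φ x| ≤ M) (n : ℕ) :
    Integrable (fun ω => Real.exp (∑ i ∈ Finset.range n, φ (V i ω))) P := by
  refine integrable_of_abs_le (hV.measurable_sum hφ n).exp (C := Real.exp (n * M)) fun ω => ?_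
  rw [Real.abs_exp]
  exact Real.exp_le_exp.2 ((le_abs_self _).trans (abs_sum_comp_le hM _ n))

theorem IsIIDUniform.integral_exp_sum {V : ℕ → Ω → ℝ}
    (hV : IsIIDUniform V P) {φ : ℝ → ℝ} (hφ : Measurable φ) (n : ℕ) :
    ∫ ω, Real.exp (∑ i ∈ Finset.range n, φ (V i ω)) ∂P =
      (∫ x in Set.Icc (0 : ℝ) 1, Real.exp (φ x)) ^ n := by
  have h := (hV.indep.comp (fun _ => φ) fun _ => hφ).mgf_sum (t := 1)
    (fun i => hφ.comp (hV.measurable i)) (Finset.range n)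
  simp only [mgf, one_mul, Finset.sum_apply, Function.comp_apply] at h
  rw [h, Finset.prod_congr rfl fun i _ => hV.integral_comp hφ.exp i]
  simp

theorem one_le_integral_exp {φ : ℝ → ℝ} (hφ : Measurable φ) {M : ℝ} (hM : ∀ x, |φ x| ≤ M)
    (h0 : ∫ x in Set.Icc (0 : ℝ) 1, φ x = 0) :
    1 ≤ ∫ x in Set.Icc (0 : ℝ) 1, Real.exp (φ x) := by
  have h1 : Integrable φ (volume.restrict (Set.Icc (0 : ℝ) 1)) := integrable_of_abs_le hφ hM
  have h2 : Integrable (fun x => Real.exp (φ x)) (volume.restrict (Set.Icc (0 : ℝ) 1)) :=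
    integrable_of_abs_le hφ.exp (C := Real.exp M) fun x => by
      rw [Real.abs_exp]; exact Real.exp_le_exp.2 ((le_abs_self _).trans (hM x))
  have h3 : ∫ x in Set.Icc (0 : ℝ) 1, (φ x + 1) ≤ ∫ x in Set.Icc (0 : ℝ) 1, Real.exp (φ x) :=
    integral_mono (h1.add (integrable_const _)) h2 fun x => Real.add_one_le_exp _
  rw [integral_add h1 (integrable_const _), h0] at h3
  simpa using h3

/-- The exponential maximal inequality for partial sums of centred variables: Doob's inequality
for the submartingale `exp (∑ φ (V i))`. -/
theorem IsIIDUniform.measure_exists_le_sum_le [IsProbabilityMeasure P] {V : ℕ → Ω → ℝ}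
    (hV : IsIIDUniform V P) {φ : ℝ → ℝ} (hφ : Measurable φ) {M : ℝ} (hM : ∀ x, |φ x| ≤ M)
    (h0 : ∫ x in Set.Icc (0 : ℝ) 1, φ x = 0) (N : ℕ) (x : ℝ) :
    P {ω | ∃ n ≤ N, x ≤ ∑ i ∈ Finset.range n, φ (V i ω)} ≤
      ENNReal.ofReal (Real.exp (-x) * (∫ x in Set.Icc (0 : ℝ) 1, Real.exp (φ x)) ^ N) := by
  have hone := one_le_integral_exp hφ hM h0
  rcases le_or_gt x 0 with hx | hx
  · refine prob_le_one.trans ?_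
    rw [← ENNReal.ofReal_one]
    apply ENNReal.ofReal_le_ofReal
    exact one_le_mul_of_one_le_of_one_le (Real.one_le_exp (by linarith)) (one_le_pow₀ hone)
  rcases Nat.eq_zero_or_pos N with rfl | hN
  · have : {ω | ∃ n ≤ 0, x ≤ ∑ i ∈ Finset.range n, φ (V i ω)} = ∅ := by
      ext ω
      simp [hx]
    rw [this, measure_empty]
    exact zero_le
  set ℱ := Filtration.natural V fun i => (hV.measurable i).stronglyMeasurable with hℱ
  set f : ℕ → Ω → ℝ := fun n ω => Real.exp (∑ i ∈ Finset.range (n + 1), φ (V i ω)) with hf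
  have hadp : StronglyAdapted ℱ f := by
    intro n
    refine Measurable.stronglyMeasurable ?_
    refine Measurable.exp (Finset.measurable_fun_sum _ fun i hi => hφ.comp ?_)
    exact ((Filtration.stronglyAdapted_natural _ i).mono
      (ℱ.mono (Nat.lt_succ_iff.1 (Finset.mem_range.1 hi)))).measurable
  have hint : ∀ n, Integrable (f n) P := fun n => hV.integrable_exp_sum hφ hM (n + 1)
  have hφint : ∀ n, Integrable (fun ω => Real.exp (φ (V n ω))) P := fun n =>
    integrable_of_abs_le (hφ.comp (hV.measurable n)).exp (C := Real.exp M) fun ω => by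
      rw [Real.abs_exp]; exact Real.exp_le_exp.2 ((le_abs_self _).trans (hM _))
  have hsub : Submartingale f ℱ P := by
    refine submartingale_nat hadp hint fun n => ?_
    have hmul : f (n + 1) = f n * fun ω => Real.exp (φ (V (n + 1) ω)) := by
      ext ω
      simp only [hf, Pi.mul_apply]
      rw [Finset.sum_range_succ, Real.exp_add]
    have h1 := condExp_mul_of_stronglyMeasurable_left (m := ℱ n) (hadp n) (hmul ▸ hint (n + 1))
      (hφint (n + 1))
    have hind : Indep (MeasurableSpace.comap (V (n + 1)) inferInstance) (ℱ n) P :=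
      hV.indep.indep_comap_natural_of_lt (fun i => (hV.measurable i).stronglyMeasurable)
        (Nat.lt_succ_self n)
    have h2 := condExp_indep_eq (hV.measurable (n + 1)).comap_le (ℱ.le n)
      (f := fun ω => Real.exp (φ (V (n + 1) ω)))
      (hφ.exp.comp (comap_measurable (V (n + 1)))).stronglyMeasurable hind
    rw [hmul]
    filter_upwards [h1, h2] with ω h1 h2
    rw [h1, Pi.mul_apply, h2, hV.integral_comp hφ.exp]
    exact le_mul_of_one_le_right (Real.exp_pos _).le hone
  have hmax := maximal_ineq hsub (fun n ω => (Real.exp_pos _).le)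
    (ε := (Real.exp x).toNNReal) (N - 1)
  have hexp : ENNReal.ofReal (Real.exp x) ≠ 0 := by simp [Real.exp_pos]
  change ENNReal.ofReal (Real.exp x) * _ ≤ _ at hmax
  rw [Real.coe_toNNReal _ (Real.exp_pos x).le] at hmax
  have hub : ∫ ω in {ω | Real.exp x ≤
      (Finset.range (N - 1 + 1)).sup' Finset.nonempty_range_add_one fun k => f k ω}, f (N - 1) ω ∂P
      ≤ (∫ x in Set.Icc (0 : ℝ) 1, Real.exp (φ x)) ^ N := by
    rw [← hV.integral_exp_sum hφ N]
    have : f (N - 1) = fun ω => Real.exp (∑ i ∈ Finset.range N, φ (V i ω)) := by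
      simp only [hf, Nat.sub_add_cancel hN]
    rw [← this]
    exact setIntegral_le_integral (hint _) (Eventually.of_forall fun ω => (Real.exp_pos _).le)
  have hsubset : {ω | ∃ n ≤ N, x ≤ ∑ i ∈ Finset.range n, φ (V i ω)} ⊆
      {ω | Real.exp x ≤
      (Finset.range (N - 1 + 1)).sup' Finset.nonempty_range_add_one fun k => f k ω} := by
    rintro ω ⟨n, hn, hxn⟩
    rw [Set.mem_ofPred_eq, Finset.le_sup'_iff]
    have hn0 : n ≠ 0 := by
      rintro rfl
      simp at hxn
      linarith
    refine ⟨n - 1, Finset.mem_range.2 (by omega), ?_⟩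
    simp only [hf, Nat.sub_add_cancel (Nat.pos_of_ne_zero hn0)]
    exact Real.exp_le_exp.2 hxn
  refine (measure_mono hsubset).trans ?_
  rw [ENNReal.ofReal_mul (Real.exp_pos _).le, Real.exp_neg, ENNReal.ofReal_inv_of_pos (Real.exp_pos _),
    mul_comm, ← div_eq_mul_inv, ENNReal.le_div_iff_mul_le (Or.inl hexp) (Or.inl ENNReal.ofReal_ne_top),
    mul_comm]
  exact hmax.trans (ENNReal.ofReal_le_ofReal hub)

/-- The elementary bound `exp x ≤ 1 + x + x²` for `|x| ≤ 1`, integrated. -/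
theorem integral_exp_le_exp_integral_sq {φ : ℝ → ℝ} (hφ : Measurable φ) (hM : ∀ x, |φ x| ≤ 1)
    (h0 : ∫ x in Set.Icc (0 : ℝ) 1, φ x = 0) :
    ∫ x in Set.Icc (0 : ℝ) 1, Real.exp (φ x) ≤ Real.exp (∫ x in Set.Icc (0 : ℝ) 1, φ x ^ 2) := by
  have h1 : Integrable φ (volume.restrict (Set.Icc (0 : ℝ) 1)) := integrable_of_abs_le hφ hM
  have h2 : Integrable (fun x => Real.exp (φ x)) (volume.restrict (Set.Icc (0 : ℝ) 1)) :=
    integrable_of_abs_le hφ.exp (C := Real.exp 1) fun x => by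
      rw [Real.abs_exp]; exact Real.exp_le_exp.2 ((le_abs_self _).trans (hM x))
  have h4 : Integrable (fun x => φ x ^ 2) (volume.restrict (Set.Icc (0 : ℝ) 1)) :=
    integrable_of_abs_le (hφ.pow_const 2) (C := 1) fun x => by
      rw [abs_pow]; exact pow_le_one₀ (abs_nonneg _) (hM x)
  have h5 : Integrable (fun x => φ x + φ x ^ 2) (volume.restrict (Set.Icc (0 : ℝ) 1)) := h1.add h4
  have h3 : ∫ x in Set.Icc (0 : ℝ) 1, Real.exp (φ x) ≤
      ∫ x in Set.Icc (0 : ℝ) 1, (1 + (φ x + φ x ^ 2)) :=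
    integral_mono h2 ((integrable_const _).add h5) fun x => by
      have := (abs_le.1 (Real.abs_exp_sub_one_sub_id_le (hM x))).2
      dsimp only
      linarith
  rw [integral_add (integrable_const _) h5, integral_add h1 h4, h0] at h3
  refine h3.trans ?_
  simp only [integral_const, measureReal_restrict_apply, MeasurableSet.univ, Set.univ_inter,
    Real.volume_real_Icc_of_le zero_le_one, sub_zero, smul_eq_mul, mul_one, zero_add]
  rw [add_comm]
  exact Real.add_one_le_exp _

/-! ### Centred counts of intervals -/

/-- The centred indicator function of the interval `(a, b]`. -/
noncomputable def centeredIndicator (a b x : ℝ) : ℝ := (Set.Ioc a b).indicator 1 x - (b - a)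

/-- The centred number of points among `u 0, …, u (n - 1)` in the interval `(a, b]`. -/
noncomputable def centeredCount (u : ℕ → ℝ) (n : ℕ) (a b : ℝ) : ℝ :=
  ∑ i ∈ Finset.range n, centeredIndicator a b (u i)

theorem measurable_centeredIndicator (a b : ℝ) : Measurable (centeredIndicator a b) :=
  (measurable_one.indicator measurableSet_Ioc).sub_const _

theorem abs_centeredIndicator_le {a b : ℝ} (ha : 0 ≤ a) (hab : a ≤ b) (hb : b ≤ 1) (x : ℝ) :
    |centeredIndicator a b x| ≤ 1 := by
  unfold centeredIndicator
  rw [abs_le]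
  by_cases hx : x ∈ Set.Ioc a b
  · rw [Set.indicator_of_mem hx, Pi.one_apply]
    constructor <;> linarith
  · rw [Set.indicator_of_notMem hx]
    constructor <;> linarith

theorem centeredIndicator_add {a b c : ℝ} (hab : a ≤ b) (hbc : b ≤ c) (x : ℝ) :
    centeredIndicator a b x + centeredIndicator b c x = centeredIndicator a c x := by
  unfold centeredIndicator
  have h : (Set.Ioc a c).indicator (1 : ℝ → ℝ) x =
      (Set.Ioc a b).indicator 1 x + (Set.Ioc b c).indicator 1 x := by
    rw [← Set.Ioc_union_Ioc_eq_Ioc hab hbc, Set.indicator_union_of_disjoint]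
    exact Set.disjoint_left.2 fun y hy hy' => absurd hy.2 (not_le.2 hy'.1)
  rw [h]
  ring

theorem centeredCount_add (u : ℕ → ℝ) (n : ℕ) {a b c : ℝ} (hab : a ≤ b) (hbc : b ≤ c) :
    centeredCount u n a b + centeredCount u n b c = centeredCount u n a c := by
  unfold centeredCount
  rw [← Finset.sum_add_distrib]
  exact Finset.sum_congr rfl fun i _ => centeredIndicator_add hab hbc _

theorem centeredCount_self (u : ℕ → ℝ) (n : ℕ) (a : ℝ) : centeredCount u n a a = 0 := by
  simp [centeredCount, centeredIndicator]

/-- Shrinking an interval on the right increases its centred count by at most the length lost, up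
to the number of points. -/
theorem abs_centeredCount_le_of_subset (u : ℕ → ℝ) (n : ℕ) {a b c : ℝ} (hab : a ≤ b) (hbc : b ≤ c) :
    |centeredCount u n a b| ≤ |centeredCount u n a c| + n * (c - a) := by
  have h1 : -(n * (c - a)) ≤ centeredCount u n a b := by
    unfold centeredCount
    have : ∑ i ∈ Finset.range n, (-(c - a)) ≤ ∑ i ∈ Finset.range n, centeredIndicator a b (u i) := by
      refine Finset.sum_le_sum fun i _ => ?_
      unfold centeredIndicator
      have : 0 ≤ (Set.Ioc a b).indicator (1 : ℝ → ℝ) (u i) :=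
        Set.indicator_nonneg (fun _ _ => zero_le_one) _
      linarith
    rw [Finset.sum_const, Finset.card_range, nsmul_eq_mul] at this
    linarith
  have h2 : centeredCount u n a b ≤ centeredCount u n a c + n * (c - a) := by
    unfold centeredCount
    have : ∑ i ∈ Finset.range n, centeredIndicator a b (u i) ≤
        ∑ i ∈ Finset.range n, (centeredIndicator a c (u i) + (c - a)) := by
      refine Finset.sum_le_sum fun i _ => ?_
      unfold centeredIndicator
      have : (Set.Ioc a b).indicator (1 : ℝ → ℝ) (u i) ≤ (Set.Ioc a c).indicator 1 (u i) :=
        Set.indicator_le_indicator_of_subset (Set.Ioc_subset_Ioc_right hbc)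
          (fun _ => zero_le_one) _
      linarith
    rwa [Finset.sum_add_distrib, Finset.sum_const, Finset.card_range, nsmul_eq_mul] at this
  rw [abs_le]
  constructor
  · have := abs_nonneg (centeredCount u n a c)
    linarith
  · have := le_abs_self (centeredCount u n a c)
    linarith

theorem setIntegral_indicator_Ioc {a b : ℝ} (ha : 0 ≤ a) (hb : b ≤ 1) :
    ∫ x in Set.Icc (0 : ℝ) 1, (Set.Ioc a b).indicator (1 : ℝ → ℝ) x = max (b - a) 0 := by
  have h : Set.Ioc a b ⊆ Set.Icc 0 1 := fun x hx => ⟨ha.trans hx.1.le, hx.2.trans hb⟩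
  rw [setIntegral_indicator measurableSet_Ioc, Set.inter_eq_right.2 h]
  simp [Measure.real, Real.volume_Ioc, ENNReal.toReal_ofReal']

theorem integrable_indicator_Ioc (a b : ℝ) :
    Integrable ((Set.Ioc a b).indicator (1 : ℝ → ℝ)) (volume.restrict (Set.Icc (0 : ℝ) 1)) :=
  (integrable_const (1 : ℝ)).indicator measurableSet_Ioc

theorem integral_centeredIndicator {a b : ℝ} (ha : 0 ≤ a) (hab : a ≤ b) (hb : b ≤ 1) :
    ∫ x in Set.Icc (0 : ℝ) 1, centeredIndicator a b x = 0 := by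
  unfold centeredIndicator
  rw [integral_sub (integrable_indicator_Ioc a b) (integrable_const _),
    setIntegral_indicator_Ioc ha hb]
  simp [hab]

theorem integral_centeredIndicator_mul {a b c d : ℝ} (ha : 0 ≤ a) (hab : a ≤ b) (hb : b ≤ 1)
    (hc : 0 ≤ c) (hcd : c ≤ d) (hd : d ≤ 1) :
    ∫ x in Set.Icc (0 : ℝ) 1, centeredIndicator a b x * centeredIndicator c d x =
      max (min b d - max a c) 0 - (b - a) * (d - c) := by
  have e : ∀ x, centeredIndicator a b x * centeredIndicator c d x =
      (Set.Ioc (max a c) (min b d)).indicator 1 x -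
        ((b - a) * centeredIndicator c d x + (d - c) * (Set.Ioc a b).indicator 1 x) := by
    intro x
    have : (Set.Ioc (max a c) (min b d)).indicator (1 : ℝ → ℝ) x =
        (Set.Ioc a b).indicator 1 x * (Set.Ioc c d).indicator 1 x := by
      rw [← Set.Ioc_inter_Ioc, Set.inter_indicator_one, Pi.mul_apply]
    rw [this]
    unfold centeredIndicator
    ring
  simp_rw [e]
  have h1 : Integrable (fun x => (b - a) * centeredIndicator c d x)
      (volume.restrict (Set.Icc (0 : ℝ) 1)) :=
    ((integrable_indicator_Ioc c d).sub (integrable_const _)).const_mul _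
  have h2 : Integrable (fun x => (d - c) * (Set.Ioc a b).indicator (1 : ℝ → ℝ) x)
      (volume.restrict (Set.Icc (0 : ℝ) 1)) := (integrable_indicator_Ioc a b).const_mul _
  have h3 : Integrable (fun x => (b - a) * centeredIndicator c d x +
    (d - c) * (Set.Ioc a b).indicator (1 : ℝ → ℝ) x)
      (volume.restrict (Set.Icc (0 : ℝ) 1)) := h1.add h2
  rw [integral_sub (integrable_indicator_Ioc _ _) h3, integral_add h1 h2, integral_const_mul,
    integral_const_mul, integral_centeredIndicator hc hcd hd,
    setIntegral_indicator_Ioc (ha.trans (le_max_left _ _)) ((min_le_left _ _).trans hb),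
    setIntegral_indicator_Ioc ha hb, max_eq_left (sub_nonneg.2 hab)]
  ring

/-- A Bernstein inequality, in its Gaussian regime, for the maximum of a centred count. -/
theorem IsIIDUniform.measure_exists_le_abs_centeredCount_le [IsProbabilityMeasure P]
    {V : ℕ → Ω → ℝ} (hV : IsIIDUniform V P) {a b : ℝ} (ha : 0 ≤ a) (hab : a < b) (hb : b ≤ 1)
    {N : ℕ} (hN : 0 < N) {y : ℝ} (hy0 : 0 ≤ y) (hy : y ≤ 2 * (N * (b - a))) :
    P {ω | ∃ n ≤ N, y ≤ |centeredCount (fun i => V i ω) n a b|} ≤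
      ENNReal.ofReal (2 * Real.exp (-(y ^ 2 / (4 * (N * (b - a)))))) := by
  have hN' : (0 : ℝ) < N := by exact_mod_cast hN
  have hp : 0 < N * (b - a) := mul_pos hN' (sub_pos.2 hab)
  -- the tilting parameter minimising the exponent
  set c : ℝ := y / (2 * (N * (b - a))) with hc
  have hc0 : 0 ≤ c := by positivity
  have hc1 : c ≤ 1 := by rw [hc, div_le_one (by positivity)]; exact hy
  have key : ∀ e : ℝ, |e| = 1 →
      P {ω | ∃ n ≤ N, c * y ≤ ∑ i ∈ Finset.range n, e * c * centeredIndicator a b (V i ω)} ≤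
        ENNReal.ofReal (Real.exp (-(y ^ 2 / (4 * (N * (b - a)))))) := by
    intro e he
    have hb1 : ∀ x, |e * c * centeredIndicator a b x| ≤ 1 := fun x => by
      rw [abs_mul, abs_mul, he, one_mul, abs_of_nonneg hc0]
      exact mul_le_one₀ hc1 (abs_nonneg _) (abs_centeredIndicator_le ha hab.le hb x)
    have hm : Measurable fun x => e * c * centeredIndicator a b x :=
      (measurable_centeredIndicator a b).const_mul _
    have hz : ∫ x in Set.Icc (0 : ℝ) 1, e * c * centeredIndicator a b x = 0 := by
      rw [integral_const_mul, integral_centeredIndicator ha hab.le hb, mul_zero]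
    refine (hV.measure_exists_le_sum_le hm hb1 hz N (c * y)).trans (ENNReal.ofReal_le_ofReal ?_)
    have h1 := integral_exp_le_exp_integral_sq hm hb1 hz
    have h2 : ∫ x in Set.Icc (0 : ℝ) 1, (e * c * centeredIndicator a b x) ^ 2 ≤ c ^ 2 * (b - a) := by
      have : ∀ x, (e * c * centeredIndicator a b x) ^ 2 =
          c ^ 2 * (centeredIndicator a b x * centeredIndicator a b x) := fun x => by
        have he2 : e ^ 2 = 1 := by rw [← sq_abs, he, one_pow]
        linear_combination (c * centeredIndicator a b x) ^ 2 * he2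
      simp_rw [this]
      rw [integral_const_mul, integral_centeredIndicator_mul ha hab.le hb ha hab.le hb]
      refine mul_le_mul_of_nonneg_left ?_ (sq_nonneg _)
      rw [min_self, max_self, max_eq_left (sub_nonneg.2 hab.le)]
      nlinarith [mul_self_nonneg (b - a)]
    have h3 : (∫ x in Set.Icc (0 : ℝ) 1, Real.exp (e * c * centeredIndicator a b x)) ^ N ≤
        Real.exp (N * (c ^ 2 * (b - a))) := by
      rw [Real.exp_nat_mul]
      exact pow_le_pow_left₀ (zero_le_one.trans (one_le_integral_exp hm hb1 hz))
        (h1.trans (Real.exp_le_exp.2 h2)) N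
    refine (mul_le_mul_of_nonneg_left h3 (Real.exp_pos _).le).trans ?_
    rw [← Real.exp_add]
    apply Real.exp_le_exp.2
    apply le_of_eq
    rw [hc]
    field_simp
    ring
  have hsubset : {ω | ∃ n ≤ N, y ≤ |centeredCount (fun i => V i ω) n a b|} ⊆
      {ω | ∃ n ≤ N, c * y ≤ ∑ i ∈ Finset.range n, 1 * c * centeredIndicator a b (V i ω)} ∪
      {ω | ∃ n ≤ N, c * y ≤ ∑ i ∈ Finset.range n, -1 * c * centeredIndicator a b (V i ω)} := by
    rintro ω ⟨n, hn, h⟩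
    rcases le_abs'.1 h with h | h
    · refine Or.inr ⟨n, hn, ?_⟩
      rw [← Finset.mul_sum, ← centeredCount]
      nlinarith
    · refine Or.inl ⟨n, hn, ?_⟩
      rw [← Finset.mul_sum, ← centeredCount]
      nlinarith
  refine (measure_mono hsubset).trans ((measure_union_le _ _).trans ?_)
  rw [two_mul, ENNReal.ofReal_add (Real.exp_pos _).le (Real.exp_pos _).le]
  exact add_le_add (key 1 abs_one) (key (-1) (by simp))

end

/-! ### The oscillation of the local empirical process -/

/-- Dyadic chaining with geometrically decreasing increments. -/
theorem abs_sub_dyadic_le {G : ℝ → ℝ} {x : ℝ} {r J : ℕ} (hrJ : r ≤ J)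
    (h : ∀ j, r ≤ j → j ≤ J → ∀ i : ℕ, i < 2 ^ j →
      |G ((i + 1 : ℝ) / 2 ^ j) - G ((i : ℝ) / 2 ^ j)| ≤ x * (4 / 5) ^ j)
    {s : ℝ} (hs : s ∈ Set.Ico (0 : ℝ) 1) :
    |G ((⌊2 ^ J * s⌋₊ : ℝ) / 2 ^ J) - G ((⌊2 ^ r * s⌋₊ : ℝ) / 2 ^ r)| ≤
      x * (4 * (4 / 5) ^ r - 4 * (4 / 5) ^ J) := by
  induction J, hrJ using Nat.le_induction with
  | base => simp
  | succ J hrJ ih =>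
    have ih' := ih fun j h1 h2 => h j h1 (h2.trans J.le_succ)
    have hpow : (0 : ℝ) < 2 ^ J := by positivity
    have hx0 : 0 ≤ x * (4 / 5) ^ (J + 1) :=
      (abs_nonneg _).trans (h (J + 1) (by omega) le_rfl 0 (by positivity))
    have hstep : |G ((⌊2 ^ (J + 1) * s⌋₊ : ℝ) / 2 ^ (J + 1)) - G ((⌊2 ^ J * s⌋₊ : ℝ) / 2 ^ J)| ≤
        x * (4 / 5) ^ (J + 1) := by
      have hnn : 0 ≤ 2 ^ J * s := mul_nonneg hpow.le hs.1
      have f1 : (⌊2 ^ J * s⌋₊ : ℝ) ≤ 2 ^ J * s := Nat.floor_le hnn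
      have f2 : 2 ^ J * s < (⌊2 ^ J * s⌋₊ : ℝ) + 1 := Nat.lt_floor_add_one _
      have g1 : (⌊2 ^ (J + 1) * s⌋₊ : ℝ) ≤ 2 ^ (J + 1) * s :=
        Nat.floor_le (mul_nonneg (by positivity) hs.1)
      have g2 : 2 ^ (J + 1) * s < (⌊2 ^ (J + 1) * s⌋₊ : ℝ) + 1 := Nat.lt_floor_add_one _
      have hp : (2 : ℝ) ^ (J + 1) = 2 * 2 ^ J := by ring
      have hq1 : ⌊2 ^ (J + 1) * s⌋₊ < 2 * ⌊2 ^ J * s⌋₊ + 2 := by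
        have : (⌊2 ^ (J + 1) * s⌋₊ : ℝ) < 2 * ⌊2 ^ J * s⌋₊ + 2 := by
          rw [hp] at g1 ⊢; linarith
        exact_mod_cast this
      have hq2 : 2 * ⌊2 ^ J * s⌋₊ < ⌊2 ^ (J + 1) * s⌋₊ + 1 := by
        have : (2 * ⌊2 ^ J * s⌋₊ : ℝ) < ⌊2 ^ (J + 1) * s⌋₊ + 1 := by
          rw [hp] at g2 ⊢; linarith
        exact_mod_cast this
      have hlt : ⌊2 ^ J * s⌋₊ < 2 ^ J := by
        rw [Nat.floor_lt hnn]
        push_cast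
        nlinarith [hs.2]
      have hcoarse : (⌊2 ^ J * s⌋₊ : ℝ) / 2 ^ J = ((2 * ⌊2 ^ J * s⌋₊ : ℕ) : ℝ) / 2 ^ (J + 1) := by
        rw [hp]; push_cast; field_simp
      rw [hcoarse]
      obtain hq | hq : ⌊2 ^ (J + 1) * s⌋₊ = 2 * ⌊2 ^ J * s⌋₊ ∨
          ⌊2 ^ (J + 1) * s⌋₊ = 2 * ⌊2 ^ J * s⌋₊ + 1 := by omega
      · rw [hq, sub_self, abs_zero]
        exact hx0
      · rw [hq]
        have := h (J + 1) (by omega) le_rfl (2 * ⌊2 ^ J * s⌋₊) (by rw [pow_succ]; omega)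
        push_cast at this ⊢
        exact this
    have e : x * (4 * (4 / 5) ^ r - 4 * (4 / 5) ^ (J + 1)) =
        x * (4 / 5) ^ (J + 1) + x * (4 * (4 / 5) ^ r - 4 * (4 / 5) ^ J) := by ring
    rw [e]
    exact (abs_sub_le _ _ _).trans (add_le_add hstep ih')

theorem centeredCount_sub (u : ℕ → ℝ) (n : ℕ) {a b c : ℝ} (hab : a ≤ b) (hbc : b ≤ c) :
    centeredCount u n a c - centeredCount u n a b = centeredCount u n b c := by
  rw [← centeredCount_add u n hab hbc]
  ring

/-- Chaining down to level `J`, below which the monotonicity of the counts takes over. -/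
theorem abs_centeredCount_oscillation_le {u : ℕ → ℝ} {n N : ℕ} (hn : n ≤ N) {t H x : ℝ}
    (hH : 0 < H) (hx : 0 ≤ x) {r J : ℕ} (hrJ : r ≤ J)
    (h : ∀ j, r ≤ j → j ≤ J → ∀ i : ℕ, i < 2 ^ j →
      |centeredCount u n (t + H * ((i : ℝ) / 2 ^ j)) (t + H * ((i + 1 : ℝ) / 2 ^ j))| ≤
        x * (4 / 5) ^ j)
    {s : ℝ} (hs : s ∈ Set.Icc (0 : ℝ) 1) :
    |centeredCount u n (t + H * ((⌊2 ^ r * s⌋₊ : ℝ) / 2 ^ r)) (t + H * s)| ≤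
      4 * x + N * H / 2 ^ J := by
  rcases hs.2.eq_or_lt with rfl | hs1
  · have : (⌊(2 : ℝ) ^ r * 1⌋₊ : ℝ) / 2 ^ r = 1 := by
      rw [mul_one]
      have : ⌊(2 : ℝ) ^ r⌋₊ = 2 ^ r := by exact_mod_cast Nat.floor_natCast (R := ℝ) (2 ^ r)
      rw [this]
      push_cast
      exact div_self (by positivity)
    rw [this, centeredCount_self, abs_zero]
    positivity
  have hpos : ∀ j : ℕ, (0 : ℝ) < 2 ^ j := fun j => by positivity
  have hfl : ∀ j : ℕ, (⌊2 ^ j * s⌋₊ : ℝ) / 2 ^ j ≤ s := fun j => by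
    rw [div_le_iff₀ (hpos j), mul_comm s]
    exact Nat.floor_le (mul_nonneg (hpos j).le hs.1)
  have hmono : ∀ {a b : ℝ}, a ≤ b → t + H * a ≤ t + H * b := fun hab => by gcongr
  have h0 : ∀ {a : ℝ}, 0 ≤ a → t ≤ t + H * a := fun ha => by nlinarith
  have hchain := abs_sub_dyadic_le (G := fun v => centeredCount u n t (t + H * v)) (x := x) hrJ
    (fun j h1 h2 i hi => by
      have := h j h1 h2 i hi
      rwa [← centeredCount_sub u n (h0 (a := (i : ℝ) / 2 ^ j) (by positivity))
        (hmono (by gcongr; linarith))] at this)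
    ⟨hs.1, hs1⟩
  have hlt : ⌊2 ^ J * s⌋₊ < 2 ^ J := by
    rw [Nat.floor_lt (mul_nonneg (hpos J).le hs.1)]
    push_cast
    nlinarith [hpos J]
  have hcell := h J hrJ le_rfl _ hlt
  have hs2 : s ≤ (⌊2 ^ J * s⌋₊ + 1 : ℝ) / 2 ^ J := by
    rw [le_div_iff₀ (hpos J), mul_comm s]
    exact (Nat.lt_floor_add_one _).le
  have hlast := abs_centeredCount_le_of_subset u n (hmono (hfl J)) (hmono hs2)
  have hlen : (t + H * ((⌊2 ^ J * s⌋₊ + 1 : ℝ) / 2 ^ J)) - (t + H * ((⌊2 ^ J * s⌋₊ : ℝ) / 2 ^ J)) =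
      H / 2 ^ J := by ring
  rw [hlen] at hlast
  have hnN : (n : ℝ) * (H / 2 ^ J) ≤ N * H / 2 ^ J := by
    rw [mul_div_assoc]
    have : (n : ℝ) ≤ N := by exact_mod_cast hn
    gcongr
  have e1 := centeredCount_sub u n (h0 (by positivity)) (hmono (hfl r))
  have e2 := centeredCount_sub u n (h0 (by positivity)) (hmono (hfl J))
  have e3 : centeredCount u n (t + H * ((⌊2 ^ r * s⌋₊ : ℝ) / 2 ^ r)) (t + H * s) =
      centeredCount u n (t + H * ((⌊2 ^ J * s⌋₊ : ℝ) / 2 ^ J)) (t + H * s) +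
      (centeredCount u n t (t + H * ((⌊2 ^ J * s⌋₊ : ℝ) / 2 ^ J)) -
        centeredCount u n t (t + H * ((⌊2 ^ r * s⌋₊ : ℝ) / 2 ^ r))) := by
    rw [← e1, ← e2]; ring
  rw [e3]
  refine (abs_add_le _ _).trans ?_
  have hρ : (4 / 5 : ℝ) ^ r ≤ 1 := pow_le_one₀ (by norm_num) (by norm_num)
  have hρ' : (0 : ℝ) ≤ x * (4 / 5) ^ J := by positivity
  nlinarith

/-- With probability at least `1 - exp (-2 L)`, the process at scale `H` oscillates by at most
`ε √(N H L)` over the cells of a sufficiently fine dyadic grid, simultaneously for all `n ≤ N`. -/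
theorem exists_measure_oscillation_le {Ω : Type*} [MeasurableSpace Ω] (P : Measure Ω)
    [IsProbabilityMeasure P] {ε : ℝ} (hε : 0 < ε) :
    ∃ r₀ : ℕ, ∀ r ≥ r₀, ∃ C : ℝ, ∀ V : ℕ → Ω → ℝ, IsIIDUniform V P →
      ∀ (N : ℕ) (t H L : ℝ), 0 ≤ t → 0 < H → t + H ≤ 1 → 1 ≤ L → C * L ≤ N * H →
        P {ω | ∃ n ≤ N, ∃ s ∈ Set.Icc (0 : ℝ) 1, ε * √(N * H * L) <
          |centeredCount (fun i => V i ω) n (t + H * ((⌊2 ^ r * s⌋₊ : ℝ) / 2 ^ r)) (t + H * s)|} ≤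
        ENNReal.ofReal (Real.exp (-(2 * L))) := by
  -- from level `r₀` on, the exponents of the Gaussian bounds beat the number of cells
  obtain ⟨r₀, hr₀⟩ : ∃ r₀ : ℕ, ∀ j ≥ r₀, 2 * (j : ℝ) + 4 ≤ ε ^ 2 / 256 * (32 / 25) ^ j := by
    have h1 : Tendsto (fun j : ℕ => (j : ℝ) ^ 1 / (32 / 25 : ℝ) ^ j) atTop (𝓝 0) :=
      tendsto_pow_const_div_const_pow_of_one_lt 1 (by norm_num)
    have h2 : Tendsto (fun j : ℕ => (j : ℝ) ^ 0 / (32 / 25 : ℝ) ^ j) atTop (𝓝 0) :=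
      tendsto_pow_const_div_const_pow_of_one_lt 0 (by norm_num)
    have h3 := (h1.const_mul 2).add (h2.const_mul 4)
    simp only [mul_zero, add_zero, pow_one, pow_zero] at h3
    obtain ⟨r₀, hr₀⟩ := eventually_atTop.1 (h3.eventually_lt_const
      (show (0 : ℝ) < ε ^ 2 / 256 by positivity))
    refine ⟨r₀, fun j hj => ?_⟩
    have h4 := (hr₀ j hj).le
    have hp : (0 : ℝ) < (32 / 25) ^ j := by positivity
    rw [← mul_div_assoc, ← mul_div_assoc, ← add_div, div_le_iff₀ hp] at h4
    linarith
  refine ⟨r₀, fun r hr => ⟨(ε * 2 ^ r) ^ 2, fun V hV N t H L ht hH htH hL hC => ?_⟩⟩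
  have hL0 : 0 < L := by linarith
  have hNH : 0 < N * H := lt_of_lt_of_le (by positivity) hC
  have hN' : (0 : ℝ) < N := by
    by_contra hcon
    nlinarith [Nat.cast_nonneg (α := ℝ) N]
  have hN : 0 < N := by exact_mod_cast hN'
  set A := √(N * H * L) with hA
  have hA0 : 0 < A := Real.sqrt_pos.2 (by positivity)
  have hA2 : A ^ 2 = N * H * L := Real.sq_sqrt (by positivity)
  have hεA : 0 < ε * A := by positivity
  -- the level at which the mean count of a cell is comparable to `ε √(N H L)`
  have hQ : 2 ^ r ≤ 2 * (N * H) / (ε * A) := by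
    rw [le_div_iff₀ hεA]
    have h1 : (ε * 2 ^ r * A) ^ 2 ≤ (N * H) ^ 2 := by
      rw [mul_pow, hA2]
      nlinarith
    have h2 := le_of_sq_le_sq h1 hNH.le
    nlinarith
  obtain ⟨J', hJ1, hJ2⟩ := exists_nat_pow_near ((one_le_pow₀ one_le_two).trans hQ)
    (one_lt_two (α := ℝ))
  set J := J' + 1 with hJ
  have hJup : (2 : ℝ) ^ J * (ε * A) ≤ 4 * (N * H) := by
    rw [le_div_iff₀ hεA] at hJ1
    rw [hJ, pow_succ]
    linarith
  have hJlow : N * H / 2 ^ J ≤ ε / 2 * A := by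
    rw [div_lt_iff₀ hεA] at hJ2
    rw [div_le_iff₀ (by positivity)]
    linarith
  have hrJ : r ≤ J := by
    have : (2 : ℝ) ^ r < 2 ^ J := hQ.trans_lt hJ2
    exact ((pow_lt_pow_iff_right₀ one_lt_two).1 this).le
  set E : ℕ → ℕ → Set Ω := fun j i => {ω | ∃ n ≤ N, ε / 8 * A * (4 / 5) ^ j ≤
    |centeredCount (fun i => V i ω) n (t + H * ((i : ℝ) / 2 ^ j)) (t + H * ((i + 1 : ℝ) / 2 ^ j))|}
    with hE
  have hsubset : {ω | ∃ n ≤ N, ∃ s ∈ Set.Icc (0 : ℝ) 1, ε * A <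
      |centeredCount (fun i => V i ω) n (t + H * ((⌊2 ^ r * s⌋₊ : ℝ) / 2 ^ r)) (t + H * s)|} ⊆
      ⋃ j ∈ Finset.Icc r J, ⋃ i ∈ Finset.range (2 ^ j), E j i := by
    rintro ω ⟨n, hn, s, hs, hlt⟩
    by_contra hcon
    simp only [Set.mem_iUnion, not_exists, Finset.mem_Icc, Finset.mem_range] at hcon
    have hx0 : 0 ≤ ε / 8 * A := by positivity
    have := abs_centeredCount_oscillation_le (u := fun i => V i ω) (t := t) hn hH hx0 hrJ
      (fun j h1 h2 i hi => by
        have h3 := hcon j ⟨h1, h2⟩ i hi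
        by_contra h4
        exact h3 ⟨n, hn, (not_le.1 h4).le⟩) hs
    linarith
  have hcell : ∀ j ∈ Finset.Icc r J, ∀ i ∈ Finset.range (2 ^ j), P (E j i) ≤
      ENNReal.ofReal (2 * Real.exp (-((2 * j + 4) * L))) := by
    intro j hj i hi
    obtain ⟨hj1, hj2⟩ := Finset.mem_Icc.1 hj
    have hpj : (0 : ℝ) < 2 ^ j := by positivity
    have hi' : (i : ℝ) + 1 ≤ 2 ^ j := by exact_mod_cast Finset.mem_range.1 hi
    have hlen : (t + H * ((i + 1 : ℝ) / 2 ^ j)) - (t + H * ((i : ℝ) / 2 ^ j)) = H / 2 ^ j := by ring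
    have hle1 : (i + 1 : ℝ) / 2 ^ j ≤ 1 := (div_le_one hpj).2 hi'
    have hρ : (4 / 5 : ℝ) ^ j ≤ 1 := pow_le_one₀ (by norm_num) (by norm_num)
    have hy : ε / 8 * A * (4 / 5) ^ j ≤ 2 * (N * (H / 2 ^ j)) := by
      have h1 : (2 : ℝ) ^ j ≤ 2 ^ J := pow_le_pow_right₀ one_le_two hj2
      have e : 2 * (N * (H / 2 ^ j)) = 2 * (N * H) / 2 ^ j := by ring
      rw [e, le_div_iff₀ hpj]
      have h2 : ε / 8 * A * (4 / 5) ^ j * 2 ^ j ≤ ε / 8 * A * 1 * 2 ^ J := by gcongr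
      nlinarith
    have hb := hV.measure_exists_le_abs_centeredCount_le (a := t + H * ((i : ℝ) / 2 ^ j))
      (b := t + H * ((i + 1 : ℝ) / 2 ^ j)) (by positivity) (by gcongr; linarith)
      (by nlinarith) hN (y := ε / 8 * A * (4 / 5) ^ j) (by positivity) (by rw [hlen]; exact hy)
    refine hb.trans (ENNReal.ofReal_le_ofReal ?_)
    rw [hlen]
    gcongr
    have e : (ε / 8 * A * (4 / 5) ^ j) ^ 2 / (4 * (N * (H / 2 ^ j))) =
        ε ^ 2 / 256 * (32 / 25) ^ j * L := by
      have e1 : (ε / 8 * A * (4 / 5) ^ j) ^ 2 = ε ^ 2 / 64 * (N * H * L) * ((4 / 5) ^ j) ^ 2 := by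
        rw [← hA2]; ring
      have e2 : (32 / 25 : ℝ) ^ j = ((4 / 5) ^ j) ^ 2 * 2 ^ j := by
        rw [← pow_mul, mul_comm j 2, pow_mul, ← mul_pow]; norm_num
      rw [e1, e2]
      field_simp
      norm_num
    rw [e]
    gcongr
    exact hr₀ j (hr.trans hj1)
  refine (measure_mono hsubset).trans ((measure_biUnion_finset_le _ _).trans ?_)
  have hlevel : ∀ j ∈ Finset.Icc r J, P (⋃ i ∈ Finset.range (2 ^ j), E j i) ≤
      ENNReal.ofReal (Real.exp (-(2 * L)) * (1 / 2) ^ (j + 1)) := by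
    intro j hj
    refine (measure_biUnion_finset_le _ _).trans ((Finset.sum_le_sum (hcell j hj)).trans ?_)
    rw [Finset.sum_const, Finset.card_range, nsmul_eq_mul, ← ENNReal.ofReal_natCast,
      ← ENNReal.ofReal_mul (by positivity)]
    apply ENNReal.ofReal_le_ofReal
    have h1 : Real.exp (-((2 * j + 4) * L)) ≤ Real.exp (-(2 * L)) * Real.exp (-((2 * j + 2 : ℕ) : ℝ)) := by
      rw [← Real.exp_add]
      apply Real.exp_le_exp.2
      push_cast
      nlinarith [Nat.cast_nonneg (α := ℝ) j]
    have h2 : Real.exp (-((2 * j + 2 : ℕ) : ℝ)) ≤ ((1 / 2) ^ (j + 1)) ^ 2 := by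
      rw [Real.exp_neg, ← pow_mul, one_div, inv_pow, show (j + 1) * 2 = 2 * j + 2 by ring]
      refine inv_anti₀ (by positivity) ?_
      rw [← Real.exp_one_pow]
      exact pow_le_pow_left₀ zero_le_two (by linarith [Real.add_one_le_exp (1 : ℝ)]) _
    have h3 : (2 : ℝ) ^ j * 2 * ((1 / 2) ^ (j + 1)) = 1 := by
      rw [← pow_succ, ← mul_pow]; norm_num
    calc ((2 ^ j : ℕ) : ℝ) * (2 * Real.exp (-((2 * j + 4) * L)))
        ≤ 2 ^ j * (2 * (Real.exp (-(2 * L)) * ((1 / 2) ^ (j + 1)) ^ 2)) := by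
          push_cast
          gcongr
          exact h1.trans (by gcongr)
      _ = Real.exp (-(2 * L)) * (1 / 2) ^ (j + 1) * (2 ^ j * 2 * (1 / 2) ^ (j + 1)) := by ring
      _ = _ := by rw [h3, mul_one]
  refine (Finset.sum_le_sum hlevel).trans ?_
  rw [← ENNReal.ofReal_sum_of_nonneg fun j _ => by positivity]
  apply ENNReal.ofReal_le_ofReal
  rw [← Finset.mul_sum]
  refine mul_le_of_le_one_right (Real.exp_pos _).le ?_
  have hsum : ∑ j ∈ Finset.Icc r J, (1 / 2 : ℝ) ^ (j + 1) ≤ ∑' j : ℕ, (1 / 2 : ℝ) ^ (j + 1) := by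
    refine Summable.sum_le_tsum _ (fun _ _ => by positivity) ?_
    exact (summable_nat_add_iff 1).2 summable_geometric_two
  refine hsum.trans (le_of_eq ?_)
  simp_rw [pow_succ]
  rw [tsum_mul_right, tsum_geometric_two]
  norm_num

/-! ### Large deviations from the limit of the moment generating function -/

/-- The complement of a ball of radius `1 + ε` is covered by finitely many half-spaces at distance
at least `1 + ε / 2` from the origin. -/
theorem exists_finite_halfspaces {ι : Type*} [Fintype ι] {ε : ℝ} (hε : 0 < ε) :
    ∃ Θ : Finset (ι → ℝ), (∀ θ ∈ Θ, ∑ p, θ p ^ 2 = 1) ∧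
      ∀ y : ι → ℝ, (1 + ε) ^ 2 < ∑ p, y p ^ 2 → ∃ θ ∈ Θ, 1 + ε / 2 ≤ ∑ p, θ p * y p := by
  classical
  set η : ℝ := ε / (2 * (1 + ε)) with hη
  have hη0 : 0 < η := by positivity
  have hη1 : (1 + ε) * (1 - η) = 1 + ε / 2 := by rw [hη]; field_simp; ring
  obtain ⟨T, hTS, hTfin, hT⟩ := (isCompact_sphere (0 : EuclideanSpace ℝ ι) 1).finite_cover_balls hη0
  refine ⟨hTfin.toFinset.image fun v p => v p, ?_, ?_⟩
  · intro θ hθ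
    simp only [Finset.mem_image, Set.Finite.mem_toFinset] at hθ
    obtain ⟨v, hv, rfl⟩ := hθ
    have h1 : ‖v‖ = 1 := by simpa using hTS hv
    have h2 := EuclideanSpace.real_norm_sq_eq v
    rw [h1, one_pow] at h2
    exact h2.symm
  · intro y hy
    set w : EuclideanSpace ℝ ι := WithLp.toLp 2 y with hw
    have hwn : ‖w‖ ^ 2 = ∑ p, y p ^ 2 := EuclideanSpace.real_norm_sq_eq w
    have hw1 : 1 + ε < ‖w‖ := lt_of_pow_lt_pow_left₀ 2 (norm_nonneg _) (by rw [hwn]; exact hy)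
    have hw0 : 0 < ‖w‖ := by linarith
    have hu : ‖w‖⁻¹ • w ∈ Metric.sphere (0 : EuclideanSpace ℝ ι) 1 := by
      rw [mem_sphere_zero_iff_norm, norm_smul, norm_inv, norm_norm, inv_mul_cancel₀ hw0.ne']
    obtain ⟨v, hvT, hv⟩ := Set.mem_iUnion₂.1 (hT hu)
    refine ⟨fun p => v p, Finset.mem_image.2 ⟨v, hTfin.mem_toFinset.2 hvT, rfl⟩, ?_⟩
    have hinner : ∑ p, v p * y p = inner ℝ w v := by
      rw [PiLp.inner_apply]
      exact Finset.sum_congr rfl fun p _ => rfl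
    have h1 : inner ℝ w v = ‖w‖ - inner ℝ w (‖w‖⁻¹ • w - v) := by
      rw [inner_sub_right, inner_smul_right, real_inner_self_eq_norm_sq]
      field_simp
      ring
    have h2 : inner ℝ w (‖w‖⁻¹ • w - v) ≤ ‖w‖ * η := by
      refine (real_inner_le_norm _ _).trans ?_
      rw [Metric.mem_ball, dist_eq_norm] at hv
      gcongr
    rw [hinner, h1, ← hη1]
    have hη2 : 0 < 1 - η := by
      by_contra hcon
      nlinarith
    nlinarith

theorem eventually_le_exp_of_tendsto_log {a L : ℕ → ℝ} {c : ℝ} (ha : ∀ j, 0 < a j)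
    (hL : Tendsto L atTop atTop) (h : Tendsto (fun j => Real.log (a j) / L j) atTop (𝓝 c))
    {c' : ℝ} (hc : c < c') : ∀ᶠ j in atTop, a j ≤ Real.exp (L j * c') := by
  filter_upwards [h.eventually_lt_const hc, hL.eventually_gt_atTop 0] with j h1 h2
  rw [← Real.log_le_iff_le_exp (ha j)]
  rw [div_lt_iff₀ h2] at h1
  linarith

theorem eventually_exp_le_of_tendsto_log {a L : ℕ → ℝ} {c : ℝ} (ha : ∀ j, 0 < a j)
    (hL : Tendsto L atTop atTop) (h : Tendsto (fun j => Real.log (a j) / L j) atTop (𝓝 c))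
    {c' : ℝ} (hc : c' < c) : ∀ᶠ j in atTop, Real.exp (L j * c') ≤ a j := by
  filter_upwards [h.eventually_const_lt hc, hL.eventually_gt_atTop 0] with j h1 h2
  rw [← Real.le_log_iff_exp_le (ha j)]
  rw [lt_div_iff₀ h2] at h1
  linarith

/-- The lower bound of the Gärtner–Ellis theorem for a quadratic limit, by exponential tilting:
under the law tilted by `exp (L ⟨2x, Y⟩)` the vector `Y` concentrates at `x`. -/
theorem eventually_exp_neg_le_measure {Ω ι : Type*} [MeasurableSpace Ω] {P : Measure Ω}
    [IsProbabilityMeasure P] [Fintype ι] {Y : ℕ → Ω → ι → ℝ} {L : ℕ → ℝ}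
    (hL : Tendsto L atTop atTop) (hY : ∀ j p, Measurable fun ω => Y j ω p)
    (hint : ∀ j (θ : ι → ℝ), Integrable (fun ω => Real.exp (L j * ∑ p, θ p * Y j ω p)) P)
    (hΛ : ∀ θ : ι → ℝ, Tendsto (fun j =>
      Real.log (∫ ω, Real.exp (L j * ∑ p, θ p * Y j ω p) ∂P) / L j) atTop (𝓝 (∑ p, θ p ^ 2 / 4)))
    {x : ι → ℝ} (hx : ∑ p, x p ^ 2 < 1) {r : ℝ} (hr : 0 < r) :
    ∀ᶠ j in atTop, Real.exp (-L j) ≤ P.real {ω | ∀ p, |Y j ω p - x p| < r} := by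
  classical
  set S : ℝ := ∑ p, x p ^ 2 with hS
  set B : ℝ := ∑ p, |x p| with hB
  have hB0 : 0 ≤ B := Finset.sum_nonneg fun p _ => abs_nonneg _
  have hS1 : 0 < 1 - S := by linarith
  -- a radius so small that the density of the tilted law varies little on the ball
  obtain ⟨ρ, hρ0, hρr, hρB⟩ : ∃ ρ : ℝ, 0 < ρ ∧ ρ ≤ r ∧ 2 * ρ * B ≤ (1 - S) / 4 := by
    refine ⟨min r ((1 - S) / (8 * (B + 1))), lt_min hr (by positivity), min_le_left _ _, ?_⟩
    calc 2 * min r ((1 - S) / (8 * (B + 1))) * B ≤ 2 * ((1 - S) / (8 * (B + 1))) * (B + 1) := by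
          gcongr
          · exact min_le_right _ _
          · linarith
      _ = (1 - S) / 4 := by field_simp; ring
  obtain ⟨η, hη0, hη1, hη2⟩ : ∃ η : ℝ, 0 < η ∧ η ≤ ρ ^ 2 / 4 ∧ η ≤ (1 - S) / 4 :=
    ⟨min (ρ ^ 2 / 4) ((1 - S) / 4), lt_min (by positivity) (by positivity), min_le_left _ _,
      min_le_right _ _⟩
  set T : ℕ → Ω → ℝ := fun j ω => Real.exp (L j * ∑ p, (2 * x p) * Y j ω p) with hT
  have hpos : ∀ j (θ : ι → ℝ), 0 < ∫ ω, Real.exp (L j * ∑ p, θ p * Y j ω p) ∂P :=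
    fun j θ => integral_exp_pos (hint j θ)
  have hZ : ∀ᶠ j in atTop, Real.exp (L j * (S - η)) ≤ ∫ ω, T j ω ∂P := by
    refine eventually_exp_le_of_tendsto_log (fun j => hpos j _) hL (hΛ fun p => 2 * x p) ?_
    have : ∑ p, (2 * x p) ^ 2 / 4 = S := Finset.sum_congr rfl fun p _ => by ring
    linarith
  have hhalf : ∀ (p : ι) (e : ℝ), e ^ 2 = 1 → ∀ᶠ j in atTop,
      ∫ ω in {ω | ρ ≤ e * (Y j ω p - x p)}, T j ω ∂P ≤ Real.exp (L j * (S - ρ ^ 2 / 2)) := by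
    intro p e he
    set θ : ι → ℝ := fun q => 2 * x q + if q = p then 2 * ρ * e else 0 with hθ
    have hθsum : ∑ q, θ q ^ 2 / 4 = S + 2 * ρ * e * x p + ρ ^ 2 := by
      have : ∀ q, θ q ^ 2 / 4 = x q ^ 2 + if q = p then 2 * ρ * e * x q + ρ ^ 2 else 0 := by
        intro q
        simp only [hθ]
        split_ifs
        · linear_combination ρ ^ 2 * he
        · ring
      rw [Finset.sum_congr rfl fun q _ => this q, Finset.sum_add_distrib, Finset.sum_ite_eq']
      simp [hS]
      ring
    filter_upwards [eventually_le_exp_of_tendsto_log (fun j => hpos j _) hL (hΛ θ)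
      (c' := S + 2 * ρ * e * x p + ρ ^ 2 + ρ ^ 2 / 2) (by rw [hθsum]; linarith [sq_pos_of_pos hρ0]),
      hL.eventually_ge_atTop 0] with j hj hLj
    have hle : ∫ ω in {ω | ρ ≤ e * (Y j ω p - x p)}, T j ω ∂P ≤
        ∫ ω, Real.exp (-(L j * (2 * ρ * (e * x p + ρ)))) *
          Real.exp (L j * ∑ q, θ q * Y j ω q) ∂P := by
      refine (setIntegral_mono_on (hint j _).integrableOn ((hint j θ).const_mul _).integrableOn
        ?_ ?_).trans (setIntegral_le_integral ((hint j θ).const_mul _)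
          (Eventually.of_forall fun ω => by positivity))
      · exact measurableSet_le measurable_const (((hY j p).sub_const _).const_mul _)
      · intro ω hω
        rw [← Real.exp_add]
        apply Real.exp_le_exp.2
        have : ∑ q, θ q * Y j ω q = ∑ q, 2 * x q * Y j ω q + 2 * ρ * e * Y j ω p := by
          have : ∀ q, θ q * Y j ω q = 2 * x q * Y j ω q + if q = p then 2 * ρ * e * Y j ω q else 0 := by
            intro q
            simp only [hθ]
            split_ifs <;> ring
          rw [Finset.sum_congr rfl fun q _ => this q, Finset.sum_add_distrib, Finset.sum_ite_eq']
          simp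
        rw [this]
        have hω' : ρ ≤ e * (Y j ω p - x p) := hω
        have : 0 ≤ L j * (2 * ρ * (e * (Y j ω p - x p) - ρ)) := by
          have : 0 ≤ e * (Y j ω p - x p) - ρ := by linarith
          positivity
        nlinarith
    refine hle.trans ?_
    rw [integral_const_mul]
    refine (mul_le_mul_of_nonneg_left hj (Real.exp_pos _).le).trans ?_
    rw [← Real.exp_add]
    apply Real.exp_le_exp.2
    apply le_of_eq
    ring
  have hlarge : ∀ᶠ j in atTop, 1 + 2 * (Fintype.card ι : ℝ) ≤ Real.exp (L j * η) :=
    (Real.tendsto_exp_atTop.comp (hL.atTop_mul_const hη0)).eventually_ge_atTop _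
  filter_upwards [hZ, eventually_all.2 fun p => hhalf p 1 (by norm_num),
    eventually_all.2 fun p => hhalf p (-1) (by norm_num), hlarge, hL.eventually_ge_atTop 0]
    with j hZ h1 h2 hlarge hLj
  set G : Set Ω := {ω | ∀ p, |Y j ω p - x p| < ρ} with hG
  have hGm : MeasurableSet G := by
    rw [hG, Set.ofPred_forall]
    refine MeasurableSet.iInter fun p => ?_
    exact measurableSet_lt ((hY j p).sub_const _).abs measurable_const
  have hTint : Integrable (T j) P := hint j _
  have hcompl : ∫ ω in Gᶜ, T j ω ∂P ≤ 2 * (Fintype.card ι : ℝ) * Real.exp (L j * (S - ρ ^ 2 / 2)) := by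
    have hTnn : ∀ ω, 0 ≤ T j ω := fun ω => (Real.exp_pos _).le
    have hms : ∀ (p : ι) (e : ℝ), MeasurableSet {ω | ρ ≤ e * (Y j ω p - x p)} := fun p e =>
      measurableSet_le measurable_const (((hY j p).sub_const _).const_mul _)
    have hpt : ∀ ω, Gᶜ.indicator (T j) ω ≤ ∑ p, (({ω | ρ ≤ 1 * (Y j ω p - x p)}.indicator (T j) ω) +
        {ω | ρ ≤ -1 * (Y j ω p - x p)}.indicator (T j) ω) := by
      intro ω
      have hnn : ∀ p, 0 ≤ ({ω | ρ ≤ 1 * (Y j ω p - x p)}.indicator (T j) ω) +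
          {ω | ρ ≤ -1 * (Y j ω p - x p)}.indicator (T j) ω := fun p =>
        add_nonneg (Set.indicator_nonneg (fun ω _ => hTnn ω) _)
          (Set.indicator_nonneg (fun ω _ => hTnn ω) _)
      by_cases hω : ω ∈ G
      · rw [Set.indicator_of_notMem (show ω ∉ Gᶜ from fun h => h hω)]
        exact Finset.sum_nonneg fun p _ => hnn p
      · rw [Set.indicator_of_mem (show ω ∈ Gᶜ from hω)]
        simp only [hG, Set.mem_ofPred_eq, not_forall, not_lt] at hω
        obtain ⟨p, hp⟩ := hω
        refine le_trans ?_ (Finset.single_le_sum (fun q _ => hnn q) (Finset.mem_univ p))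
        rcases le_abs'.1 hp with hp | hp
        · rw [Set.indicator_of_mem (s := {ω | ρ ≤ -1 * (Y j ω p - x p)}) (by
            simp only [Set.mem_ofPred_eq]; linarith)]
          exact le_add_of_nonneg_left (Set.indicator_nonneg (fun ω _ => hTnn ω) _)
        · rw [Set.indicator_of_mem (s := {ω | ρ ≤ 1 * (Y j ω p - x p)}) (by
            simp only [Set.mem_ofPred_eq]; linarith)]
          exact le_add_of_nonneg_right (Set.indicator_nonneg (fun ω _ => hTnn ω) _)
    have hI : ∀ (p : ι) (e : ℝ), Integrable ({ω | ρ ≤ e * (Y j ω p - x p)}.indicator (T j)) P :=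
      fun p e => hTint.indicator (hms p e)
    rw [← integral_indicator hGm.compl]
    refine (integral_mono (hTint.indicator hGm.compl)
      (integrable_finsetSum _ fun p _ => (hI p 1).add (hI p (-1))) hpt).trans ?_
    rw [integral_finsetSum _ fun p _ => (hI p 1).add (hI p (-1))]
    calc _ ≤ ∑ p : ι, 2 * Real.exp (L j * (S - ρ ^ 2 / 2)) := by
          refine Finset.sum_le_sum fun p _ => ?_
          refine (integral_add (hI p 1) (hI p (-1))).trans_le ?_
          rw [integral_indicator (hms p 1), integral_indicator (hms p (-1)), two_mul]
          exact add_le_add (h1 p) (h2 p)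
      _ = _ := by simp; ring
  have hGlow : Real.exp (L j * (S - 2 * η)) ≤ ∫ ω in G, T j ω ∂P := by
    have hsplit := integral_add_compl hGm hTint
    have e1 : Real.exp (L j * (S - η)) = Real.exp (L j * η) * Real.exp (L j * (S - 2 * η)) := by
      rw [← Real.exp_add]; ring_nf
    have e2 : Real.exp (L j * (S - ρ ^ 2 / 2)) ≤ Real.exp (L j * (S - 2 * η)) := by
      apply Real.exp_le_exp.2
      gcongr
      linarith
    have hpos := Real.exp_pos (L j * (S - 2 * η))
    have hc : (0 : ℝ) ≤ Fintype.card ι := Nat.cast_nonneg _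
    have e3 : 2 * (Fintype.card ι : ℝ) * Real.exp (L j * (S - ρ ^ 2 / 2)) ≤
        2 * (Fintype.card ι : ℝ) * Real.exp (L j * (S - 2 * η)) := by gcongr
    nlinarith
  have hGup : ∫ ω in G, T j ω ∂P ≤ Real.exp (L j * (2 * S + 2 * ρ * B)) * P.real G := by
    have : ∫ ω in G, T j ω ∂P ≤ ∫ ω in G, Real.exp (L j * (2 * S + 2 * ρ * B)) ∂P := by
      refine setIntegral_mono_on hTint.integrableOn (integrable_const _).integrableOn hGm ?_
      intro ω hω
      simp only [hT]
      apply Real.exp_le_exp.2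
      refine mul_le_mul_of_nonneg_left ?_ hLj
      rw [hS, hB, Finset.mul_sum, Finset.mul_sum, ← Finset.sum_add_distrib]
      refine Finset.sum_le_sum fun p _ => ?_
      have h3 : x p * (Y j ω p - x p) ≤ |x p| * ρ := by
        refine (le_abs_self _).trans ?_
        rw [abs_mul]
        exact mul_le_mul_of_nonneg_left (hω p).le (abs_nonneg _)
      nlinarith
    refine this.trans (le_of_eq ?_)
    rw [setIntegral_const, smul_eq_mul, mul_comm]
  have hPG : Real.exp (-L j) ≤ P.real G := by
    have h3 := hGlow.trans hGup
    have h4 : Real.exp (L j * (2 * S + 2 * ρ * B)) * Real.exp (-L j) ≤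
        Real.exp (L j * (S - 2 * η)) := by
      rw [← Real.exp_add]
      apply Real.exp_le_exp.2
      have : 2 * S + 2 * ρ * B - 1 ≤ S - 2 * η := by linarith
      nlinarith
    exact le_of_mul_le_mul_left (h4.trans h3) (Real.exp_pos _)
  exact hPG.trans (measureReal_mono fun ω hω p => (hω p).trans_le hρr)

/-! ### Asymptotic independence of the scales -/

/-- The asymptotic regime for sample sizes `N j`, bandwidths `H j l` and logarithmic factors `L j`:
the local sample sizes dominate `L`, and bandwidths with different indices are of different orders
of magnitude. -/
structure IsBandwidthArray {k : ℕ} (N : ℕ → ℕ) (H : ℕ → Fin k → ℝ) (L : ℕ → ℝ) : Prop where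
  pos : ∀ j l, 0 < H j l
  tendsto_log : Tendsto L atTop atTop
  tendsto_count : ∀ l, Tendsto (fun j => N j * H j l / L j) atTop atTop
  tendsto_zero : ∀ l, Tendsto (fun j => H j l) atTop (𝓝 0)
  tendsto_ratio : ∀ l l', l < l' → Tendsto (fun j => H j l / H j l') atTop (𝓝 0)

/-- The increments over the cells of the grid of mesh `1 / m` of the normalised processes at the
bandwidths `H l`, scaled so that the sum of squares is the discrete energy. -/
noncomputable def gridVector {k : ℕ} (t : ℝ) (N : ℕ) (H : Fin k → ℝ) (L : ℝ) (m : ℕ) (u : ℕ → ℝ)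
    (n : ℕ) (p : Fin k × Fin m) : ℝ :=
  √m / √(2 * N * H p.1 * L) *
    centeredCount u n (t + H p.1 * ((p.2 : ℝ) / m)) (t + H p.1 * ((p.2 + 1 : ℝ) / m))

/-- The contribution of a single point to `L ⟨θ, gridVector⟩`. -/
noncomputable def gridTilt {k : ℕ} (t : ℝ) (N : ℕ) (H : Fin k → ℝ) (L : ℝ) (m : ℕ)
    (θ : Fin k × Fin m → ℝ) (x : ℝ) : ℝ :=
  ∑ p, L * (θ p * (√m / √(2 * N * H p.1 * L))) *
    centeredIndicator (t + H p.1 * ((p.2 : ℝ) / m)) (t + H p.1 * ((p.2 + 1 : ℝ) / m)) x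

section

variable {k : ℕ} {t : ℝ} {m : ℕ}

theorem mul_sum_gridVector (N : ℕ) (H : Fin k → ℝ) (L : ℝ) (θ : Fin k × Fin m → ℝ) (u : ℕ → ℝ)
    (n : ℕ) : L * ∑ p, θ p * gridVector t N H L m u n p =
      ∑ i ∈ Finset.range n, gridTilt t N H L m θ (u i) := by
  unfold gridTilt gridVector centeredCount
  rw [Finset.sum_comm, Finset.mul_sum]
  refine Finset.sum_congr rfl fun p _ => ?_
  rw [← Finset.mul_sum]
  ring

theorem measurable_gridTilt (N : ℕ) (H : Fin k → ℝ) (L : ℝ) (θ : Fin k × Fin m → ℝ) :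
    Measurable (gridTilt t N H L m θ) :=
  Finset.measurable_fun_sum _ fun _ _ => (measurable_centeredIndicator _ _).const_mul _

theorem abs_centeredIndicator_le_one_add (a b x : ℝ) : |centeredIndicator a b x| ≤ 1 + |b - a| := by
  unfold centeredIndicator
  refine (abs_sub _ _).trans ?_
  gcongr
  by_cases hx : x ∈ Set.Ioc a b
  · rw [Set.indicator_of_mem hx]; simp
  · rw [Set.indicator_of_notMem hx]; simp

theorem exists_abs_gridTilt_le (N : ℕ) (H : Fin k → ℝ) (L : ℝ) (θ : Fin k × Fin m → ℝ) :
    ∃ M, ∀ x, |gridTilt t N H L m θ x| ≤ M := by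
  refine ⟨∑ p : Fin k × Fin m, |L * (θ p * (√m / √(2 * N * H p.1 * L)))| *
    (1 + |t + H p.1 * ((p.2 + 1 : ℝ) / m) - (t + H p.1 * ((p.2 : ℝ) / m))|),
    fun x => (Finset.abs_sum_le_sum_abs _ _).trans (Finset.sum_le_sum fun p _ => ?_)⟩
  rw [abs_mul]
  exact mul_le_mul_of_nonneg_left (abs_centeredIndicator_le_one_add _ _ _) (abs_nonneg _)

theorem cell_bounds (ht : 0 ≤ t) {H : ℝ} (hH : 0 < H) (htH : t + H ≤ 1) (c : Fin m) :
    0 ≤ t + H * ((c : ℝ) / m) ∧ t + H * ((c : ℝ) / m) ≤ t + H * ((c + 1 : ℝ) / m) ∧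
      t + H * ((c + 1 : ℝ) / m) ≤ 1 := by
  have hm : (0 : ℝ) < m := by exact_mod_cast c.pos
  have hc : (c : ℝ) + 1 ≤ m := by exact_mod_cast c.2
  have hc' : (c + 1 : ℝ) / m ≤ 1 := (div_le_one hm).2 hc
  exact ⟨by positivity, by gcongr; linarith, by nlinarith⟩

theorem abs_gridTilt_le (ht : 0 ≤ t) (N : ℕ) {H : Fin k → ℝ} (hH : ∀ l, 0 < H l)
    (htH : ∀ l, t + H l ≤ 1) (L : ℝ) (θ : Fin k × Fin m → ℝ) (x : ℝ) :
    |gridTilt t N H L m θ x| ≤ ∑ p, |L * (θ p * (√m / √(2 * N * H p.1 * L)))| := by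
  refine (Finset.abs_sum_le_sum_abs _ _).trans (Finset.sum_le_sum fun p _ => ?_)
  rw [abs_mul]
  obtain ⟨h1, h2, h3⟩ := cell_bounds ht (hH p.1) (htH p.1) p.2
  exact mul_le_of_le_one_right (abs_nonneg _) (abs_centeredIndicator_le h1 h2 h3 x)

theorem integral_gridTilt (ht : 0 ≤ t) (N : ℕ) {H : Fin k → ℝ} (hH : ∀ l, 0 < H l)
    (htH : ∀ l, t + H l ≤ 1) (L : ℝ) (θ : Fin k × Fin m → ℝ) :
    ∫ x in Set.Icc (0 : ℝ) 1, gridTilt t N H L m θ x = 0 := by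
  unfold gridTilt
  rw [integral_finsetSum]
  · refine Finset.sum_eq_zero fun p _ => ?_
    obtain ⟨h1, h2, h3⟩ := cell_bounds ht (hH p.1) (htH p.1) p.2
    rw [integral_const_mul, integral_centeredIndicator h1 h2 h3, mul_zero]
  · intro p _
    exact ((integrable_indicator_Ioc _ _).sub (integrable_const _)).const_mul _

variable {N : ℕ → ℕ} {H : ℕ → Fin k → ℝ} {L : ℕ → ℝ}

theorem IsBandwidthArray.eventually_le (hA : IsBandwidthArray N H L) (ht : t < 1) :
    ∀ᶠ j in atTop, ∀ l, t + H j l ≤ 1 := by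
  refine eventually_all.2 fun l => ?_
  filter_upwards [(hA.tendsto_zero l).eventually_lt_const (sub_pos.2 ht)] with j hj
  linarith

theorem div_sqrt_mul_sqrt {a b : ℝ} (ha : 0 < a) : a / (√a * √b) = √(a / b) := by
  rw [Real.sqrt_div ha.le, ← div_div, Real.div_sqrt]

/-- The normalised indicators of grid cells are asymptotically orthonormal: cells of one scale are
disjoint, and a cell of a smaller scale is negligible within a cell of a larger one. -/
theorem IsBandwidthArray.tendsto_covariance (hA : IsBandwidthArray N H L) (ht0 : 0 ≤ t)
    (ht1 : t < 1) (p p' : Fin k × Fin m) :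
    Tendsto (fun j => m / (√(H j p.1) * √(H j p'.1)) * ∫ x in Set.Icc (0 : ℝ) 1,
      centeredIndicator (t + H j p.1 * ((p.2 : ℝ) / m)) (t + H j p.1 * ((p.2 + 1 : ℝ) / m)) x *
      centeredIndicator (t + H j p'.1 * ((p'.2 : ℝ) / m)) (t + H j p'.1 * ((p'.2 + 1 : ℝ) / m)) x)
      atTop (𝓝 (if p = p' then 1 else 0)) := by
  obtain ⟨l, c⟩ := p
  obtain ⟨l', c'⟩ := p'
  have hm : (0 : ℝ) < m := by exact_mod_cast c.pos
  have hlen : ∀ (h : ℝ) (c : ℝ), t + h * ((c + 1) / m) - (t + h * (c / m)) = h / m := by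
    intro h c; ring
  have hform : ∀ᶠ j in atTop, ∫ x in Set.Icc (0 : ℝ) 1,
      centeredIndicator (t + H j l * ((c : ℝ) / m)) (t + H j l * ((c + 1 : ℝ) / m)) x *
      centeredIndicator (t + H j l' * ((c' : ℝ) / m)) (t + H j l' * ((c' + 1 : ℝ) / m)) x =
      max (min (t + H j l * ((c + 1 : ℝ) / m)) (t + H j l' * ((c' + 1 : ℝ) / m)) -
        max (t + H j l * ((c : ℝ) / m)) (t + H j l' * ((c' : ℝ) / m))) 0 -
        H j l / m * (H j l' / m) := by
    filter_upwards [hA.eventually_le ht1] with j hj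
    obtain ⟨h1, h2, h3⟩ := cell_bounds ht0 (hA.pos j l) (hj l) c
    obtain ⟨h1', h2', h3'⟩ := cell_bounds ht0 (hA.pos j l') (hj l') c'
    rw [integral_centeredIndicator_mul h1 h2 h3 h1' h2' h3', hlen, hlen]
  by_cases hl : l = l'
  · subst hl
    have hz : Tendsto (fun j => H j l / m) atTop (𝓝 0) := by
      simpa using (hA.tendsto_zero l).div_const (m : ℝ)
    have hss : ∀ j, √(H j l) * √(H j l) = H j l := fun j => Real.mul_self_sqrt (hA.pos j l).le
    by_cases hc : c = c'
    · subst hc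
      rw [if_pos rfl]
      have : Tendsto (fun j => 1 - H j l / m) atTop (𝓝 1) := by simpa using hz.const_sub 1
      refine this.congr' ?_
      filter_upwards [hform] with j hj
      have hH := hA.pos j l
      rw [hj, min_self, max_self, hlen, max_eq_left (by positivity), hss]
      field_simp
    · rw [if_neg (by simpa using hc)]
      have : Tendsto (fun j => -(H j l / m)) atTop (𝓝 0) := by simpa using hz.neg
      refine this.congr' ?_
      filter_upwards [hform] with j hj
      have hH := hA.pos j l
      have hdis : min (t + H j l * ((c + 1 : ℝ) / m)) (t + H j l * ((c' + 1 : ℝ) / m)) ≤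
          max (t + H j l * ((c : ℝ) / m)) (t + H j l * ((c' : ℝ) / m)) := by
        rcases lt_or_gt_of_ne hc with h | h
        · refine (min_le_left _ _).trans (le_trans ?_ (le_max_right _ _))
          have : (c : ℝ) + 1 ≤ c' := by exact_mod_cast h
          gcongr
        · refine (min_le_right _ _).trans (le_trans ?_ (le_max_left _ _))
          have : (c' : ℝ) + 1 ≤ c := by exact_mod_cast h
          gcongr
      rw [hj, max_eq_right (sub_nonpos.2 hdis), hss]
      field_simp
      ring
  · rw [if_neg fun h => hl (congrArg Prod.fst h)]
    -- both the overlap and the product of the lengths are at most the length of the smaller cell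
    have hbound : ∀ᶠ j in atTop, |m / (√(H j l) * √(H j l')) * ∫ x in Set.Icc (0 : ℝ) 1,
        centeredIndicator (t + H j l * ((c : ℝ) / m)) (t + H j l * ((c + 1 : ℝ) / m)) x *
        centeredIndicator (t + H j l' * ((c' : ℝ) / m)) (t + H j l' * ((c' + 1 : ℝ) / m)) x| ≤
        min (√(H j l / H j l')) (√(H j l' / H j l)) := by
      filter_upwards [hform, hA.eventually_le ht1] with j hj hle
      have hH := hA.pos j l
      have hH' := hA.pos j l'
      have hm1 : (1 : ℝ) ≤ m := by exact_mod_cast c.pos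
      have h1 : H j l / m ≤ 1 := by rw [div_le_one hm]; linarith [hle l]
      have h1' : H j l' / m ≤ 1 := by rw [div_le_one hm]; linarith [hle l']
      have hp1 : H j l / m * (H j l' / m) ≤ H j l / m := mul_le_of_le_one_right (by positivity) h1'
      have hp2 : H j l / m * (H j l' / m) ≤ H j l' / m := mul_le_of_le_one_left (by positivity) h1
      have hp0 : 0 ≤ H j l / m * (H j l' / m) := by positivity
      have ho1 : max (min (t + H j l * ((c + 1 : ℝ) / m)) (t + H j l' * ((c' + 1 : ℝ) / m)) -
          max (t + H j l * ((c : ℝ) / m)) (t + H j l' * ((c' : ℝ) / m))) 0 ≤ H j l / m := by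
        refine max_le ?_ (by positivity)
        rw [← hlen (H j l) c]
        exact sub_le_sub (min_le_left _ _) (le_max_left _ _)
      have ho2 : max (min (t + H j l * ((c + 1 : ℝ) / m)) (t + H j l' * ((c' + 1 : ℝ) / m)) -
          max (t + H j l * ((c : ℝ) / m)) (t + H j l' * ((c' : ℝ) / m))) 0 ≤ H j l' / m := by
        refine max_le ?_ (by positivity)
        rw [← hlen (H j l') c']
        exact sub_le_sub (min_le_right _ _) (le_max_right _ _)
      have ho0 : 0 ≤ max (min (t + H j l * ((c + 1 : ℝ) / m)) (t + H j l' * ((c' + 1 : ℝ) / m)) -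
          max (t + H j l * ((c : ℝ) / m)) (t + H j l' * ((c' : ℝ) / m))) 0 := le_max_right _ _
      rw [hj, abs_mul, abs_of_nonneg (show 0 ≤ m / (√(H j l) * √(H j l')) by positivity)]
      set o := max (min (t + H j l * ((c + 1 : ℝ) / m)) (t + H j l' * ((c' + 1 : ℝ) / m)) -
          max (t + H j l * ((c : ℝ) / m)) (t + H j l' * ((c' : ℝ) / m))) 0
      refine le_min ?_ ?_
      · rw [← div_sqrt_mul_sqrt hH]
        calc m / (√(H j l) * √(H j l')) * |o - H j l / m * (H j l' / m)|
            ≤ m / (√(H j l) * √(H j l')) * (H j l / m) := by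
              gcongr
              rw [abs_le]
              constructor <;> linarith
          _ = _ := by field_simp
      · rw [← div_sqrt_mul_sqrt hH', mul_comm (√(H j l'))]
        calc m / (√(H j l) * √(H j l')) * |o - H j l / m * (H j l' / m)|
            ≤ m / (√(H j l) * √(H j l')) * (H j l' / m) := by
              gcongr
              rw [abs_le]
              constructor <;> linarith
          _ = _ := by field_simp
    have hmin : Tendsto (fun j => min (√(H j l / H j l')) (√(H j l' / H j l))) atTop (𝓝 0) := by
      rcases lt_or_gt_of_ne hl with h | h
      · have h0 : Tendsto (fun j => √(H j l / H j l')) atTop (𝓝 0) := by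
          simpa using (hA.tendsto_ratio l l' h).sqrt
        exact squeeze_zero (fun _ => le_min (Real.sqrt_nonneg _) (Real.sqrt_nonneg _))
          (fun _ => min_le_left _ _) h0
      · have h0 : Tendsto (fun j => √(H j l' / H j l)) atTop (𝓝 0) := by
          simpa using (hA.tendsto_ratio l' l h).sqrt
        exact squeeze_zero (fun _ => le_min (Real.sqrt_nonneg _) (Real.sqrt_nonneg _))
          (fun _ => min_le_right _ _) h0
    exact squeeze_zero_norm' hbound hmin

theorem IsBandwidthArray.eventually_pos (hA : IsBandwidthArray N H L) (l : Fin k) :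
    ∀ᶠ j in atTop, 0 < L j ∧ (0 : ℝ) < N j := by
  filter_upwards [hA.tendsto_log.eventually_gt_atTop 0,
    (hA.tendsto_count l).eventually_gt_atTop 0] with j h1 h2
  refine ⟨h1, (Nat.cast_nonneg _).lt_of_ne fun h => ?_⟩
  rw [← h] at h2
  simp at h2

theorem IsBandwidthArray.tendsto_second_moment (hA : IsBandwidthArray N H L) (ht0 : 0 ≤ t)
    (ht1 : t < 1) (θ : Fin k × Fin m → ℝ) :
    Tendsto (fun j => N j / L j *
      ∫ x in Set.Icc (0 : ℝ) 1, gridTilt t (N j) (H j) (L j) m θ x ^ 2) atTop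
      (𝓝 (∑ p, θ p ^ 2 / 2)) := by
  have hlim : Tendsto (fun j => ∑ p : Fin k × Fin m, ∑ p' : Fin k × Fin m, θ p * θ p' / 2 *
      (m / (√(H j p.1) * √(H j p'.1)) * ∫ x in Set.Icc (0 : ℝ) 1,
      centeredIndicator (t + H j p.1 * ((p.2 : ℝ) / m)) (t + H j p.1 * ((p.2 + 1 : ℝ) / m)) x *
      centeredIndicator (t + H j p'.1 * ((p'.2 : ℝ) / m)) (t + H j p'.1 * ((p'.2 + 1 : ℝ) / m)) x))
      atTop (𝓝 (∑ p : Fin k × Fin m, ∑ p' : Fin k × Fin m,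
        θ p * θ p' / 2 * (if p = p' then 1 else 0))) :=
    tendsto_finsetSum _ fun p _ => tendsto_finsetSum _ fun p' _ =>
      (hA.tendsto_covariance ht0 ht1 p p').const_mul _
  have hval : ∑ p : Fin k × Fin m, ∑ p' : Fin k × Fin m,
      θ p * θ p' / 2 * (if p = p' then (1 : ℝ) else 0) = ∑ p, θ p ^ 2 / 2 := by
    refine Finset.sum_congr rfl fun p _ => ?_
    simp only [mul_ite, mul_one, mul_zero, Finset.sum_ite_eq, Finset.mem_univ, if_true]
    ring
  rw [hval] at hlim
  refine hlim.congr' ?_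
  have hpos : ∀ᶠ j in atTop, ∀ _ : Fin k, 0 < L j ∧ (0 : ℝ) < N j :=
    eventually_all.2 fun l => hA.eventually_pos l
  filter_upwards [hpos] with j hj
  have hint : ∀ p p' : Fin k × Fin m, Integrable (fun x =>
      centeredIndicator (t + H j p.1 * ((p.2 : ℝ) / m)) (t + H j p.1 * ((p.2 + 1 : ℝ) / m)) x *
      centeredIndicator (t + H j p'.1 * ((p'.2 : ℝ) / m)) (t + H j p'.1 * ((p'.2 + 1 : ℝ) / m)) x)
      (volume.restrict (Set.Icc (0 : ℝ) 1)) := by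
    intro p p'
    refine integrable_of_abs_le ((measurable_centeredIndicator _ _).mul
      (measurable_centeredIndicator _ _)) (C :=
        (1 + |t + H j p.1 * ((p.2 + 1 : ℝ) / m) - (t + H j p.1 * ((p.2 : ℝ) / m))|) *
        (1 + |t + H j p'.1 * ((p'.2 + 1 : ℝ) / m) - (t + H j p'.1 * ((p'.2 : ℝ) / m))|)) fun x => ?_
    rw [abs_mul]
    exact mul_le_mul (abs_centeredIndicator_le_one_add _ _ x)
      (abs_centeredIndicator_le_one_add _ _ x) (abs_nonneg _) (by positivity)
  have hsq : ∀ x, gridTilt t (N j) (H j) (L j) m θ x ^ 2 =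
      ∑ p : Fin k × Fin m, ∑ p' : Fin k × Fin m,
      (L j * (θ p * (√m / √(2 * N j * H j p.1 * L j)))) *
      (L j * (θ p' * (√m / √(2 * N j * H j p'.1 * L j)))) *
      (centeredIndicator (t + H j p.1 * ((p.2 : ℝ) / m)) (t + H j p.1 * ((p.2 + 1 : ℝ) / m)) x *
      centeredIndicator (t + H j p'.1 * ((p'.2 : ℝ) / m)) (t + H j p'.1 * ((p'.2 + 1 : ℝ) / m)) x) := by
    intro x
    unfold gridTilt
    rw [sq, Finset.sum_mul_sum]
    exact Finset.sum_congr rfl fun p _ => Finset.sum_congr rfl fun p' _ => by ring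
  simp_rw [hsq]
  rw [integral_finsetSum _ fun p _ => integrable_finsetSum _ fun p' _ => (hint p p').const_mul _,
    Finset.mul_sum]
  refine Finset.sum_congr rfl fun p _ => ?_
  rw [integral_finsetSum _ fun p' _ => (hint p p').const_mul _, Finset.mul_sum]
  refine Finset.sum_congr rfl fun p' _ => ?_
  obtain ⟨hL, hN⟩ := hj p.1
  rw [integral_const_mul, ← mul_assoc, ← mul_assoc]
  congr 1
  have hs : ∀ l, √(2 * N j * H j l * L j) = √(2 * N j * L j) * √(H j l) := by
    intro l
    rw [← Real.sqrt_mul (by positivity)]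
    congr 1
    ring
  rw [hs, hs]
  have h1 : √(2 * N j * L j) * √(2 * N j * L j) = 2 * N j * L j := Real.mul_self_sqrt (by positivity)
  have h2 : √(m : ℝ) * √(m : ℝ) = m := Real.mul_self_sqrt (Nat.cast_nonneg _)
  have h3 := Real.sqrt_pos.2 (hA.pos j p.1)
  have h4 := Real.sqrt_pos.2 (hA.pos j p'.1)
  have h5 : 0 < √(2 * N j * L j) := Real.sqrt_pos.2 (by positivity)
  calc θ p * θ p' / 2 * (m / (√(H j p.1) * √(H j p'.1)))
      = N j / L j * L j ^ 2 * (θ p * θ p') * m / (2 * N j * L j) / (√(H j p.1) * √(H j p'.1)) := by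
        field_simp
    _ = _ := by
        have e : ∀ a D h h' : ℝ, L j * (θ p * (a / (D * h))) * (L j * (θ p' * (a / (D * h')))) =
            L j ^ 2 * (θ p * θ p') * (a * a) / (D * D) / (h * h') := fun a D h h' => by
          simp only [div_eq_mul_inv, mul_inv]; ring
        rw [mul_assoc (N j / L j), e, h1, h2]
        ring

/-- The contribution of a single point tends to zero uniformly, so that the exponentials in the moment
generating function may be expanded to second order. -/
theorem IsBandwidthArray.tendsto_sum_abs_coeff (hA : IsBandwidthArray N H L)
    (θ : Fin k × Fin m → ℝ) :
    Tendsto (fun j => ∑ p, |L j * (θ p * (√m / √(2 * N j * H j p.1 * L j)))|) atTop (𝓝 0) := by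
  have h : ∀ p : Fin k × Fin m, Tendsto
      (fun j => |L j * (θ p * (√m / √(2 * N j * H j p.1 * L j)))|) atTop (𝓝 0) := by
    intro p
    have h1 : Tendsto (fun j => (√(2 * (N j * H j p.1 / L j)))⁻¹) atTop (𝓝 0) :=
      tendsto_inv_atTop_zero.comp (Real.tendsto_sqrt_atTop.comp
        ((hA.tendsto_count p.1).const_mul_atTop two_pos))
    have h2 := (h1.const_mul (θ p * √m)).abs
    rw [mul_zero, abs_zero] at h2
    refine h2.congr' ?_
    filter_upwards [hA.eventually_pos p.1] with j hj
    congr 1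
    have e : √(2 * N j * H j p.1 * L j) = L j * √(2 * (N j * H j p.1 / L j)) := by
      rw [← Real.sqrt_sq hj.1.le, ← Real.sqrt_mul (sq_nonneg _), Real.sqrt_sq hj.1.le]
      congr 1
      have := hj.1.ne'
      field_simp
    rw [e]
    have := hj.1.ne'
    field_simp
  simpa using tendsto_finsetSum Finset.univ fun p _ => h p

/-- The logarithmic moment generating function of the grid vector is asymptotically that of a
Gaussian vector with covariance matrix `1 / (2 L)`. -/
theorem IsBandwidthArray.tendsto_log_mgf (hA : IsBandwidthArray N H L) (ht0 : 0 ≤ t)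
    (ht1 : t < 1) (θ : Fin k × Fin m → ℝ) :
    Tendsto (fun j => Real.log ((∫ x in Set.Icc (0 : ℝ) 1,
      Real.exp (gridTilt t (N j) (H j) (L j) m θ x)) ^ N j) / L j) atTop
      (𝓝 (∑ p, θ p ^ 2 / 4)) := by
  set q : ℕ → ℝ := fun j => ∫ x in Set.Icc (0 : ℝ) 1, gridTilt t (N j) (H j) (L j) m θ x ^ 2 with hq
  set M : ℕ → ℝ := fun j => ∑ p, |L j * (θ p * (√m / √(2 * N j * H j p.1 * L j)))| with hM
  set E : ℕ → ℝ := fun j => ∫ x in Set.Icc (0 : ℝ) 1,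
    Real.exp (gridTilt t (N j) (H j) (L j) m θ x) with hE
  have hM0 : Tendsto M atTop (𝓝 0) := hA.tendsto_sum_abs_coeff θ
  have hq2 : Tendsto (fun j => N j / L j * q j) atTop (𝓝 (∑ p, θ p ^ 2 / 2)) :=
    hA.tendsto_second_moment ht0 ht1 θ
  have hEbd : ∀ᶠ j in atTop, |E j - 1 - q j / 2| ≤ M j * q j ∧ 1 ≤ E j ∧ q j ≤ M j ^ 2 ∧ 0 ≤ q j := by
    filter_upwards [hM0.eventually_le_const one_pos, hA.eventually_le ht1] with j hM1 hle
    have hφ : Measurable (gridTilt t (N j) (H j) (L j) m θ) := measurable_gridTilt _ _ _ _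
    have hb : ∀ x, |gridTilt t (N j) (H j) (L j) m θ x| ≤ M j :=
      abs_gridTilt_le ht0 (N j) (hA.pos j) hle (L j) θ
    have h0 := integral_gridTilt ht0 (N j) (hA.pos j) hle (L j) θ
    have i1 : Integrable (gridTilt t (N j) (H j) (L j) m θ) (volume.restrict (Set.Icc (0 : ℝ) 1)) :=
      integrable_of_abs_le hφ hb
    have i2 : Integrable (fun x => gridTilt t (N j) (H j) (L j) m θ x ^ 2)
        (volume.restrict (Set.Icc (0 : ℝ) 1)) :=
      integrable_of_abs_le (hφ.pow_const 2) (C := M j ^ 2) fun x => by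
        rw [abs_pow]; exact pow_le_pow_left₀ (abs_nonneg _) (hb x) 2
    have i3 : Integrable (fun x => Real.exp (gridTilt t (N j) (H j) (L j) m θ x))
        (volume.restrict (Set.Icc (0 : ℝ) 1)) :=
      integrable_of_abs_le hφ.exp (C := Real.exp (M j)) fun x => by
        rw [Real.abs_exp]; exact Real.exp_le_exp.2 ((le_abs_self _).trans (hb x))
    have i4 : Integrable (fun _ : ℝ => (1 : ℝ)) (volume.restrict (Set.Icc (0 : ℝ) 1)) :=
      integrable_const _
    refine ⟨?_, one_le_integral_exp hφ hb h0, ?_, integral_nonneg fun x => sq_nonneg _⟩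
    · have e : E j - 1 - q j / 2 = ∫ x in Set.Icc (0 : ℝ) 1,
          (Real.exp (gridTilt t (N j) (H j) (L j) m θ x) - 1 - gridTilt t (N j) (H j) (L j) m θ x -
            gridTilt t (N j) (H j) (L j) m θ x ^ 2 / 2) := by
        have j1 : Integrable (fun x => Real.exp (gridTilt t (N j) (H j) (L j) m θ x) - 1)
          (volume.restrict (Set.Icc (0 : ℝ) 1)) := i3.sub i4
        have j2 : Integrable (fun x => Real.exp (gridTilt t (N j) (H j) (L j) m θ x) - 1 -
          gridTilt t (N j) (H j) (L j) m θ x) (volume.restrict (Set.Icc (0 : ℝ) 1)) := j1.sub i1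
        rw [integral_sub j2 (i2.div_const 2), integral_sub j1 i1, integral_sub i3 i4, h0,
          integral_div]
        simp [hE, hq]
      rw [e, ← integral_const_mul, ← Real.norm_eq_abs]
      refine norm_integral_le_of_norm_le (i2.const_mul _) (Eventually.of_forall fun x => ?_)
      have h1 : |gridTilt t (N j) (H j) (L j) m θ x| ≤ 1 := (hb x).trans hM1
      have h2 := Real.exp_bound h1 (n := 3) (by norm_num)
      simp only [Finset.sum_range_succ, Finset.sum_range_zero, Nat.factorial] at h2
      rw [Real.norm_eq_abs]
      have e2 : Real.exp (gridTilt t (N j) (H j) (L j) m θ x) - 1 -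
          gridTilt t (N j) (H j) (L j) m θ x - gridTilt t (N j) (H j) (L j) m θ x ^ 2 / 2 =
          Real.exp (gridTilt t (N j) (H j) (L j) m θ x) - (0 +
            gridTilt t (N j) (H j) (L j) m θ x ^ 0 / ((1 : ℕ) : ℝ) +
            gridTilt t (N j) (H j) (L j) m θ x ^ 1 / (((0 + 1) * 1 : ℕ) : ℝ) +
            gridTilt t (N j) (H j) (L j) m θ x ^ 2 / (((1 + 1) * ((0 + 1) * 1) : ℕ) : ℝ)) := by
        push_cast
        ring
      rw [e2]
      refine h2.trans ?_
      have h3 : |gridTilt t (N j) (H j) (L j) m θ x| ^ 3 ≤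
          M j * gridTilt t (N j) (H j) (L j) m θ x ^ 2 := by
        rw [pow_succ', sq_abs]
        exact mul_le_mul_of_nonneg_right (hb x) (sq_nonneg _)
      refine (mul_le_of_le_one_right (by positivity) ?_).trans h3
      norm_num
    · have : q j ≤ ∫ x in Set.Icc (0 : ℝ) 1, M j ^ 2 :=
        integral_mono i2 (integrable_const _) fun x => by
          dsimp only
          rw [← sq_abs]
          exact pow_le_pow_left₀ (abs_nonneg _) (hb x) 2
      simpa using this
  have hE1 : Tendsto (fun j => E j) atTop (𝓝 1) := by
    have hsq : Tendsto (fun j => M j ^ 2 / 2 + M j * M j ^ 2) atTop (𝓝 0) := by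
      simpa using ((hM0.pow 2).div_const 2).add (hM0.mul (hM0.pow 2))
    rw [tendsto_iff_dist_tendsto_zero]
    refine squeeze_zero' (Eventually.of_forall fun _ => dist_nonneg) ?_ hsq
    filter_upwards [hEbd] with j ⟨h1, h2, h3, h4⟩
    have hMj : 0 ≤ M j := Finset.sum_nonneg fun p _ => abs_nonneg _
    rw [Real.dist_eq, abs_of_nonneg (by linarith)]
    have := (abs_le.1 h1).2
    nlinarith
  have hy : Tendsto (fun j => N j / L j * (E j - 1)) atTop (𝓝 (∑ p, θ p ^ 2 / 4)) := by
    have h1 : Tendsto (fun j => N j / L j * q j / 2) atTop (𝓝 (∑ p, θ p ^ 2 / 4)) := by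
      have : ∑ p, θ p ^ 2 / 4 = (∑ p, θ p ^ 2 / 2) / 2 := by
        rw [Finset.sum_div]; exact Finset.sum_congr rfl fun p _ => by ring
      rw [this]
      exact hq2.div_const 2
    have h2 : Tendsto (fun j => M j * (N j / L j * q j)) atTop (𝓝 0) := by
      simpa using hM0.mul hq2
    have h3 : Tendsto (fun j => N j / L j * (E j - 1) - N j / L j * q j / 2) atTop (𝓝 0) := by
      refine squeeze_zero_norm' ?_ h2
      filter_upwards [hEbd, hA.tendsto_log.eventually_gt_atTop 0] with j ⟨hb, _⟩ hL
      have e : N j / L j * (E j - 1) - N j / L j * q j / 2 = N j / L j * (E j - 1 - q j / 2) := by ring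
      rw [e, Real.norm_eq_abs, abs_mul, abs_of_nonneg (show (0 : ℝ) ≤ N j / L j by positivity)]
      calc N j / L j * |E j - 1 - q j / 2| ≤ N j / L j * (M j * q j) := by gcongr
        _ = _ := by ring
    simpa using h3.add h1
  have hlow : Tendsto (fun j => N j / L j * (E j - 1) / E j) atTop (𝓝 (∑ p, θ p ^ 2 / 4)) := by
    have := hy.div hE1 one_ne_zero
    rw [div_one] at this
    exact this
  refine tendsto_of_tendsto_of_tendsto_of_le_of_le' hlow hy ?_ ?_
  · filter_upwards [hEbd, hA.tendsto_log.eventually_gt_atTop 0] with j ⟨_, h1, _⟩ hL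
    have hE0 : 0 < E j := by linarith
    calc N j / L j * (E j - 1) / E j = N j / L j * (1 - (E j)⁻¹) := by field_simp
      _ ≤ N j / L j * Real.log (E j) := by
          gcongr
          exact Real.one_sub_inv_le_log_of_pos hE0
      _ = _ := by rw [Real.log_pow]; ring
  · filter_upwards [hEbd, hA.tendsto_log.eventually_gt_atTop 0] with j ⟨_, h1, _⟩ hL
    calc Real.log (E j ^ N j) / L j = N j / L j * Real.log (E j) := by rw [Real.log_pow]; ring
      _ ≤ N j / L j * (E j - 1) := by
          gcongr
          exact Real.log_le_sub_one_of_pos (by linarith)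

end

/-! ### Almost sure behaviour along a bandwidth array -/

section

variable {Ω : Type*} [MeasurableSpace Ω] {P : Measure Ω}

theorem ae_eventually_notMem_of_eventually_le {E : ℕ → Set Ω} {a : ℕ → ℝ} (ha : Summable a)
    (h : ∀ᶠ j in atTop, P (E j) ≤ ENNReal.ofReal (a j)) : ∀ᵐ ω ∂P, ∀ᶠ j in atTop, ω ∉ E j := by
  obtain ⟨j₀, hj₀⟩ := eventually_atTop.1 h
  have hsum : ∑' j, P (E (j + j₀)) ≠ ∞ :=
    ne_top_of_le_ne_top ((summable_nat_add_iff j₀).2 ha).tsum_ofReal_ne_top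
      (ENNReal.tsum_le_tsum fun j => hj₀ (j + j₀) (Nat.le_add_left _ _))
  filter_upwards [ae_eventually_notMem hsum] with ω hω
  obtain ⟨j₁, hj₁⟩ := eventually_atTop.1 hω
  refine eventually_atTop.2 ⟨j₁ + j₀, fun j hj => ?_⟩
  have := hj₁ (j - j₀) (by omega)
  rwa [Nat.sub_add_cancel (by omega)] at this

/-- Events which depend on disjoint blocks of an independent sequence are independent. -/
theorem iIndepSet_of_blocks {U : ℕ → Ω → ℝ} (hUm : ∀ i, Measurable (U i)) (hU : iIndepFun U P)
    {c : ℕ → ℕ} (hc : Monotone c) {G : ℕ → Set Ω}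
    (hG : ∀ j, MeasurableSet[⨆ i ∈ Set.Ico (c j) (c (j + 1)),
      MeasurableSpace.comap (U i) inferInstance] (G j)) : iIndepSet G P := by
  have hle : ∀ i, MeasurableSpace.comap (U i) inferInstance ≤ ‹MeasurableSpace Ω› :=
    fun i => (hUm i).comap_le
  have := hU.isProbabilityMeasure
  rw [iIndepSet_iff_meas_biInter fun j => (iSup₂_le fun i _ => hle i) _ (hG j)]
  intro s
  induction s using Finset.induction_on_max with
  | empty => simp
  | insert a s has ih =>
    have ha : a ∉ s := fun h => lt_irrefl _ (has a h)
    rw [Finset.set_biInter_insert, Finset.prod_insert ha, ← ih]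
    have hind := indep_iSup_of_disjoint hle hU.iIndep
      (S := Set.Ici (c a)) (T := Set.Iio (c a)) (Set.disjoint_left.2 fun i h1 h2 =>
        absurd (show i < c a from h2) (not_lt.2 h1))
    have hmono : ∀ {S T : Set ℕ}, S ⊆ T →
        (⨆ i ∈ S, MeasurableSpace.comap (U i) (inferInstance : MeasurableSpace ℝ)) ≤
          ⨆ i ∈ T, MeasurableSpace.comap (U i) inferInstance :=
      fun hST => biSup_mono fun i hi => hST hi
    refine (Indep_iff _ _ _).1 hind _ _ (hmono (fun i hi => hi.1) _ (hG a)) ?_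
    refine Finset.measurableSet_biInter s fun j hj => ?_
    exact hmono (fun i hi => hi.2.trans_le (hc (has j hj))) _ (hG j)

theorem centeredCount_grid_sum (u : ℕ → ℝ) (n : ℕ) (t : ℝ) {H : ℝ} (hH : 0 < H) (m i : ℕ) :
    centeredCount u n t (t + H * ((i : ℝ) / m)) = ∑ c ∈ Finset.range i,
      centeredCount u n (t + H * ((c : ℝ) / m)) (t + H * ((c + 1 : ℝ) / m)) := by
  induction i with
  | zero => simp [centeredCount_self]
  | succ i ih =>
    rw [Finset.sum_range_succ, ← ih, centeredCount_add]
    · push_cast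
      rfl
    · have : 0 ≤ H * ((i : ℝ) / m) := by positivity
      linarith
    · gcongr
      linarith

/-- The fineness `r₀` of the grid depends only on `ε`, so that the grid can be fixed before the
array. -/
theorem exists_ae_eventually_oscillation_le [IsProbabilityMeasure P] {k : ℕ} {t : ℝ} (ht0 : 0 ≤ t)
    (ht1 : t < 1) {ε : ℝ} (hε : 0 < ε) :
    ∃ r₀ : ℕ, ∀ r ≥ r₀, ∀ {N : ℕ → ℕ} {H : ℕ → Fin k → ℝ} {L : ℕ → ℝ}, IsBandwidthArray N H L →
      Summable (fun j => Real.exp (-(2 * L j))) →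
      ∀ V : ℕ → ℕ → Ω → ℝ, (∀ j, IsIIDUniform (V j) P) →
      ∀ᵐ ω ∂P, ∀ᶠ j in atTop, ∀ l, ∀ n ≤ N j, ∀ s ∈ Set.Icc (0 : ℝ) 1,
        |centeredCount (fun i => V j i ω) n (t + H j l * ((⌊2 ^ r * s⌋₊ : ℝ) / 2 ^ r))
          (t + H j l * s)| ≤ ε * √(N j * H j l * L j) := by
  obtain ⟨r₀, hr₀⟩ := exists_measure_oscillation_le P hε
  refine ⟨r₀, fun r hr N H L hA hsum V hV => ?_⟩
  obtain ⟨C, hC⟩ := hr₀ r hr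
  have h : ∀ l, ∀ᵐ ω ∂P, ∀ᶠ j in atTop, ω ∉ {ω | ∃ n ≤ N j, ∃ s ∈ Set.Icc (0 : ℝ) 1,
      ε * √(N j * H j l * L j) < |centeredCount (fun i => V j i ω) n
        (t + H j l * ((⌊2 ^ r * s⌋₊ : ℝ) / 2 ^ r)) (t + H j l * s)|} := by
    intro l
    refine ae_eventually_notMem_of_eventually_le hsum ?_
    filter_upwards [hA.eventually_le ht1, hA.tendsto_log.eventually_ge_atTop 1,
      (hA.tendsto_count l).eventually_ge_atTop C] with j h1 h2 h3
    refine hC (V j) (hV j) (N j) t (H j l) (L j) ht0 (hA.pos j l) (h1 l) h2 ?_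
    rwa [le_div_iff₀ (by linarith)] at h3
  filter_upwards [ae_all_iff.2 h] with ω hω
  filter_upwards [eventually_all.2 hω] with j hj l n hn s hs
  by_contra hcon
  exact hj l ⟨n, hn, s, hs, not_le.1 hcon⟩

variable {k : ℕ} {t : ℝ} {N : ℕ → ℕ} {H : ℕ → Fin k → ℝ} {L : ℕ → ℝ}

theorem gridVector_sq_sum (t : ℝ) (N : ℕ) (H : Fin k → ℝ) (L : ℝ) (m : ℕ) (u : ℕ → ℝ) (n : ℕ) :
    ∑ p, gridVector t N H L m u n p ^ 2 = ∑ l, m * ∑ c ∈ Finset.range m,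
      ((√(2 * N * H l * L))⁻¹ *
        centeredCount u n (t + H l * ((c : ℝ) / m)) (t + H l * ((c + 1 : ℝ) / m))) ^ 2 := by
  rw [Fintype.sum_prod_type]
  refine Finset.sum_congr rfl fun l _ => ?_
  rw [Finset.sum_range, Finset.mul_sum]
  refine Finset.sum_congr rfl fun c _ => ?_
  have h2 : √(m : ℝ) ^ 2 = m := Real.sq_sqrt (Nat.cast_nonneg _)
  unfold gridVector
  rw [div_eq_mul_inv, mul_assoc, mul_pow, h2]

/-- The upper half of the law of the iterated logarithm for the discrete energies. -/
theorem IsBandwidthArray.ae_eventually_energy_le [IsProbabilityMeasure P]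
    (hA : IsBandwidthArray N H L) (ht0 : 0 ≤ t) (ht1 : t < 1)
    (hsum : ∀ δ > 0, Summable fun j => Real.exp (-((1 + δ) * L j)))
    {V : ℕ → Ω → ℝ} (hV : IsIIDUniform V P) (m : ℕ) {ε : ℝ} (hε : 0 < ε) :
    ∀ᵐ ω ∂P, ∀ᶠ j in atTop, ∀ n ≤ N j,
      ∑ p, gridVector t (N j) (H j) (L j) m (fun i => V i ω) n p ^ 2 ≤ (1 + ε) ^ 2 := by
  obtain ⟨Θ, hΘ1, hΘ⟩ := exists_finite_halfspaces (ι := Fin k × Fin m) hε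
  have h : ∀ θ ∈ Θ, ∀ᵐ ω ∂P, ∀ᶠ j in atTop, ω ∉ {ω | ∃ n ≤ N j, 2 * L j * (1 + ε / 2) ≤
      ∑ i ∈ Finset.range n, gridTilt t (N j) (H j) (L j) m (fun p => 2 * θ p) (V i ω)} := by
    intro θ hθ
    refine ae_eventually_notMem_of_eventually_le (hsum (ε / 2) (by positivity)) ?_
    have hpos : ∀ j, 0 < (∫ x in Set.Icc (0 : ℝ) 1,
        Real.exp (gridTilt t (N j) (H j) (L j) m (fun p => 2 * θ p) x)) ^ N j := by
      intro j
      obtain ⟨M, hM⟩ := exists_abs_gridTilt_le (t := t) (N j) (H j) (L j) (fun p => 2 * θ p)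
      have : NeZero (volume.restrict (Set.Icc (0 : ℝ) 1)) := ⟨by simp [Measure.restrict_eq_zero]⟩
      refine pow_pos (integral_exp_pos ?_) _
      exact integrable_of_abs_le (measurable_gridTilt _ _ _ _).exp (C := Real.exp M) fun x => by
        rw [Real.abs_exp]; exact Real.exp_le_exp.2 ((le_abs_self _).trans (hM x))
    have hone : ∑ p, (2 * θ p) ^ 2 / 4 = 1 := by
      rw [← hΘ1 θ hθ]; exact Finset.sum_congr rfl fun p _ => by ring
    filter_upwards [hA.eventually_le ht1, eventually_le_exp_of_tendsto_log hpos hA.tendsto_log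
      (hA.tendsto_log_mgf ht0 ht1 fun p => 2 * θ p) (c' := 1 + ε / 2) (by rw [hone]; linarith)]
      with j hle hj
    refine (hV.measure_exists_le_sum_le (measurable_gridTilt _ _ _ _)
      (abs_gridTilt_le ht0 (N j) (hA.pos j) hle (L j) _)
      (integral_gridTilt ht0 (N j) (hA.pos j) hle (L j) _) (N j) _).trans
      (ENNReal.ofReal_le_ofReal ?_)
    refine (mul_le_mul_of_nonneg_left hj (Real.exp_pos _).le).trans (le_of_eq ?_)
    rw [← Real.exp_add]
    congr 1
    ring
  have h' : ∀ᵐ ω ∂P, ∀ θ ∈ Θ, ∀ᶠ j in atTop, ω ∉ {ω | ∃ n ≤ N j, 2 * L j * (1 + ε / 2) ≤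
      ∑ i ∈ Finset.range n, gridTilt t (N j) (H j) (L j) m (fun p => 2 * θ p) (V i ω)} :=
    (ae_ball_iff Θ.countable_toSet).2 h
  filter_upwards [h'] with ω hω
  filter_upwards [(eventually_all_finset Θ).2 hω, hA.tendsto_log.eventually_ge_atTop 0]
    with j hj hL n hn
  by_contra hcon
  obtain ⟨θ, hθ, hle⟩ := hΘ _ (not_le.1 hcon)
  refine hj θ hθ ⟨n, hn, ?_⟩
  rw [← mul_sum_gridVector]
  have : ∑ p, 2 * θ p * gridVector t (N j) (H j) (L j) m (fun i => V i ω) n p =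
      2 * ∑ p, θ p * gridVector t (N j) (H j) (L j) m (fun i => V i ω) n p := by
    rw [Finset.mul_sum]; exact Finset.sum_congr rfl fun p _ => by ring
  rw [this]
  nlinarith

theorem floor_grid_le {r : ℕ} {s : ℝ} (hs : s ∈ Set.Icc (0 : ℝ) 1) :
    ⌊2 ^ r * s⌋₊ ≤ 2 ^ r ∧ (⌊2 ^ r * s⌋₊ : ℝ) / 2 ^ r ≤ s ∧
      s - (⌊2 ^ r * s⌋₊ : ℝ) / 2 ^ r ≤ 1 / 2 ^ r := by
  have hpos : (0 : ℝ) < 2 ^ r := by positivity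
  refine ⟨?_, ?_, ?_⟩
  · refine Nat.floor_le_of_le ?_
    push_cast
    exact mul_le_of_le_one_right hpos.le hs.2
  · rw [div_le_iff₀ hpos, mul_comm s]
    exact Nat.floor_le (mul_nonneg hpos.le hs.1)
  · rw [sub_le_iff_le_add, ← add_div, le_div_iff₀ hpos, mul_comm s, add_comm]
    exact (Nat.lt_floor_add_one _).le

theorem exists_sqrt_mesh_le {ε : ℝ} (hε : 0 < ε) : ∃ r₁ : ℕ, ∀ r ≥ r₁, √(1 / 2 ^ r : ℝ) ≤ ε := by
  have h1 : Tendsto (fun r : ℕ => √((1 / 2 : ℝ) ^ r)) atTop (𝓝 0) := by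
    simpa using (tendsto_pow_atTop_nhds_zero_of_lt_one (r := (1 / 2 : ℝ)) (by norm_num)
      (by norm_num)).sqrt
  obtain ⟨r₁, hr₁⟩ := eventually_atTop.1 (h1.eventually_le_const hε)
  exact ⟨r₁, fun r hr => by simpa using hr₁ r hr⟩

/-- Along a bandwidth array, the normalised processes are eventually close to the Strassen ball. -/
theorem IsBandwidthArray.ae_eventually_near_strassenBall [IsProbabilityMeasure P]
    (hA : IsBandwidthArray N H L) (ht0 : 0 ≤ t) (ht1 : t < 1)
    (hsum : ∀ δ > 0, Summable fun j => Real.exp (-((1 + δ) * L j)))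
    {V : ℕ → Ω → ℝ} (hV : IsIIDUniform V P) {ε : ℝ} (hε : 0 < ε) :
    ∀ᵐ ω ∂P, ∀ᶠ j in atTop, ∀ n ≤ N j, ∃ g ∈ strassenBall k, ∀ l (s : unitInterval),
      |(√(2 * N j * H j l * L j))⁻¹ *
        centeredCount (fun i => V i ω) n t (t + H j l * s) - (g l).1 s| ≤ ε := by
  obtain ⟨r₀, hr₀⟩ := exists_ae_eventually_oscillation_le (P := P) (k := k) ht0 ht1
    (show 0 < ε / 3 by positivity)
  obtain ⟨r₁, hr₁⟩ := exists_sqrt_mesh_le (show 0 < ε / 3 by positivity)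
  set r := max r₀ r₁ with hr
  have hm : 0 < 2 ^ r := by positivity
  have hs2 : Summable fun j => Real.exp (-(2 * L j)) := by
    have := hsum 1 one_pos
    norm_num at this
    exact this
  filter_upwards [hr₀ r (le_max_left _ _) hA hs2 (fun _ => V) (fun _ => hV),
    hA.ae_eventually_energy_le ht0 ht1 hsum hV (2 ^ r) (show 0 < ε / 3 by positivity)]
    with ω hosc henergy
  filter_upwards [hosc, henergy, hA.tendsto_log.eventually_gt_atTop 0,
    eventually_all.2 fun l => hA.eventually_pos l] with j hosc henergy hL hpos n hn
  set Z : Fin k → ℝ → ℝ → ℝ := fun l a b => (√(2 * N j * H j l * L j))⁻¹ *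
    centeredCount (fun i => V i ω) n (t + H j l * a) (t + H j l * b) with hZ
  -- shrink the grid increments by the factor `1 + ε / 3` to get into the ball
  obtain ⟨g, hg, hgrid⟩ := exists_mem_strassenBall_of_grid (k := k) hm
    (fun l c => (1 + ε / 3)⁻¹ * Z l ((c : ℝ) / 2 ^ r) ((c + 1 : ℝ) / 2 ^ r)) (by
      have h1 := henergy n hn
      rw [gridVector_sq_sum] at h1
      have h2 : ∑ l, ((2 ^ r : ℕ) : ℝ) * ∑ i ∈ Finset.range (2 ^ r),
          ((1 + ε / 3)⁻¹ * Z l ((i : ℝ) / 2 ^ r) ((i + 1 : ℝ) / 2 ^ r)) ^ 2 =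
          ((1 + ε / 3) ^ 2)⁻¹ * ∑ l, ((2 ^ r : ℕ) : ℝ) * ∑ i ∈ Finset.range (2 ^ r),
          (Z l ((i : ℝ) / 2 ^ r) ((i + 1 : ℝ) / 2 ^ r)) ^ 2 := by
        rw [Finset.mul_sum]
        refine Finset.sum_congr rfl fun l _ => ?_
        rw [mul_left_comm]
        congr 1
        rw [Finset.mul_sum]
        refine Finset.sum_congr rfl fun i _ => ?_
        rw [mul_pow, inv_pow]
      rw [h2]
      push_cast at h1 ⊢
      rw [inv_mul_le_iff₀ (by positivity), mul_one]
      exact h1)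
  refine ⟨g, hg, fun l s => ?_⟩
  have hH := hA.pos j l
  have hN := (hpos l).2
  obtain ⟨hf1, hf2, hf3⟩ := floor_grid_le (r := r) s.2
  set v : ℝ := (⌊(2 : ℝ) ^ r * s⌋₊ : ℝ) / 2 ^ r with hv
  have hv0 : 0 ≤ v := by positivity
  have hcast : (((2 ^ r : ℕ) : ℝ)) = 2 ^ r := by push_cast; rfl
  have hgv : Z l 0 v = (1 + ε / 3) * extendToReal (g l) v := by
    have h1 := hgrid l _ hf1
    have h2 := centeredCount_grid_sum (fun i => V i ω) n t hH (2 ^ r) ⌊(2 : ℝ) ^ r * s⌋₊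
    rw [hcast] at h1 h2
    rw [h1, ← Finset.mul_sum, mul_inv_cancel_left₀ (show 1 + ε / 3 ≠ 0 by positivity)]
    simp only [hZ, mul_zero, add_zero]
    rw [h2, Finset.mul_sum]
  have hv1 : v ≤ 1 := hf2.trans s.2.2
  have hgext : extendToReal (g l) v = (g l).1 ⟨v, hv0, hv1⟩ := extendToReal_coe (g l) ⟨v, hv0, hv1⟩
  have hg1 := abs_apply_le_one_of_mem_strassenBall hg l ⟨v, hv0, hv1⟩
  have hgmod := abs_sub_le_of_mem_strassenBall hg l ⟨v, hv0, hv1⟩ s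
  have hgmod' : |(g l).1 ⟨v, hv0, hv1⟩ - (g l).1 s| ≤ ε / 3 := by
    refine hgmod.trans ((Real.sqrt_le_sqrt ?_).trans (hr₁ r (le_max_right _ _)))
    rw [abs_sub_comm, abs_of_nonneg (sub_nonneg.2 hf2)]
    exact hf3
  have hsplit : Z l 0 s = Z l 0 v + Z l v s := by
    simp only [hZ]
    rw [← mul_add, centeredCount_add]
    · gcongr
    · gcongr
  have hZosc : |Z l v s| ≤ ε / 3 := by
    have h1 := hosc l n hn s s.2
    have hroot : √(N j * H j l * L j) ≤ √(2 * N j * H j l * L j) := by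
      apply Real.sqrt_le_sqrt
      have : 0 < N j * H j l * L j := by positivity
      linarith
    have hrpos : 0 < √(2 * N j * H j l * L j) := Real.sqrt_pos.2 (by positivity)
    simp only [hZ]
    rw [abs_mul, abs_of_pos (inv_pos.2 hrpos), inv_mul_le_iff₀ hrpos,
      mul_comm (√(2 * N j * H j l * L j))]
    exact h1.trans (mul_le_mul_of_nonneg_left hroot (by positivity))
  have hgoal : (√(2 * N j * H j l * L j))⁻¹ *
      centeredCount (fun i => V i ω) n t (t + H j l * s) = Z l 0 s := by
    simp only [hZ, mul_zero, add_zero]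
  rw [hgoal, hsplit, hgv, hgext]
  have e : (1 + ε / 3) * (g l).1 ⟨v, hv0, hv1⟩ + Z l v s - (g l).1 s =
      ε / 3 * (g l).1 ⟨v, hv0, hv1⟩ + Z l v s + ((g l).1 ⟨v, hv0, hv1⟩ - (g l).1 s) := by ring
  rw [e]
  have h3 : |ε / 3 * (g l).1 ⟨v, hv0, hv1⟩| ≤ ε / 3 := by
    rw [abs_mul, abs_of_pos (show 0 < ε / 3 by positivity)]
    exact mul_le_of_le_one_right (by positivity) hg1
  have h4 := abs_add_le (ε / 3 * (g l).1 ⟨v, hv0, hv1⟩ + Z l v s) ((g l).1 ⟨v, hv0, hv1⟩ - (g l).1 s)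
  have h5 := abs_add_le (ε / 3 * (g l).1 ⟨v, hv0, hv1⟩) (Z l v s)
  linarith

end

/-! ### Cluster points along disjoint blocks -/

theorem measurableSet_gridVector_near {Ω : Type*} [MeasurableSpace Ω] {k : ℕ} {t : ℝ} {N : ℕ}
    {H : Fin k → ℝ} {L : ℝ} {m : ℕ} {W : ℕ → Ω → ℝ} {n : ℕ}
    (hW : ∀ i : ℕ, i < n → Measurable (W i)) (x : Fin k × Fin m → ℝ) (δ : ℝ) :
    MeasurableSet {ω | ∀ p, |gridVector t N H L m (fun i => W i ω) n p - x p| < δ} := by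
  have hsum : ∀ a b : ℝ, Measurable fun ω => centeredCount (fun i => W i ω) n a b := fun a b =>
    Finset.measurable_fun_sum _ fun i hi =>
      (measurable_centeredIndicator a b).comp (hW i (Finset.mem_range.1 hi))
  simp only [Set.ofPred_forall]
  refine MeasurableSet.iInter fun p => measurableSet_lt ?_ measurable_const
  exact (((hsum _ _).const_mul _).sub_const (x p)).norm

section

variable {Ω : Type*} [MeasurableSpace Ω] {P : Measure Ω}
variable {k : ℕ} {t : ℝ} {N : ℕ → ℕ} {H : ℕ → Fin k → ℝ} {L : ℕ → ℝ}

/-- The lower large deviation bound for the grid increments around a point of energy less than one. -/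
theorem IsBandwidthArray.eventually_exp_neg_le_measure_gridVector [IsProbabilityMeasure P]
    (hA : IsBandwidthArray N H L) (ht0 : 0 ≤ t) (ht1 : t < 1) {V : ℕ → ℕ → Ω → ℝ}
    (hV : ∀ j, IsIIDUniform (V j) P) {m : ℕ} {x : Fin k × Fin m → ℝ} (hx : ∑ p, x p ^ 2 < 1)
    {δ : ℝ} (hδ : 0 < δ) :
    ∀ᶠ j in atTop, Real.exp (-L j) ≤
      P.real {ω | ∀ p, |gridVector t (N j) (H j) (L j) m (fun i => V j i ω) (N j) p - x p| < δ} := by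
  have hexp : ∀ j (θ : Fin k × Fin m → ℝ) ω, Real.exp (L j * ∑ p, θ p *
      gridVector t (N j) (H j) (L j) m (fun i => V j i ω) (N j) p) =
      Real.exp (∑ i ∈ Finset.range (N j), gridTilt t (N j) (H j) (L j) m θ (V j i ω)) :=
    fun j θ ω => by rw [mul_sum_gridVector]
  refine eventually_exp_neg_le_measure hA.tendsto_log (Y := fun j ω =>
    gridVector t (N j) (H j) (L j) m (fun i => V j i ω) (N j)) ?_ ?_ ?_ hx hδ
  · intro j p
    exact ((hV j).measurable_sum (measurable_centeredIndicator _ _) (N j)).const_mul _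
  · intro j θ
    simp_rw [hexp]
    obtain ⟨M, hM⟩ := exists_abs_gridTilt_le (t := t) (N j) (H j) (L j) θ
    exact (hV j).integrable_exp_sum (measurable_gridTilt _ _ _ _) hM (N j)
  · intro θ
    simp_rw [hexp]
    simp_rw [fun j => (hV j).integral_exp_sum (measurable_gridTilt (t := t) (N j) (H j) (L j) θ) (N j)]
    exact hA.tendsto_log_mgf ht0 ht1 θ

/-- Along a bandwidth array whose samples are disjoint blocks of one sequence, the normalised
processes come arbitrarily close to every function of energy less than one infinitely often. -/
theorem IsBandwidthArray.ae_frequently_near [IsProbabilityMeasure P]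
    (hA : IsBandwidthArray N H L) (ht0 : 0 ≤ t) (ht1 : t < 1)
    {U : ℕ → Ω → ℝ} (hU : IsIIDUniform U P) {c : ℕ → ℕ} (hcN : ∀ j, c j + N j = c (j + 1))
    (hs2 : Summable fun j => Real.exp (-(2 * L j))) (hdiv : ¬ Summable fun j => Real.exp (-L j))
    {f : Fin k → ℝ → ℝ} {b : ℝ} (hb : b < 1) (hf : EnergyLE b f) (hf0 : ∀ l, f l 0 = 0)
    {ε : ℝ} (hε : 0 < ε) :
    ∀ᵐ ω ∂P, ∃ᶠ j in atTop, ∀ l, ∀ s ∈ Set.Icc (0 : ℝ) 1,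
      |(√(2 * N j * H j l * L j))⁻¹ *
        centeredCount (fun i => U (i + c j) ω) (N j) t (t + H j l * s) - f l s| ≤ ε := by
  obtain ⟨r₀, hr₀⟩ := exists_ae_eventually_oscillation_le (P := P) (k := k) ht0 ht1
    (show 0 < ε / 3 by positivity)
  obtain ⟨r₁, hr₁⟩ := exists_sqrt_mesh_le (show 0 < ε / 3 by positivity)
  set r := max r₀ r₁ with hr
  have hm : 0 < 2 ^ r := by positivity
  have hcast : (((2 ^ r : ℕ) : ℝ)) = 2 ^ r := by push_cast; rfl
  have hsqrt : 0 < √((2 ^ r : ℕ) : ℝ) := Real.sqrt_pos.2 (by positivity)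
  set δ : ℝ := ε / 3 / √((2 ^ r : ℕ) : ℝ) with hδ
  have hδ0 : 0 < δ := by positivity
  set x : Fin k × Fin (2 ^ r) → ℝ := fun p => √((2 ^ r : ℕ) : ℝ) *
    (f p.1 ((p.2 + 1 : ℝ) / (2 ^ r : ℕ)) - f p.1 ((p.2 : ℝ) / (2 ^ r : ℕ))) with hx
  have hx1 : ∑ p, x p ^ 2 < 1 := by
    refine lt_of_le_of_lt (le_trans (le_of_eq ?_) (hf.grid_sum_le hm)) hb
    rw [Fintype.sum_prod_type]
    refine Finset.sum_congr rfl fun l _ => ?_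
    rw [Finset.sum_range]
    refine Finset.sum_congr rfl fun i _ => ?_
    rw [hx, mul_pow, Real.sq_sqrt (Nat.cast_nonneg _), ← sub_div, add_sub_cancel_left]
    field_simp
  set V : ℕ → ℕ → Ω → ℝ := fun j i => U (i + c j) with hVdef
  have hV : ∀ j, IsIIDUniform (V j) P := fun j => hU.shift (c j)
  set G : ℕ → Set Ω := fun j => {ω | ∀ p, |gridVector t (N j) (H j) (L j) (2 ^ r)
    (fun i => V j i ω) (N j) p - x p| < δ} with hG
  have hGlow : ∀ᶠ j in atTop, Real.exp (-L j) ≤ P.real (G j) :=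
    hA.eventually_exp_neg_le_measure_gridVector ht0 ht1 hV hx1 hδ0
  have hGblock : ∀ j, MeasurableSet[⨆ i ∈ Set.Ico (c j) (c (j + 1)),
      MeasurableSpace.comap (U i) inferInstance] (G j) := by
    intro j
    refine @measurableSet_gridVector_near Ω (⨆ i ∈ Set.Ico (c j) (c (j + 1)),
      MeasurableSpace.comap (U i) inferInstance) k t (N j) (H j) (L j) (2 ^ r) (V j) (N j)
      (fun i hi => ?_) x δ
    exact (comap_measurable (U (i + c j))).mono
      (le_iSup₂_of_le (i + c j) ⟨Nat.le_add_left _ _, by rw [← hcN]; omega⟩ le_rfl) le_rfl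
  have hGm : ∀ j, MeasurableSet (G j) := fun j =>
    (iSup₂_le fun i _ => (hU.measurable i).comap_le :
      (⨆ i ∈ Set.Ico (c j) (c (j + 1)), MeasurableSpace.comap (U i) inferInstance) ≤
        ‹MeasurableSpace Ω›) _ (hGblock j)
  have hcmono : Monotone c := monotone_nat_of_le_succ fun j => by rw [← hcN]; omega
  have hGind : iIndepSet G P := iIndepSet_of_blocks hU.measurable hU.indep hcmono hGblock
  have hGsum : ∑' j, P (G j) = ∞ := by
    by_contra hcon
    refine hdiv (Summable.of_norm_bounded_eventually_nat (ENNReal.summable_toReal hcon) ?_)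
    filter_upwards [hGlow] with j hj
    rw [Real.norm_of_nonneg (Real.exp_pos _).le]
    exact hj
  have hGio : ∀ᵐ ω ∂P, ∃ᶠ j in atTop, ω ∈ G j := by
    have h1 := (mem_ae_iff_prob_eq_one (MeasurableSet.measurableSet_limsup hGm)).2
      (measure_limsup_eq_one hGm hGind hGsum)
    filter_upwards [h1] with ω hω
    exact mem_limsup_iff_frequently_mem.1 hω
  filter_upwards [hGio, hr₀ r (le_max_left _ _) hA hs2 V hV] with ω hω hosc
  refine (hω.and_eventually (hosc.and (hA.tendsto_log.eventually_gt_atTop 0 |>.and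
    (eventually_all.2 fun l => hA.eventually_pos l)))).mono ?_
  rintro j ⟨hGj, hosc, hL, hpos⟩ l s hs
  have hH := hA.pos j l
  have hN := (hpos l).2
  have hrpos : 0 < √(2 * N j * H j l * L j) := Real.sqrt_pos.2 (by positivity)
  obtain ⟨hf1, hf2, hf3⟩ := floor_grid_le (r := r) hs
  set Z : ℝ → ℝ → ℝ := fun a b => (√(2 * N j * H j l * L j))⁻¹ *
    centeredCount (fun i => U (i + c j) ω) (N j) (t + H j l * a) (t + H j l * b) with hZ
  set v : ℝ := (⌊(2 : ℝ) ^ r * s⌋₊ : ℝ) / 2 ^ r with hv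
  have hv0 : 0 ≤ v := by positivity
  have hZosc : |Z v s| ≤ ε / 3 := by
    have h1 := hosc l (N j) le_rfl s hs
    have hroot : √(N j * H j l * L j) ≤ √(2 * N j * H j l * L j) := by
      apply Real.sqrt_le_sqrt
      have : 0 < N j * H j l * L j := by positivity
      linarith
    simp only [hZ]
    rw [abs_mul, abs_of_pos (inv_pos.2 hrpos), inv_mul_le_iff₀ hrpos,
      mul_comm (√(2 * N j * H j l * L j))]
    exact h1.trans (mul_le_mul_of_nonneg_left hroot (by positivity))
  have hfosc : |f l s - f l v| ≤ ε / 3 :=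
    ((hf.mono hb.le).abs_sub_le l hv0 hf2 hs.2).trans
      ((Real.sqrt_le_sqrt hf3).trans (hr₁ r (le_max_right _ _)))
  -- the errors of at most `2 ^ r` grid increments add up
  have hgrid : |Z 0 v - f l v| ≤ ε / 3 := by
    have h1 := centeredCount_grid_sum (fun i => U (i + c j) ω) (N j) t hH (2 ^ r)
      ⌊(2 : ℝ) ^ r * s⌋₊
    have h2 : f l v = ∑ i ∈ Finset.range ⌊(2 : ℝ) ^ r * s⌋₊,
        (f l ((i + 1 : ℝ) / (2 ^ r : ℕ)) - f l ((i : ℝ) / (2 ^ r : ℕ))) := by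
      have := Finset.sum_range_sub (fun i : ℕ => f l ((i : ℝ) / (2 ^ r : ℕ))) ⌊(2 : ℝ) ^ r * s⌋₊
      push_cast at this ⊢
      rw [this]
      simp [hf0, hv]
    have h3 : Z 0 v = ∑ i ∈ Finset.range ⌊(2 : ℝ) ^ r * s⌋₊,
        Z ((i : ℝ) / (2 ^ r : ℕ)) ((i + 1 : ℝ) / (2 ^ r : ℕ)) := by
      simp only [hZ, mul_zero, add_zero]
      rw [← Finset.mul_sum, ← h1, hcast]
    rw [h3, h2, ← Finset.sum_sub_distrib]
    refine (Finset.abs_sum_le_sum_abs _ _).trans ?_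
    have h4 : ∀ i ∈ Finset.range ⌊(2 : ℝ) ^ r * s⌋₊,
        |Z ((i : ℝ) / (2 ^ r : ℕ)) ((i + 1 : ℝ) / (2 ^ r : ℕ)) -
          (f l ((i + 1 : ℝ) / (2 ^ r : ℕ)) - f l ((i : ℝ) / (2 ^ r : ℕ)))| ≤
          δ / √((2 ^ r : ℕ) : ℝ) := by
      intro i hi
      have hi' : i < 2 ^ r := (Finset.mem_range.1 hi).trans_le hf1
      have h5 := (hGj (l, ⟨i, hi'⟩)).le
      rw [le_div_iff₀ hsqrt, mul_comm]
      refine le_trans (le_of_eq ?_) h5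
      rw [← abs_of_pos hsqrt, ← abs_mul]
      congr 1
      simp only [gridVector, hx, hZ, hVdef]
      rw [div_eq_mul_inv]
      ring
    refine (Finset.sum_le_sum h4).trans ?_
    rw [Finset.sum_const, Finset.card_range, nsmul_eq_mul]
    calc (⌊(2 : ℝ) ^ r * s⌋₊ : ℝ) * (δ / √((2 ^ r : ℕ) : ℝ))
        ≤ ((2 ^ r : ℕ) : ℝ) * (δ / √((2 ^ r : ℕ) : ℝ)) := by
          gcongr
      _ = ε / 3 * (((2 ^ r : ℕ) : ℝ) / (√((2 ^ r : ℕ) : ℝ) * √((2 ^ r : ℕ) : ℝ))) := by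
          rw [hδ]; field_simp
      _ = ε / 3 := by
          rw [Real.mul_self_sqrt (Nat.cast_nonneg _), div_self (by positivity), mul_one]
  have hsplit : (√(2 * N j * H j l * L j))⁻¹ *
      centeredCount (fun i => U (i + c j) ω) (N j) t (t + H j l * s) = Z 0 v + Z v s := by
    simp only [hZ, mul_zero, add_zero]
    rw [← mul_add, centeredCount_add]
    · have : 0 ≤ H j l * v := by positivity
      linarith
    · gcongr
  rw [hsplit]
  have e : Z 0 v + Z v s - f l s = (Z 0 v - f l v) + Z v s - (f l s - f l v) := by ring
  rw [e]
  have h6 := abs_sub (Z 0 v - f l v + Z v s) (f l s - f l v)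
  have h7 := abs_add_le (Z 0 v - f l v) (Z v s)
  linarith

end

/-! ### Iterated logarithms along geometric sequences -/

theorem one_lt_log_three : 1 < Real.log 3 := by
  rw [Real.lt_log_iff_exp_lt (by norm_num)]
  exact Real.exp_one_lt_three

theorem log₂_mono : Monotone log₂ := fun x y hxy => by
  have h1 : Real.log 3 ≤ Real.log (max x 3) := Real.log_le_log (by norm_num) (le_max_right _ _)
  have h0 := one_lt_log_three
  exact Real.log_le_log (by linarith)
    (Real.log_le_log (lt_max_of_lt_right (by norm_num)) (max_le_max_right 3 hxy))

theorem log₂_pos (x : ℝ) : 0 < log₂ x := by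
  have h1 : Real.log 3 ≤ Real.log (max x 3) := Real.log_le_log (by norm_num) (le_max_right _ _)
  exact Real.log_pos (one_lt_log_three.trans_le h1)

theorem eventually_log₂_pow {a : ℝ} (ha : 1 < a) :
    ∀ᶠ j : ℕ in atTop, log₂ (a ^ j) = Real.log (j * Real.log a) := by
  filter_upwards [(tendsto_pow_atTop_atTop_of_one_lt ha).eventually_ge_atTop 3] with j hj
  rw [log₂, max_eq_left hj, Real.log_pow]

theorem tendsto_log₂_pow {a : ℝ} (ha : 1 < a) : Tendsto (fun j : ℕ => log₂ (a ^ j)) atTop atTop :=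
  (Real.tendsto_log_atTop.comp
    (tendsto_natCast_atTop_atTop.atTop_mul_const (Real.log_pos ha))).congr'
    ((eventually_log₂_pow ha).mono fun _ h => h.symm)

theorem summable_exp_neg_log₂_pow {a : ℝ} (ha : 1 < a) (q : ℝ) :
    (Summable fun j : ℕ => Real.exp (-(q * log₂ (a ^ j)))) ↔ 1 < q := by
  have hla := Real.log_pos ha
  have h1 : (fun j : ℕ => Real.exp (-(q * log₂ (a ^ j)))) =ᶠ[atTop]
      fun j : ℕ => (j : ℝ) ^ (-q) * Real.log a ^ (-q) := by
    filter_upwards [eventually_log₂_pow ha, eventually_gt_atTop 0] with j hj hj0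
    have hj0' : (0 : ℝ) < j := by exact_mod_cast hj0
    rw [hj, ← Real.mul_rpow hj0'.le hla.le, Real.rpow_def_of_pos (by positivity)]
    congr 1
    ring
  rw [← Nat.cofinite_eq_atTop] at h1
  rw [summable_congr_cofinite h1, summable_mul_right_iff (by positivity), Real.summable_nat_rpow]
  exact neg_lt_neg_iff

theorem eventually_log₂_pow_succ_le {a b : ℝ} (ha : 1 < a) (hb : 1 < b) :
    ∀ᶠ j : ℕ in atTop, log₂ (a ^ (j + 1)) ≤ b * log₂ (a ^ j) := by
  have hla := Real.log_pos ha
  filter_upwards [eventually_log₂_pow ha, (tendsto_add_atTop_nat 1).eventually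
    (eventually_log₂_pow ha), eventually_gt_atTop 0,
    (tendsto_log₂_pow ha).eventually_ge_atTop (Real.log 2 / (b - 1))] with j h1 h2 h3 h4
  have h3' : (1 : ℝ) ≤ j := by exact_mod_cast h3
  rw [div_le_iff₀ (by linarith)] at h4
  have h5 : log₂ (a ^ (j + 1)) ≤ Real.log 2 + log₂ (a ^ j) := by
    rw [h2, h1, ← Real.log_mul (by norm_num) (by positivity)]
    apply Real.log_le_log (by positivity)
    push_cast
    nlinarith
  linarith

/-! ### Bandwidth families -/

/-- The regularity of the bandwidths that is used: for each `l`, ultimately `h n l ↓ 0` and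
`n * h n l` is non-decreasing with `n * h n l / log₂ n → ∞`, and bandwidths with different indices
are of different orders of magnitude. -/
structure IsBandwidthFamily {k : ℕ} (h : ℕ → Fin k → ℝ) : Prop where
  pos : ∀ n l, 0 < h n l
  eventually_mono : ∃ N, ∀ m n, N ≤ m → m ≤ n → ∀ l, h n l ≤ h m l ∧ m * h m l ≤ n * h n l
  tendsto_zero : ∀ l, Tendsto (fun n => h n l) atTop (𝓝 0)
  tendsto_count : ∀ l, Tendsto (fun n : ℕ => n * h n l / log₂ n) atTop atTop
  tendsto_ratio : ∀ l l', l < l' → Tendsto (fun n => h n l / h n l') atTop (𝓝 0)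

/-- The monotonicity of the extreme bandwidths passes to the intermediate ones through the monotone
ratios: that of `h n l` downwards from the largest index, that of `n * h n l` upwards from the
smallest. -/
theorem IsBandwidthFamily.of_ultimately {k : ℕ} (hk : 0 < k) {h : ℕ → Fin k → ℝ}
    (h_pos : ∀ n l, 0 < h n l) (h_mono : ∀ n, StrictMono (h n))
    (h_ratio : ∀ l l' : Fin k, (l : ℕ) + 1 = l' →
      UltimatelyDecreasesToZero fun n => h n l / h n l')
    (h_last : UltimatelyDecreasesToZero fun n => h n ⟨k - 1, by omega⟩)
    (h_first : UltimatelyIncreasesToInfinity fun n => (n : ℝ) * h n ⟨0, by omega⟩)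
    (h_first_log : Tendsto (fun n : ℕ => (n : ℝ) * h n ⟨0, by omega⟩ / log₂ n) atTop atTop) :
    IsBandwidthFamily h where
  pos := h_pos
  eventually_mono := by
    have h1 : ∀ d : ℕ, ∀ l : Fin k, (l : ℕ) + d = k - 1 →
        ∃ N, AntitoneOn (fun n => h n l) (Set.Ici N) := by
      intro d
      induction d with
      | zero =>
        intro l hl
        have hl' : l = ⟨k - 1, by omega⟩ := Fin.ext (by simpa using hl)
        rw [hl']
        exact h_last.1
      | succ d ih =>
        intro l hl
        obtain ⟨N₁, hN₁⟩ := ih ⟨l + 1, by omega⟩ (by simp only; omega)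
        obtain ⟨N₂, hN₂⟩ := (h_ratio l ⟨l + 1, by omega⟩ rfl).1
        refine ⟨max N₁ N₂, fun m hm n hn hmn => ?_⟩
        rw [Set.mem_Ici, max_le_iff] at hm hn
        have e1 := hN₁ hm.1 hn.1 hmn
        have e2 := hN₂ hm.2 hn.2 hmn
        have e3 := mul_le_mul e2 e1 (h_pos _ _).le (div_pos (h_pos _ _) (h_pos _ _)).le
        simpa only [div_mul_cancel₀ _ (h_pos _ _).ne'] using e3
    have h2 : ∀ i : ℕ, ∀ hi : i < k,
        ∃ N, MonotoneOn (fun n : ℕ => (n : ℝ) * h n ⟨i, hi⟩) (Set.Ici N) := by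
      intro i
      induction i with
      | zero => exact fun hi => h_first.1
      | succ i ih =>
        intro hi
        obtain ⟨N₁, hN₁⟩ := ih (by omega)
        obtain ⟨N₂, hN₂⟩ := (h_ratio ⟨i, by omega⟩ ⟨i + 1, hi⟩ rfl).1
        refine ⟨max N₁ N₂, fun m hm n hn hmn => ?_⟩
        rw [Set.mem_Ici, max_le_iff] at hm hn
        have e1 := hN₁ hm.1 hn.1 hmn
        have e2 := hN₂ hm.2 hn.2 hmn
        have e3 := div_le_div₀ (mul_nonneg (Nat.cast_nonneg n) (h_pos n ⟨i, by omega⟩).le) e1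
          (div_pos (h_pos _ _) (h_pos _ _)) e2
        have e4 : ∀ n : ℕ, (n : ℝ) * h n ⟨i, by omega⟩ / (h n ⟨i, by omega⟩ / h n ⟨i + 1, hi⟩) =
            n * h n ⟨i + 1, hi⟩ := fun n => by
          have := (h_pos n ⟨i, by omega⟩).ne'
          field_simp
        simpa only [e4] using e3
    choose N₁ hN₁ using fun l : Fin k => h1 (k - 1 - l) l (by omega)
    choose N₂ hN₂ using fun l : Fin k => h2 l l.2
    refine ⟨Finset.univ.sup fun l => max (N₁ l) (N₂ l), fun m n hm hmn l => ?_⟩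
    have hl : max (N₁ l) (N₂ l) ≤ m :=
      (Finset.le_sup (f := fun l => max (N₁ l) (N₂ l)) (Finset.mem_univ l)).trans hm
    exact ⟨hN₁ l (le_of_max_le_left hl) (le_of_max_le_left (hl.trans hmn)) hmn,
      hN₂ l (le_of_max_le_right hl) (le_of_max_le_right (hl.trans hmn)) hmn⟩
  tendsto_zero l := by
    refine tendsto_of_tendsto_of_tendsto_of_le_of_le tendsto_const_nhds h_last.2
      (fun n => (h_pos n l).le) fun n => ?_
    exact (h_mono n).monotone (Fin.le_def.2 (by simp only; omega))
  tendsto_count l := by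
    refine tendsto_atTop_mono (fun n => ?_) h_first_log
    have := log₂_pos n
    have := (h_mono n).monotone (Fin.le_def.2 (Nat.zero_le _) : (⟨0, by omega⟩ : Fin k) ≤ l)
    gcongr
  tendsto_ratio l l' hll := by
    have hlt : (l : ℕ) < l' := hll
    refine tendsto_of_tendsto_of_tendsto_of_le_of_le tendsto_const_nhds
      (h_ratio l ⟨l + 1, by omega⟩ rfl).2 (fun n => (div_pos (h_pos _ _) (h_pos _ _)).le)
      fun n => ?_
    exact div_le_div_of_nonneg_left (h_pos _ _).le (h_pos _ _)
      ((h_mono n).monotone (Fin.le_def.2 hlt))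

/-- Sampling a bandwidth family along a subsequence `σ`, with sample sizes of the same order. -/
theorem IsBandwidthFamily.isBandwidthArray {k : ℕ} {h : ℕ → Fin k → ℝ} (hh : IsBandwidthFamily h)
    {σ N : ℕ → ℕ} {L : ℕ → ℝ} (hσ : Tendsto σ atTop atTop) (hL : Tendsto L atTop atTop)
    (hLσ : ∀ j, L j ≤ log₂ (σ j)) {c : ℝ} (hc : 0 < c) (hN : ∀ j, c * σ j ≤ N j) :
    IsBandwidthArray N (fun j => h (σ j)) L where
  pos j l := hh.pos _ _
  tendsto_log := hL
  tendsto_count l := by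
    refine tendsto_atTop_mono' _ ?_ (((hh.tendsto_count l).comp hσ).const_mul_atTop hc)
    filter_upwards [hL.eventually_gt_atTop 0] with j hj
    have h1 := hh.pos (σ j) l
    have h2 : c * (σ j * h (σ j) l / log₂ (σ j)) = c * σ j * h (σ j) l / log₂ (σ j) := by ring
    simp only [Function.comp_apply]
    rw [h2]
    have h3 := hN j
    have h4 := hLσ j
    gcongr
  tendsto_zero l := (hh.tendsto_zero l).comp hσ
  tendsto_ratio l l' hll := (hh.tendsto_ratio l l' hll).comp hσ

/-! ### The normalised local empirical process -/

theorem normalizedProcess_apply (u : ℕ → ℝ) (n : ℕ) {h : ℝ} (hh : 0 ≤ h) (t : ℝ)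
    (s : unitInterval) : (normalizedProcess u n h hh t).1 s =
      (√(2 * n * h * log₂ n))⁻¹ * centeredCount u n t (t + h * s) := by
  have hhs : t ≤ t + h * s := le_add_of_nonneg_right (mul_nonneg hh s.2.1)
  have h1 : centeredCount u n t (t + h * s) =
      (((Finset.range n).filter fun i => u i ≤ t + h * s).card : ℝ) -
        ((Finset.range n).filter fun i => u i ≤ t).card - n * (h * s) := by
    simp only [centeredCount, centeredIndicator, Finset.card_filter, Nat.cast_sum]
    rw [Finset.sum_sub_distrib, Finset.sum_const, Finset.card_range, ← Finset.sum_sub_distrib,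
      nsmul_eq_mul, add_sub_cancel_left]
    congr 1
    refine Finset.sum_congr rfl fun i _ => ?_
    by_cases h2 : u i ≤ t
    · simp [h2, h2.trans hhs]
    · by_cases h3 : u i ≤ t + h * s <;> simp [h2, h3, not_le.1 h2]
  have h2 : (normalizedProcess u n h hh t).1 s =
      (√(2 * h * log₂ n))⁻¹ * localIncrement u n h t s := rfl
  rw [h2, h1]
  unfold localIncrement empiricalProcess empiricalCDF
  rcases Nat.eq_zero_or_pos n with rfl | hn
  · simp
  · have hn' : (0 : ℝ) < n := by exact_mod_cast hn
    have h3 : √(2 * n * h * log₂ n) = √n * √(2 * h * log₂ n) := by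
      rw [← Real.sqrt_mul hn'.le]
      congr 1
      ring
    have h4 : 0 < √(n : ℝ) := Real.sqrt_pos.2 hn'
    have h5 : (n : ℝ) = √n * √n := (Real.mul_self_sqrt hn'.le).symm
    have h6 : ∀ c d : ℝ, √(n : ℝ) * (c / n - (t + h * s)) - √(n : ℝ) * (d / n - t) =
        (√(n : ℝ))⁻¹ * (c - d - n * (h * s)) := by
      intro c d
      field_simp
      rw [Real.sq_sqrt hn'.le]
      ring
    rw [h6, h3, mul_inv]
    ring

theorem centeredCount_add_sample (u : ℕ → ℝ) (m n : ℕ) (a b : ℝ) :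
    centeredCount u (m + n) a b =
      centeredCount u m a b + centeredCount (fun i => u (i + m)) n a b := by
  simp only [centeredCount, Finset.sum_range_add, add_comm]

theorem isIIDUniform_of_isUniform {Ω : Type*} [MeasurableSpace Ω] {P : Measure Ω}
    {U : ℕ → Ω → ℝ} (hU_meas : ∀ i, Measurable (U i)) (hU_indep : iIndepFun U P)
    (hU_unif : ∀ i, pdf.IsUniform (U i) (Set.Icc 0 1) P volume) : IsIIDUniform U P where
  measurable := hU_meas
  indep := hU_indep
  map_eq i := by
    have h1 := hU_unif i
    rw [pdf.IsUniform] at h1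
    rw [h1, ProbabilityTheory.cond]
    simp

/-! ### The normalised processes approach the Strassen ball -/

section

variable {Ω : Type*} [MeasurableSpace Ω] {P : Measure Ω} [IsProbabilityMeasure P]
variable {k : ℕ} {t : ℝ} {h : ℕ → Fin k → ℝ} {U : ℕ → Ω → ℝ}

theorem abs_sub_one_le_of_sq_le {c η : ℝ} (hc : 0 ≤ c) (h1 : 1 - η ≤ c ^ 2) (h2 : c ^ 2 ≤ 1 + η) :
    |c - 1| ≤ η := by
  rw [abs_le]
  rcases le_total c 1 with h | h
  · constructor <;> nlinarith
  · constructor <;> nlinarith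

/-- For `a ^ j ≤ n < a ^ (j + 1)`, the process at `n` is, up to a factor close to `1` and a
change of the argument by a factor close to `1`, the process of `n` points at the bandwidths and
the normalisation attached to `j`, which is controlled for all `n ≤ ⌈a ^ (j + 1)⌉₊` at once. -/
theorem ae_eventually_near_strassenBall (hh : IsBandwidthFamily h) (ht0 : 0 ≤ t) (ht1 : t < 1)
    (hU : IsIIDUniform U P) {ε : ℝ} (hε : 0 < ε) :
    ∀ᵐ ω ∂P, ∀ᶠ n in atTop, ∃ g ∈ strassenBall k,
      dist (fun l => normalizedProcess (fun i => U i ω) n (h n l) (hh.pos n l).le t) g ≤ ε := by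
  set η : ℝ := min ((ε / 3) ^ 2) (ε / 3 / (1 + ε / 3)) with hη
  have hη0 : 0 < η := by positivity
  have hη1 : √η ≤ ε / 3 := by
    rw [Real.sqrt_le_left (by positivity)]
    exact min_le_left _ _
  have hη2 : η * (1 + ε / 3) ≤ ε / 3 := (le_div_iff₀ (by positivity)).1 (min_le_right _ _)
  set a : ℝ := √(1 + η) with ha_def
  have ha2 : a ^ 2 = 1 + η := Real.sq_sqrt (by positivity)
  have ha : 1 < a := by
    rw [ha_def, Real.lt_sqrt zero_le_one]
    linarith
  have ha0 : 0 < a := by linarith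
  have haη : 1 - η ≤ 1 / a := by
    rw [le_div_iff₀ ha0]
    nlinarith
  have hceil : ∀ j, ⌈a ^ j⌉₊ ≤ ⌈a ^ (j + 1)⌉₊ := fun j =>
    Nat.ceil_mono (pow_le_pow_right₀ ha.le j.le_succ)
  have hσ : Tendsto (fun j : ℕ => ⌈a ^ j⌉₊) atTop atTop :=
    tendsto_nat_ceil_atTop.comp (tendsto_pow_atTop_atTop_of_one_lt ha)
  have hA : IsBandwidthArray (fun j => ⌈a ^ (j + 1)⌉₊) (fun j => h ⌈a ^ j⌉₊)
      (fun j => log₂ (a ^ j)) :=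
    hh.isBandwidthArray hσ (tendsto_log₂_pow ha) (fun j => log₂_mono (Nat.le_ceil _)) one_pos
      fun j => by rw [one_mul]; exact_mod_cast hceil j
  have hsum : ∀ δ > 0, Summable fun j : ℕ => Real.exp (-((1 + δ) * log₂ (a ^ j))) := fun δ hδ =>
    (summable_exp_neg_log₂_pow ha (1 + δ)).2 (by linarith)
  obtain ⟨N₁, hN₁⟩ := hh.eventually_mono
  filter_upwards [hA.ae_eventually_near_strassenBall ht0 ht1 hsum hU
    (show 0 < ε / 3 by positivity)] with ω hω
  have hbig : ∀ᶠ j : ℕ in atTop, 1 ≤ (a - 1) * a * a ^ j :=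
    ((tendsto_pow_atTop_atTop_of_one_lt ha).const_mul_atTop
      (mul_pos (by linarith) ha0)).eventually_ge_atTop 1
  obtain ⟨J, hJ⟩ := eventually_atTop.1 (hω.and ((eventually_log₂_pow_succ_le ha ha).and
    ((hσ.eventually_ge_atTop N₁).and hbig)))
  filter_upwards [eventually_ge_atTop ⌈a ^ J⌉₊, eventually_ge_atTop 1] with n hnJ hn1
  have hn1' : (1 : ℝ) ≤ n := by exact_mod_cast hn1
  obtain ⟨j, hj1, hj2⟩ := exists_nat_pow_near hn1' ha
  have hjJ : J ≤ j := by
    have h1 : a ^ J < a ^ (j + 1) := (Nat.ceil_le.1 hnJ).trans_lt hj2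
    exact Nat.lt_succ_iff.1 ((pow_lt_pow_iff_right₀ ha).1 h1)
  obtain ⟨hnear, hlog, hσN, hbig⟩ := hJ j hjJ
  have hσn : ⌈a ^ j⌉₊ ≤ n := Nat.ceil_le.2 hj1
  have hnN : n ≤ ⌈a ^ (j + 1)⌉₊ := by
    have : (n : ℝ) ≤ ⌈a ^ (j + 1)⌉₊ := hj2.le.trans (Nat.le_ceil _)
    exact_mod_cast this
  obtain ⟨g, hg, hgn⟩ := hnear n hnN
  refine ⟨g, hg, CadlagSpace.dist_pi_le hε.le fun l s => ?_⟩
  rw [normalizedProcess_apply]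
  set H := h ⌈a ^ j⌉₊ l with hH
  set N : ℝ := (⌈a ^ (j + 1)⌉₊ : ℝ) with hN
  have hH0 : 0 < H := hh.pos _ _
  have hhn0 : 0 < h n l := hh.pos _ _
  have hL0 : 0 < log₂ (a ^ j) := log₂_pos _
  have hLn0 : 0 < log₂ n := log₂_pos _
  have hnN' : (n : ℝ) ≤ N := Nat.cast_le.2 hnN
  have hN0 : 0 < N := by linarith
  have hσ1 : a ^ j ≤ (⌈a ^ j⌉₊ : ℝ) := Nat.le_ceil _
  have hapos : 0 < a ^ j := by positivity
  have hNa : N ≤ a ^ 2 * a ^ j := by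
    have h1 : N < a ^ (j + 1) + 1 := Nat.ceil_lt_add_one (by positivity)
    have h2 : a ^ (j + 1) = a * a ^ j := by ring
    rw [h2] at h1
    nlinarith
  obtain ⟨hanti, hmono⟩ := hN₁ _ _ hσN hσn l
  have hrange : a ^ j * H ≤ n * h n l := (mul_le_mul_of_nonneg_right hσ1 hH0.le).trans hmono
  have hr1 : h n l / H ≤ 1 := (div_le_one hH0).2 hanti
  -- the bandwidth ratio is at least `a ^ j / n ≥ 1 / a`
  have hr2 : 1 / a ≤ h n l / H := by
    rw [div_le_div_iff₀ ha0 hH0, one_mul]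
    have h1 : (n : ℝ) * h n l ≤ a ^ (j + 1) * h n l := mul_le_mul_of_nonneg_right hj2.le hhn0.le
    have h2 : a ^ j * H ≤ a ^ j * (h n l * a) := by
      calc a ^ j * H ≤ a ^ (j + 1) * h n l := hrange.trans h1
        _ = a ^ j * (h n l * a) := by ring
    exact le_of_mul_le_mul_left h2 hapos
  set c : ℝ := √(2 * N * H * log₂ (a ^ j)) / √(2 * n * h n l * log₂ n) with hc
  have hden : 0 < 2 * n * h n l * log₂ n := by positivity
  have hnum : 0 < 2 * N * H * log₂ (a ^ j) := by positivity
  have hc2 : c ^ 2 = (2 * N * H * log₂ (a ^ j)) / (2 * n * h n l * log₂ n) := by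
    rw [hc, div_pow, Real.sq_sqrt hnum.le, Real.sq_sqrt hden.le]
  have hlow : 1 - η ≤ c ^ 2 := by
    refine haη.trans ?_
    rw [hc2, div_le_div_iff₀ ha0 hden]
    have h1 : log₂ n ≤ a * log₂ (a ^ j) := (log₂_mono hj2.le).trans hlog
    calc 1 * (2 * n * h n l * log₂ n) ≤ 2 * N * H * (a * log₂ (a ^ j)) := by
          rw [one_mul]; gcongr
      _ = 2 * N * H * log₂ (a ^ j) * a := by ring
  have hupp : c ^ 2 ≤ 1 + η := by
    rw [hc2, ← ha2, div_le_iff₀ hden]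
    have h1 : log₂ (a ^ j) ≤ log₂ n := log₂_mono hj1
    have h2 : N * H ≤ a ^ 2 * (n * h n l) := by
      calc N * H ≤ a ^ 2 * a ^ j * H := by gcongr
        _ = a ^ 2 * (a ^ j * H) := by ring
        _ ≤ a ^ 2 * (n * h n l) := by gcongr
    calc 2 * N * H * log₂ (a ^ j) = 2 * (N * H) * log₂ (a ^ j) := by ring
      _ ≤ 2 * (a ^ 2 * (n * h n l)) * log₂ n := by gcongr
      _ = a ^ 2 * (2 * n * h n l * log₂ n) := by ring
  have hc1 : |c - 1| ≤ η := abs_sub_one_le_of_sq_le (by positivity) hlow hupp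
  set s' : unitInterval := ⟨h n l / H * s, mul_nonneg (by positivity) s.2.1,
    mul_le_one₀ hr1 s.2.1 s.2.2⟩ with hs'
  set Z : ℝ := (√(2 * N * H * log₂ (a ^ j)))⁻¹ *
    centeredCount (fun i => U i ω) n t (t + H * s') with hZ
  have hZg : |Z - (g l).1 s'| ≤ ε / 3 := hgn l s'
  have hx : (√(2 * n * h n l * log₂ n))⁻¹ *
      centeredCount (fun i => U i ω) n t (t + h n l * s) = c * Z := by
    have h1 : H * (s' : ℝ) = h n l * s := by
      simp only [hs']
      field_simp
    have h2 : √(2 * N * H * log₂ (a ^ j)) ≠ 0 := (Real.sqrt_pos.2 hnum).ne'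
    rw [hZ, h1, hc]
    field_simp
  rw [hx]
  have hgs' := abs_apply_le_one_of_mem_strassenBall hg l s'
  have hZ1 : |Z| ≤ 1 + ε / 3 := by
    have h1 := abs_add_le (Z - (g l).1 s') ((g l).1 s')
    rw [sub_add_cancel] at h1
    linarith
  have hgg : |(g l).1 s' - (g l).1 s| ≤ ε / 3 := by
    refine (abs_sub_le_of_mem_strassenBall hg l s' s).trans ((Real.sqrt_le_sqrt ?_).trans hη1)
    have h1 : (s' : ℝ) - s = -((1 - h n l / H) * s) := by
      simp only [hs']
      ring
    rw [h1, abs_neg, abs_of_nonneg (mul_nonneg (by linarith) s.2.1)]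
    have h2 := s.2.2
    have h3 := s.2.1
    nlinarith
  have e : c * Z - (g l).1 s = (c - 1) * Z + (Z - (g l).1 s') + ((g l).1 s' - (g l).1 s) := by ring
  rw [e]
  have h1 := abs_add_three ((c - 1) * Z) (Z - (g l).1 s') ((g l).1 s' - (g l).1 s)
  have h2 : |(c - 1) * Z| ≤ ε / 3 := by
    rw [abs_mul]
    exact (mul_le_mul hc1 hZ1 (abs_nonneg _) hη0.le).trans hη2
  linarith

/-! ### Every point of the Strassen ball is approached -/

/-- The normalised count of a sample in terms of those of an initial part, with a fraction `κ` of
the points, and of the remaining points. -/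
theorem normalized_centeredCount_add_sample (u : ℕ → ℝ) {m n : ℕ} {κ H L : ℝ} (hκ0 : 0 < κ)
    (hκ1 : κ < 1) (hm : (m : ℝ) = κ * (m + n : ℕ)) (a b : ℝ) :
    (√(2 * (m + n : ℕ) * H * L))⁻¹ * centeredCount u (m + n) a b =
      √κ * ((√(2 * m * H * L))⁻¹ * centeredCount u m a b) +
      √(1 - κ) * ((√(2 * n * H * L))⁻¹ * centeredCount (fun i => u (i + m)) n a b) := by
  have hn : (n : ℝ) = (1 - κ) * (m + n : ℕ) := by
    rw [sub_mul, ← hm]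
    push_cast
    ring
  have h1 : 2 * m * H * L = κ * (2 * (m + n : ℕ) * H * L) := by
    rw [hm]
    ring
  have h2 : 2 * n * H * L = (1 - κ) * (2 * (m + n : ℕ) * H * L) := by
    rw [hn]
    ring
  have h3 : √κ ≠ 0 := (Real.sqrt_pos.2 hκ0).ne'
  have h4 : √(1 - κ) ≠ 0 := (Real.sqrt_pos.2 (sub_pos.2 hκ1)).ne'
  rw [h1, h2, Real.sqrt_mul hκ0.le, Real.sqrt_mul (sub_pos.2 hκ1).le, mul_inv, mul_inv,
    centeredCount_add_sample]
  generalize (√(2 * (m + n : ℕ) * H * L))⁻¹ = x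
  field_simp

theorem abs_block_sub_le {κ q v Y Z ε : ℝ} (hκ0 : 0 ≤ κ) (hκ1 : κ ≤ 1) (hq0 : 0 ≤ q) (hq1 : q ≤ 1)
    (hY : |Y| ≤ 2) (hZ : |Z - q * v| ≤ ε / 4) (hv : |v| ≤ 1) (hqε : 1 - q ≤ ε / 4)
    (hκε : κ ≤ ε / 4) (hκε' : √κ ≤ ε / 8) :
    |√κ * Y + √(1 - κ) * Z - v| ≤ ε := by
  have hρ1 : √(1 - κ) ≤ 1 := Real.sqrt_le_one.2 (by linarith)
  have hρ2 : 1 - κ ≤ √(1 - κ) := Real.le_sqrt_of_sq_le (by nlinarith)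
  have hρ0 : 0 ≤ √(1 - κ) := Real.sqrt_nonneg _
  generalize √(1 - κ) = ρ at *
  have e : √κ * Y + ρ * Z - v = √κ * Y + ρ * (Z - q * v) + (ρ * q - 1) * v := by ring
  rw [e]
  have h1 := abs_add_three (√κ * Y) (ρ * (Z - q * v)) ((ρ * q - 1) * v)
  have h2 : |√κ * Y| ≤ ε / 4 := by
    rw [abs_mul, abs_of_nonneg (Real.sqrt_nonneg _)]
    have := mul_le_mul hκε' hY (abs_nonneg _) ((Real.sqrt_nonneg κ).trans hκε')
    linarith
  have h3 : |ρ * (Z - q * v)| ≤ ε / 4 := by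
    rw [abs_mul, abs_of_nonneg hρ0]
    exact (mul_le_of_le_one_left (abs_nonneg _) hρ1).trans hZ
  have h4 : |(ρ * q - 1) * v| ≤ ε / 2 := by
    rw [abs_mul]
    refine (mul_le_of_le_one_right (abs_nonneg _) hv).trans ?_
    have h5 := mul_le_one₀ hρ1 hq0 hq1
    have h6 : 0 ≤ (1 - ρ) * (1 - q) := mul_nonneg (by linarith) (by linarith)
    rw [abs_sub_comm, abs_of_nonneg (by linarith)]
    linarith
  linarith

/-- Along the sample sizes `A ^ (j + 1)` the last block of points is close to `f` infinitely often,
and the contribution of the earlier points is of order `A ^ (-1/2)`. -/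
theorem ae_frequently_dist_le (hh : IsBandwidthFamily h) (ht0 : 0 ≤ t) (ht1 : t < 1)
    (hU : IsIIDUniform U P) {f : Fin k → CadlagSpace} (hf : f ∈ strassenBall k)
    {ε : ℝ} (hε : 0 < ε) :
    ∀ᵐ ω ∂P, ∃ᶠ n in atTop,
      dist (fun l => normalizedProcess (fun i => U i ω) n (h n l) (hh.pos n l).le t) f ≤ ε := by
  -- `A` is so large that a block `[A ^ j, A ^ (j + 1))` dominates everything that precedes it
  obtain ⟨A, hA⟩ := exists_nat_gt (64 / ε ^ 2 + 4 / ε + 2)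
  have hε64 : 0 < 64 / ε ^ 2 := by positivity
  have hε4 : 0 < 4 / ε := by positivity
  have hA2 : (2 : ℝ) < A := by linarith
  have hA2' : 2 < A := by exact_mod_cast hA2
  have hA1 : (1 : ℝ) < A := by linarith
  have hA0 : (0 : ℝ) < A := by linarith
  have hAinv : 1 / (A : ℝ) ≤ ε / 4 := by
    rw [div_le_iff₀ hA0]
    have h1 : ε / 4 * (4 / ε) = 1 := by field_simp
    have h2 : ε / 4 * (4 / ε) ≤ ε / 4 * A := by gcongr; linarith
    linarith
  have hAsqrt : √(1 / (A : ℝ)) ≤ ε / 8 := by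
    rw [Real.sqrt_le_left (by positivity), div_le_iff₀ hA0]
    have h1 : (ε / 8) ^ 2 * (64 / ε ^ 2) = 1 := by field_simp; norm_num
    have h2 : (ε / 8) ^ 2 * (64 / ε ^ 2) ≤ (ε / 8) ^ 2 * A := by gcongr; linarith
    linarith
  set q : ℝ := 1 - min (ε / 4) (1 / 2) with hq
  have hq1 : q < 1 := by
    have : 0 < min (ε / 4) (1 / 2) := by positivity
    linarith
  have hq0 : 0 < q := by
    have : min (ε / 4) (1 / 2 : ℝ) ≤ 1 / 2 := min_le_right _ _
    linarith
  have hqε : 1 - q ≤ ε / 4 := by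
    have : min (ε / 4) (1 / 2 : ℝ) ≤ ε / 4 := min_le_left _ _
    linarith
  obtain ⟨hf0, hfE⟩ := mem_strassenBall_iff.1 hf
  set σ : ℕ → ℕ := fun j => A ^ (j + 1) with hσdef
  set L : ℕ → ℝ := fun j => log₂ ((A : ℝ) ^ (j + 1)) with hLdef
  have hσ : Tendsto σ atTop atTop :=
    (tendsto_pow_atTop_atTop_of_one_lt (by omega : 1 < A)).comp (tendsto_add_atTop_nat 1)
  have hL : Tendsto L atTop atTop := (tendsto_log₂_pow hA1).comp (tendsto_add_atTop_nat 1)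
  have hLσ : ∀ j, L j ≤ log₂ (σ j) := fun j => by simp [hLdef, hσdef]
  have hple : ∀ j, A ^ j ≤ A ^ (j + 1) := fun j => Nat.pow_le_pow_right (by omega) j.le_succ
  have hsub : ∀ j, ((A ^ (j + 1) - A ^ j : ℕ) : ℝ) = A ^ (j + 1) - A ^ j := fun j => by
    rw [Nat.cast_sub (hple j)]
    push_cast
    rfl
  have hB : IsBandwidthArray (fun j => A ^ (j + 1) - A ^ j) (fun j => h (σ j)) L := by
    refine hh.isBandwidthArray hσ hL hLσ (c := 1 / 2) (by norm_num) fun j => ?_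
    rw [hsub, hσdef]
    push_cast
    have : (0 : ℝ) < A ^ j := by positivity
    rw [pow_succ]
    nlinarith
  have hB' : IsBandwidthArray (fun j => A ^ j) (fun j => h (σ j)) L := by
    refine hh.isBandwidthArray hσ hL hLσ (c := 1 / A) (by positivity) fun j => le_of_eq ?_
    rw [hσdef]
    push_cast
    rw [pow_succ]
    field_simp
  have hsumm : ∀ p : ℝ, (Summable fun j : ℕ => Real.exp (-(p * L j))) ↔ 1 < p := fun p => by
    rw [← summable_exp_neg_log₂_pow hA1 p]
    exact summable_nat_add_iff (f := fun j : ℕ => Real.exp (-(p * log₂ ((A : ℝ) ^ j)))) 1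
  have hdiv : ¬ Summable fun j => Real.exp (-L j) := by
    have := (hsumm 1).not.2 (lt_irrefl _)
    simpa only [one_mul] using this
  have hqE : EnergyLE (q ^ 2 * 1) fun l x => q * extendToReal (f l) x := hfE.const_mul q
  have hnear := hB.ae_frequently_near ht0 ht1 hU (c := fun j => A ^ j)
    (fun j => Nat.add_sub_cancel' (hple j)) ((hsumm 2).2 (by norm_num)) hdiv
    (by nlinarith : q ^ 2 * 1 < 1) hqE
    (fun l => by
      have : extendToReal (f l) 0 = 0 := by
        exact (extendToReal_coe (f l) 0).trans (hf0 l)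
      rw [this, mul_zero]) (show 0 < ε / 4 by positivity)
  have hprev := hB'.ae_eventually_near_strassenBall ht0 ht1
    (fun δ hδ => (hsumm (1 + δ)).2 (by linarith)) hU one_pos
  filter_upwards [hnear, hprev] with ω hω hprev
  refine hσ.frequently ((hω.and_eventually hprev).mono ?_)
  rintro j ⟨hj, hj'⟩
  obtain ⟨g, hg, hgj⟩ := hj' (A ^ j) le_rfl
  refine CadlagSpace.dist_pi_le hε.le fun l s => ?_
  have hLσ' : log₂ (σ j) = L j := by simp [hLdef, hσdef]
  rw [normalizedProcess_apply, hLσ']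
  have hH : 0 < h (σ j) l := hh.pos _ _
  have hLj : 0 < L j := log₂_pos _
  have hAj : (0 : ℝ) < A ^ j := by positivity
  set Z : ℝ := (√(2 * (A ^ (j + 1) - A ^ j : ℕ) * h (σ j) l * L j))⁻¹ *
    centeredCount (fun i => U (i + A ^ j) ω) (A ^ (j + 1) - A ^ j) t (t + h (σ j) l * s) with hZ
  set Y : ℝ := (√(2 * (A ^ j : ℕ) * h (σ j) l * L j))⁻¹ *
    centeredCount (fun i => U i ω) (A ^ j) t (t + h (σ j) l * s) with hY
  have hZf : |Z - q * (f l).1 s| ≤ ε / 4 := by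
    have := hj l s s.2
    rwa [extendToReal_coe] at this
  have hYb : |Y| ≤ 2 := by
    have h1 : |Y - (g l).1 s| ≤ 1 := hgj l s
    have h2 := abs_apply_le_one_of_mem_strassenBall hg l s
    have h3 := abs_add_le (Y - (g l).1 s) ((g l).1 s)
    rw [sub_add_cancel] at h3
    linarith
  have hσj : A ^ j + (A ^ (j + 1) - A ^ j) = σ j := Nat.add_sub_cancel' (hple j)
  have hx := normalized_centeredCount_add_sample (fun i => U i ω) (m := A ^ j)
    (H := h (σ j) l) (L := L j)
    (n := A ^ (j + 1) - A ^ j) (κ := 1 / A) (by positivity) (by rwa [div_lt_one hA0]) (by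
      rw [hσj, hσdef]
      push_cast
      rw [pow_succ]
      field_simp) t (t + h (σ j) l * s)
  rw [hσj] at hx
  rw [hx]
  exact abs_block_sub_le (by positivity) ((div_lt_one hA0).2 hA1).le hq0.le hq1.le hYb hZf
    (abs_apply_le_one_of_mem_strassenBall hf l s) hqε hAinv hAsqrt

end

/-! ### Sequences approaching a compact set -/

/-- A sequence which approaches a compact set, and comes close infinitely often to every point of
a dense subset of it, has relatively compact range, and the compact set as its set of cluster
points. -/
theorem isCompact_closure_range_and_mapClusterPt_eq {E : Type*} [NormedAddCommGroup E] {x : ℕ → E}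
    {K D : Set E} (hK : IsCompact K) (hKne : K.Nonempty) (hDK : K ⊆ closure D)
    (hnear : ∀ m : ℕ, ∀ᶠ n in atTop, ∃ g ∈ K, dist (x n) g ≤ 1 / ((m : ℝ) + 1))
    (hfreq : ∀ f ∈ D, ∀ m : ℕ, ∃ᶠ n in atTop, dist (x n) f ≤ 1 / ((m : ℝ) + 1)) :
    IsCompact (closure (Set.range x)) ∧ {y | MapClusterPt y atTop x} = K := by
  have hinf : Tendsto (fun n => Metric.infDist (x n) K) atTop (𝓝 0) := by
    rw [Metric.tendsto_atTop]
    intro ε hε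
    obtain ⟨m, hm⟩ := exists_nat_one_div_lt hε
    obtain ⟨n₀, hn₀⟩ := eventually_atTop.1 (hnear m)
    refine ⟨n₀, fun n hn => ?_⟩
    obtain ⟨g, hg, hgn⟩ := hn₀ n hn
    rw [Real.dist_0_eq_abs, abs_of_nonneg Metric.infDist_nonneg]
    exact (Metric.infDist_le_dist_of_mem hg).trans_lt (hgn.trans_lt hm)
  choose y hyK hy using fun n => hK.exists_infDist_eq_dist hKne (x n)
  have he : Tendsto (fun n => x n - y n) atTop (𝓝 0) := by
    rw [tendsto_zero_iff_norm_tendsto_zero]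
    refine hinf.congr fun n => ?_
    rw [hy, dist_eq_norm]
  constructor
  · refine (hK.add he.isCompact_insert_range).closure_of_subset ?_
    rintro _ ⟨n, rfl⟩
    exact ⟨y n, hyK n, x n - y n, Set.mem_insert_of_mem _ ⟨n, rfl⟩, by simp⟩
  · ext z
    rw [Set.mem_ofPred_eq, mapClusterPt_iff_frequently]
    constructor
    · intro hz
      rw [hK.isClosed.mem_iff_infDist_zero hKne]
      refine le_antisymm (le_of_forall_pos_le_add fun ε hε => ?_) Metric.infDist_nonneg
      obtain ⟨n, hn1, hn2⟩ := ((hz _ (Metric.ball_mem_nhds z (half_pos hε))).and_eventually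
        (hinf.eventually_lt_const (half_pos hε))).exists
      have h1 := Metric.infDist_le_infDist_add_dist (s := K) (x := z) (y := x n)
      rw [Metric.mem_ball, dist_comm] at hn1
      linarith
    · intro hz s hs
      obtain ⟨ε, hε, hs⟩ := Metric.mem_nhds_iff.1 hs
      obtain ⟨f, hf, hzf⟩ := Metric.mem_closure_iff.1 (hDK hz) (ε / 2) (half_pos hε)
      obtain ⟨m, hm⟩ := exists_nat_one_div_lt (half_pos hε)
      refine (hfreq f hf m).mono fun n hn => hs ?_
      have h1 := dist_triangle (x n) f z
      rw [dist_comm z f] at hzf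
      rw [Metric.mem_ball]
      linarith

end LocalEmpirical

theorem theorem2 {Ω : Type*} [MeasurableSpace Ω] (P : Measure Ω) [IsProbabilityMeasure P]
    (U : ℕ → Ω → ℝ) (hU_meas : ∀ i, Measurable (U i)) (hU_indep : iIndepFun U P)
    (hU_unif : ∀ i, pdf.IsUniform (U i) (Set.Icc 0 1) P volume)
    (t : ℝ) (ht : t ∈ Set.Ico (0 : ℝ) 1)
    (k : ℕ) (hk : 2 ≤ k)
    (h : ℕ → Fin k → ℝ)
    (h_pos : ∀ n l, 0 < h n l) (h_lt_one : ∀ n l, h n l < 1) (h_mono : ∀ n, StrictMono (h n))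
    (h_ratio : ∀ l l' : Fin k, (l : ℕ) + 1 = l' →
      UltimatelyDecreasesToZero fun n => h n l / h n l')
    (h_last : UltimatelyDecreasesToZero fun n => h n ⟨k - 1, by omega⟩)
    (h_first : UltimatelyIncreasesToInfinity fun n => (n : ℝ) * h n ⟨0, by omega⟩)
    (h_first_log : Tendsto (fun n : ℕ => (n : ℝ) * h n ⟨0, by omega⟩ / log₂ n) atTop atTop) :
    ∀ᵐ ω ∂P,
      IsCompact (closure (Set.range fun (n : ℕ) (l : Fin k) =>
        normalizedProcess (fun i => U i ω) n (h n l) (h_pos n l).le t)) ∧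
      ClustersTo (fun (n : ℕ) (l : Fin k) =>
        normalizedProcess (fun i => U i ω) n (h n l) (h_pos n l).le t) (strassenBall k) := by
  have hh : IsBandwidthFamily h := IsBandwidthFamily.of_ultimately (by omega) h_pos h_mono h_ratio
    h_last h_first h_first_log
  have hU : IsIIDUniform U P := isIIDUniform_of_isUniform hU_meas hU_indep hU_unif
  have hK := isCompact_strassenBall k
  obtain ⟨D, hDK, hDc, hKD⟩ := hK.isSeparable.exists_countable_dense_subset
  have hnear : ∀ᵐ ω ∂P, ∀ m : ℕ, ∀ᶠ n in atTop, ∃ g ∈ strassenBall k,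
      dist (fun l => normalizedProcess (fun i => U i ω) n (h n l) (h_pos n l).le t) g ≤
        1 / ((m : ℝ) + 1) :=
    ae_all_iff.2 fun m => ae_eventually_near_strassenBall hh ht.1 ht.2 hU (by positivity)
  have hfreq : ∀ᵐ ω ∂P, ∀ f ∈ D, ∀ m : ℕ, ∃ᶠ n in atTop,
      dist (fun l => normalizedProcess (fun i => U i ω) n (h n l) (h_pos n l).le t) f ≤
        1 / ((m : ℝ) + 1) :=
    (ae_ball_iff hDc).2 fun f hf => ae_all_iff.2 fun m =>
      ae_frequently_dist_le hh ht.1 ht.2 hU (hDK hf) (by positivity)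
  filter_upwards [hnear, hfreq] with ω hω1 hω2
  obtain ⟨h1, h2⟩ := isCompact_closure_range_and_mapClusterPt_eq hK (strassenBall_nonempty k) hKD
    hω1 hω2
  exact ⟨h1, strassenBall_nonempty k, h2⟩
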